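/- **Setting and notation.** Use coordinates $q=(q^0,q^1,q^2,q^3)=(t,\xi^1,\xi^2,\underline u)$ on $\mathbb R^4$, $\mathbf q=(q^1,q^2,q^3)$, $\partial_\mu=\partial/\partial q^\mu$, and put $\mathfrak d=10^{-3}$. Matrix inequalities are meant in the sense of quadratic forms; $|\cdot|$ is the Euclidean norm, for matrices $|A|^2=\operatorname{tr}(A^TA)$. Let $\mathcal I=(t_0,t^*)$ with $-\infty<t_0<t^*<0$, let $b\in[1,2]$, and consider one of two families of open sets $\mathcal O(t)\subset\mathbb R^3$: * (A) slabs: $\mathcal O(t)=\mathbb R^2\times(0,b)$, with $t^*\le -1$; * (B) disk bundles: for $\xi_0\in\mathbb R^2$ and $t^*<-\mathfrak d^{-1}$, $\mathcal O(t)=\mathcal O(\xi_0,b,t)=\{(\xi,\underline u):0<\underline u<b,\ |\xi-\xi_0|<r'(t,\underline u)\}$ with $r'(t,\underline u)=\tfrac14+\tfrac1{18\mathfrak d}\,|b+\mathfrak d-\underline u|\cdot\bigl|2\mathfrak d-\tfrac1{\underline u+|t|}\bigr|$. Set $\mathcal U=\bigcup_{t\in\mathcal I}\{t\}\times\mathcal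 O(t)$. For a scalar, vector or matrix valued function $f$ on $\mathcal U$ with enough derivatives, let $$E^k\{f\}(t)=\sum_{\alpha\in\mathbb N_0^4,\,|\alpha|\le k}\int_{\mathcal O(t)}|\partial^\alpha f(t,\mathbf q)|^2\,d^3\mathbf q,\qquad \mathrm{Sup}^{(k)}\{f\}(t)=\sup_{|\alpha|\le k}\ \sup_{\mathbf q\in\mathcal O(t)}|\partial^\alpha f(t,\mathbf q)|.$$ At $t=t_0$ the derivatives are the continuous extensions from $\mathcal U$. **Hypotheses.** Let $R\ge0$ be an integer and $P=P_1+P_2+P_3\le10^9$, $\mathbb R^P=\mathbb R^{P_1}\oplus\mathbb R^{P_2}\oplus\mathbb R^{P_3}$; subscripts $m,n\in\{1,2,3\}$ denote blocks. On $\mathcal U$ let $M^\mu$ ($\mu=0,\dots,3$) and $H$ be real $P\times P$ matrix valued, and $\Theta$, $\mathrm{Src}$ be $\mathbb R^P$ valued functions such that: 1. $M^\mu$ is symmetric, $\tfrac12\le M^0\le2$, $M^3\ge0$, and $M^\mu\partial_\mu\Theta=H\Theta+\mathrm{Src}$. 2. $M^\mu,\Theta$ are $C^{R+1}$ and $H,\mathrm{Src}$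 are $C^R$ on $\mathcal U$, and all their derivatives of order $\le R+1$, respectively $\le R$, extend continuously to $\overline{\mathcal U}$. 3. $\Theta(t,\cdot)$ and $\mathrm{Src}(t,\cdot)$ are supported in a ball independent of $t$, and $\Theta$, $\mathrm{Src}$ vanish where $q^3<\tfrac12$. 4. $M^\mu$ is block diagonal, and the second diagonal block of $M^\mu\partial_\mu$ is $c(q)\,(\partial_0+\partial_3)$ times the identity for some function $c$. 5. $M_\infty^\mu$ are constant symmetric $P\times P$ matrices with $\tfrac12\le M_\infty^0\le2$, $M_\infty^1=M_\infty^2=0$, $M_\infty^3\ge0$; and $$H_\infty(t)=\begin{pmatrix}0&0&0\\ H_1&0&0\\ 0&|t|^{-1}H_2&|t|^{-1}H_3\end{pmatrix}$$ with constant matrices $H_1,H_2,H_3$ and $H_3\le0$. 6. There are $c_1\ge0$ and $J>0$ such that $|t|^{2J+2}E^R\{\mathrm{Src}_1\}(t)$, $|t|^{2J}E^R\{\mathrm{Src}_2\}(t)$ and $|t|^{2J+2}E^R\{\mathrm{Src}_3\}(t)$ are all $\le c_1^2$ for all $t\in\mathcal I$. 7. There is $c_2>0$ such that one of the following holds for all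 $t\in\mathcal I$, all $\mu$ and all $n$: * (a) $R\ge4$, and $|t|^2E^R\{M^\mu-M_\infty^\mu\}(t)$, $|t|^2E^R\{H_{1n}-(H_\infty)_{1n}\}(t)$, $E^R\{H_{2n}-(H_\infty)_{2n}\}(t)$, $|t|^2E^R\{H_{3n}-(H_\infty)_{3n}\}(t)$ are all $\le c_2^2$; * (b) $|t|\,\mathrm{Sup}^{(\max\{1,R\})}\{M^\mu-M_\infty^\mu\}(t)$, $|t|\,\mathrm{Sup}^{(R)}\{H_{1n}-(H_\infty)_{1n}\}(t)$, $\mathrm{Sup}^{(R)}\{H_{2n}-(H_\infty)_{2n}\}(t)$, $|t|\,\mathrm{Sup}^{(R)}\{H_{3n}-(H_\infty)_{3n}\}(t)$ are all $\le c_2$. 8. In case (B) only: on the lateral boundary $\partial\mathcal U\cap(\mathcal I\times\mathbb R^2\times(0,b))$ one has $\theta_\mu M^\mu\ge0$ (with $M^\mu$ extended continuously), where, with $u=q^0-q^3$ (so $du=dq^0-dq^3$), $d\underline u=dq^3$ and $k_1=\tfrac1{18\mathfrak d}$, $$\theta=\sum_{i=1}^2\frac{\xi^i-\xi_0^i}{|\xi-\xi_0|}\,d\xi^i+k_1\Bigl|\tfrac1{|u|}-2\mathfrak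 d\Bigr|\,d\underline u+k_1\frac{|b+\mathfrak d-\underline u|}{|u|^2}\,du .$$ **Proposition (Energy Estimate (A) and Refined Energy Estimate (B)).** In each of the cases (A) and (B) the following holds. Let $J_0>0$. There are constants $c_3\in(0,1)$ and $c_4>0$, depending only on $(R,J_0,|H_1|,|H_2|,|H_3|)$, such that if the hypotheses hold with $J\ge J_0$, $c_2\le c_3$ and $|t^*|^{-1}\le c_3$, then $E^R\{\Theta\}(t_0)$ and $E^R\{\Theta\}(\tau)$ are finite and $$\sqrt{E^R\{\Theta\}(\tau)}\ \le\ c_4\,\frac{|t_0|^J\sqrt{E^R\{\Theta\}(t_0)}+c_1}{|\tau|^J}\qquad\text{for all }\tau\in\mathcal I .$$ -/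

import Mathlib

open Set MeasureTheory
open scoped ENNReal Matrix

noncomputable section

namespace EnergyEstimate

/-- Spacetime with coordinates `q = (q⁰, q¹, q², q³) = (t, ξ¹, ξ², ū)`. Its points are only used
through differentiation and topology, which do not see the choice of norm. -/
abbrev Spacetime := Fin 4 → ℝ

/-- Space with coordinates `𝐪 = (q¹, q², q³) = (ξ¹, ξ², ū)`; the coordinate `x i` is `q^{i+1}`. -/
abbrev Space := Fin 3 → ℝ

/-- The spacetime point `(t, 𝐪)`. -/
def pt (t : ℝ) (x : Space) : Spacetime := Matrix.vecCons t x

/-- The spacetime region `⋃_{t ∈ I} {t} × O(t)`. -/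
def region (I : Set ℝ) (O : ℝ → Set Space) : Set Spacetime :=
  {q | q 0 ∈ I ∧ (fun i : Fin 3 => q i.succ) ∈ O (q 0)}

/-! ### Derivatives, energies and supremum norms -/

/-- The partial derivative `∂_μ = ∂/∂q^μ`. -/
def pd (μ : Fin 4) (f : Spacetime → ℝ) : Spacetime → ℝ :=
  fun q => fderiv ℝ f q (Pi.single μ 1)

/-- `∂^α = ∂_0^{α_0} ∂_1^{α_1} ∂_2^{α_2} ∂_3^{α_3}`. -/
def multiDeriv (α : Fin 4 → ℕ) (f : Spacetime → ℝ) : Spacetime → ℝ :=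
  (pd 0)^[α 0] ((pd 1)^[α 1] ((pd 2)^[α 2] ((pd 3)^[α 3] f)))

/-- The multi-indices `α ∈ ℕ⁴` with `|α| ≤ k`. -/
def multiIndices (k : ℕ) : Finset (Fin 4 → ℕ) :=
  (Fintype.piFinset fun _ : Fin 4 => Finset.range (k + 1)).filter fun α => ∑ μ, α μ ≤ k

/-- The derivative `∂^α f` on the open set `U`, extended by continuity to the closure of `U`. -/
def closedDeriv (U : Set Spacetime) (α : Fin 4 → ℕ) (f : Spacetime → ℝ) : Spacetime → ℝ :=
  extendFrom U (multiDeriv α f)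

/-- `f` (given by its components) is `C^n` on `U`, and all its derivatives of order at most `n`
extend continuously to the closure of `U`. -/
def CnClosure (n : ℕ) (U : Set Spacetime) {κ : Type} (f : Spacetime → κ → ℝ) : Prop :=
  ∀ i, ContDiffOn ℝ n (fun q => f q i) U ∧
    ∀ α ∈ multiIndices n, ∃ g : Spacetime → ℝ,
      ContinuousOn g (closure U) ∧ EqOn g (multiDeriv α fun q => f q i) U

/-- The square of the Euclidean norm of `∂^α f (q)`, for `f` given by its components. -/
def derivNormSq (U : Set Spacetime) {κ : Type} [Fintype κ] (f : Spacetime → κ → ℝ)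
    (α : Fin 4 → ℕ) (q : Spacetime) : ℝ :=
  ∑ i, (closedDeriv U α (fun q' => f q' i) q) ^ 2

/-- The energy `E^k_X{f}(t) = ∑_{|α| ≤ k} ∫_X d³𝐪 |∂^α f(t,𝐪)|²` of a field `f` on `U`, as an
extended nonnegative number. The time derivatives are included. For `t` at the end of the time
interval the derivatives are the continuous extensions. -/
def energy (U : Set Spacetime) (X : Set Space) (k : ℕ) {κ : Type} [Fintype κ]
    (f : Spacetime → κ → ℝ) (t : ℝ) : ℝ≥0∞ :=
  ∑ α ∈ multiIndices k, ∫⁻ x in X, ENNReal.ofReal (derivNormSq U f α (pt t x))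

/-- `Sup^{(k)}_X{f}(t) = sup_{|α| ≤ k} sup_{𝐪 ∈ X} |∂^α f(t,𝐪)|`. -/
def supNorm (U : Set Spacetime) (X : Set Space) (k : ℕ) {κ : Type} [Fintype κ]
    (f : Spacetime → κ → ℝ) (t : ℝ) : ℝ≥0∞ :=
  ⨆ α ∈ multiIndices k, ⨆ x ∈ X, ENNReal.ofReal √(derivNormSq U f α (pt t x))

/-! ### Matrices -/

/-- `A ≤ B` in the sense of quadratic forms. -/
def QuadLE {ι : Type} [Fintype ι] (A B : Matrix ι ι ℝ) : Prop :=
  ∀ v : ι → ℝ, v ⬝ᵥ (A *ᵥ v) ≤ v ⬝ᵥ (B *ᵥ v)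

/-- The Euclidean norm of a matrix, `|A|² = tr(AᵀA)`. -/
def matNorm {ι κ : Type} [Fintype ι] [Fintype κ] (A : Matrix ι κ ℝ) : ℝ := √((Aᵀ * A).trace)

/-- A matrix-valued function as a function with values in the space of its entries. -/
def entries {ι κ : Type} (A : Spacetime → Matrix ι κ ℝ) : Spacetime → ι × κ → ℝ :=
  fun q p => A q p.1 p.2

/-- The index set of `ℝ^P = ℝ^{P_1} ⊕ ℝ^{P_2} ⊕ ℝ^{P_3}`. Blocks are numbered `0, 1, 2`. -/
abbrev Idx (P : Fin 3 → ℕ) : Type := Σ m : Fin 3, Fin (P m)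

/-- The block `f_m` of a vector-valued function. -/
def vecBlock {P : Fin 3 → ℕ} (m : Fin 3) (f : Spacetime → Idx P → ℝ) :
    Spacetime → Fin (P m) → ℝ :=
  fun q i => f q ⟨m, i⟩

/-- The block `A_{mn}` of a matrix-valued function. -/
def matBlock {P : Fin 3 → ℕ} (m n : Fin 3) (A : Spacetime → Matrix (Idx P) (Idx P) ℝ) :
    Spacetime → Matrix (Fin (P m)) (Fin (P n)) ℝ :=
  fun q => Matrix.of fun i j => A q ⟨m, i⟩ ⟨n, j⟩

/-! ### The system -/

/-- The data: coefficient matrices `M^μ`, `H`, the source, the field `Θ`, and the asymptotic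
matrices. -/
structure SystemData (P : Fin 3 → ℕ) where
  M : Fin 4 → Spacetime → Matrix (Idx P) (Idx P) ℝ
  H : Spacetime → Matrix (Idx P) (Idx P) ℝ
  Src : Spacetime → Idx P → ℝ
  Θ : Spacetime → Idx P → ℝ
  Mₐ : Fin 4 → Matrix (Idx P) (Idx P) ℝ
  H₁ : Matrix (Fin (P 1)) (Fin (P 0)) ℝ
  H₂ : Matrix (Fin (P 2)) (Fin (P 1)) ℝ
  H₃ : Matrix (Fin (P 2)) (Fin (P 2)) ℝ

variable {P : Fin 3 → ℕ}

/-- The asymptotic matrix with block rows `(0, 0, 0)`, `(H₁, 0, 0)`, `(0, |t|⁻¹ H₂, |t|⁻¹ H₃)`. -/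
def SystemData.Hₐ (S : SystemData P) (t : ℝ) : Matrix (Idx P) (Idx P) ℝ :=
  Matrix.of fun a b =>
    match a, b with
    | ⟨1, i⟩, ⟨0, j⟩ => S.H₁ i j
    | ⟨2, i⟩, ⟨1, j⟩ => |t|⁻¹ * S.H₂ i j
    | ⟨2, i⟩, ⟨2, j⟩ => |t|⁻¹ * S.H₃ i j
    | _, _ => 0

/-- The structural hypotheses on the region `U = ⋃_{t ∈ (t₀, t₁)} {t} × O(t)`, with `R` the
order of differentiability. -/
structure SystemData.IsAdmissible (S : SystemData P) (R : ℕ) (t₀ t₁ : ℝ) (O : ℝ → Set Space) :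
    Prop where
  M_symm : ∀ μ, ∀ q ∈ region (Ioo t₀ t₁) O, (S.M μ q).IsSymm
  M_zero_lower : ∀ q ∈ region (Ioo t₀ t₁) O, QuadLE ((1 / 2 : ℝ) • 1) (S.M 0 q)
  M_zero_upper : ∀ q ∈ region (Ioo t₀ t₁) O, QuadLE (S.M 0 q) ((2 : ℝ) • 1)
  M_three_nonneg : ∀ q ∈ region (Ioo t₀ t₁) O, QuadLE 0 (S.M 3 q)
  /-- The system `M^μ ∂_μ Θ = H Θ + Src`. -/
  equation : ∀ q ∈ region (Ioo t₀ t₁) O,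
    ∑ μ, S.M μ q *ᵥ (fun a => pd μ (fun q' => S.Θ q' a) q) = S.H q *ᵥ S.Θ q + S.Src q
  M_regular : ∀ μ, CnClosure (R + 1) (region (Ioo t₀ t₁) O) (entries (S.M μ))
  Θ_regular : CnClosure (R + 1) (region (Ioo t₀ t₁) O) S.Θ
  H_regular : CnClosure R (region (Ioo t₀ t₁) O) (entries S.H)
  Src_regular : CnClosure R (region (Ioo t₀ t₁) O) S.Src
  /-- Supports in a ball which does not depend on the time. -/
  support_ball : ∃ ρ : ℝ, ∀ t ∈ Ioo t₀ t₁, ∀ x ∈ O t, ρ ≤ ‖x‖ →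
    S.Θ (pt t x) = 0 ∧ S.Src (pt t x) = 0
  support_lower : ∀ q ∈ region (Ioo t₀ t₁) O, q 3 < 1 / 2 → S.Θ q = 0 ∧ S.Src q = 0
  /-- Block-diagonality of `M^μ`. -/
  M_blockDiag : ∀ μ, ∀ q ∈ region (Ioo t₀ t₁) O, ∀ m n, m ≠ n → matBlock m n (S.M μ) q = 0
  /-- The second diagonal block of the operator is a function times `∂_0 + ∂_3`. -/
  M_second : ∃ c : Spacetime → ℝ, ∀ q ∈ region (Ioo t₀ t₁) O,
    matBlock 1 1 (S.M 0) q = c q • 1 ∧ matBlock 1 1 (S.M 1) q = 0 ∧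
    matBlock 1 1 (S.M 2) q = 0 ∧ matBlock 1 1 (S.M 3) q = c q • 1
  Mₐ_symm : ∀ μ, (S.Mₐ μ).IsSymm
  Mₐ_zero_lower : QuadLE ((1 / 2 : ℝ) • 1) (S.Mₐ 0)
  Mₐ_zero_upper : QuadLE (S.Mₐ 0) ((2 : ℝ) • 1)
  Mₐ_one : S.Mₐ 1 = 0
  Mₐ_two : S.Mₐ 2 = 0
  Mₐ_three_nonneg : QuadLE 0 (S.Mₐ 3)
  H₃_nonpos : QuadLE S.H₃ 0

/-- The decay hypothesis on the source. -/
def SystemData.SourceDecay (S : SystemData P) (R : ℕ) (t₀ t₁ : ℝ) (O : ℝ → Set Space)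
    (J c₁ : ℝ) : Prop :=
  ∀ t ∈ Ioo t₀ t₁,
    ENNReal.ofReal (|t| ^ (2 * J + 2)) *
      energy (region (Ioo t₀ t₁) O) (O t) R (vecBlock 0 S.Src) t ≤ ENNReal.ofReal (c₁ ^ 2) ∧
    ENNReal.ofReal (|t| ^ (2 * J)) *
      energy (region (Ioo t₀ t₁) O) (O t) R (vecBlock 1 S.Src) t ≤ ENNReal.ofReal (c₁ ^ 2) ∧
    ENNReal.ofReal (|t| ^ (2 * J + 2)) *
      energy (region (Ioo t₀ t₁) O) (O t) R (vecBlock 2 S.Src) t ≤ ENNReal.ofReal (c₁ ^ 2)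

/-- The difference `M^μ - Mₐ^μ`. -/
def SystemData.δM (S : SystemData P) (μ : Fin 4) : Spacetime → Idx P × Idx P → ℝ :=
  entries fun q => S.M μ q - S.Mₐ μ

/-- The block `H_{mn} - (Hₐ)_{mn}` of the difference. -/
def SystemData.δH (S : SystemData P) (m n : Fin 3) : Spacetime → Fin (P m) × Fin (P n) → ℝ :=
  entries (matBlock m n fun q => S.H q - S.Hₐ (q 0))

/-- The decay hypothesis on the coefficients in terms of energies. -/
def SystemData.CoeffEnergyDecay (S : SystemData P) (R : ℕ) (t₀ t₁ : ℝ) (O : ℝ → Set Space)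
    (c₂ : ℝ) : Prop :=
  ∀ t ∈ Ioo t₀ t₁,
    (∀ μ, ENNReal.ofReal (|t| ^ 2) *
      energy (region (Ioo t₀ t₁) O) (O t) R (S.δM μ) t ≤ ENNReal.ofReal (c₂ ^ 2)) ∧
    ∀ n,
      ENNReal.ofReal (|t| ^ 2) *
        energy (region (Ioo t₀ t₁) O) (O t) R (S.δH 0 n) t ≤ ENNReal.ofReal (c₂ ^ 2) ∧
      energy (region (Ioo t₀ t₁) O) (O t) R (S.δH 1 n) t ≤ ENNReal.ofReal (c₂ ^ 2) ∧
      ENNReal.ofReal (|t| ^ 2) *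
        energy (region (Ioo t₀ t₁) O) (O t) R (S.δH 2 n) t ≤ ENNReal.ofReal (c₂ ^ 2)

/-- The decay hypothesis on the coefficients in terms of supremum norms. -/
def SystemData.CoeffSupDecay (S : SystemData P) (R : ℕ) (t₀ t₁ : ℝ) (O : ℝ → Set Space)
    (c₂ : ℝ) : Prop :=
  ∀ t ∈ Ioo t₀ t₁,
    (∀ μ, ENNReal.ofReal |t| *
      supNorm (region (Ioo t₀ t₁) O) (O t) (max 1 R) (S.δM μ) t ≤ ENNReal.ofReal c₂) ∧
    ∀ n,
      ENNReal.ofReal |t| *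
        supNorm (region (Ioo t₀ t₁) O) (O t) R (S.δH 0 n) t ≤ ENNReal.ofReal c₂ ∧
      supNorm (region (Ioo t₀ t₁) O) (O t) R (S.δH 1 n) t ≤ ENNReal.ofReal c₂ ∧
      ENNReal.ofReal |t| *
        supNorm (region (Ioo t₀ t₁) O) (O t) R (S.δH 2 n) t ≤ ENNReal.ofReal c₂

/-- The energy `E^R_{O(t)}{Θ}(t)` of the field in the slice `O(t)`. -/
def SystemData.fieldEnergy (S : SystemData P) (R : ℕ) (t₀ t₁ : ℝ) (O : ℝ → Set Space)
    (t : ℝ) : ℝ≥0∞ :=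
  energy (region (Ioo t₀ t₁) O) (O t) R S.Θ t

/-! ### The domains -/

/-- `O(b) = ℝ² × (0, b)`. -/
def slab (b : ℝ) : Set Space := {x | x 2 ∈ Ioo 0 b}

/-- The constant `𝔡 = 10⁻³`. -/
def dd : ℝ := 1 / 1000

/-- `r'(t, ū) = 1/4 + (1/(18𝔡)) |b + 𝔡 - ū| |2𝔡 - 1/(ū + |t|)|`. -/
def radius (b t y : ℝ) : ℝ :=
  1 / 4 + 1 / (18 * dd) * |b + dd - y| * |2 * dd - 1 / (y + |t|)|

/-- The disk bundle `O(ξ₀, b, t) = ⋃_{ū ∈ (0,b)} D_{r'(t,ū)}(ξ₀) × {ū}`. -/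
def diskBundle (ξ₀ : EuclideanSpace ℝ (Fin 2)) (b t : ℝ) : Set Space :=
  {x | x 2 ∈ Ioo 0 b ∧ !₂[x 0, x 1] ∈ Metric.ball ξ₀ (radius b t (x 2))}

/-- The components `θ_μ` with respect to `dq^μ` of the outward conormal
`θ = ∑ ξ̂^i dξ^i + k₁ |1/|u| - 1/|u₀|| dū + k₁ (|ū₀ - ū|/|u|²) du` of the lateral boundary, where
`ξ̂ = (ξ - ξ₀)/|ξ - ξ₀|`, `k₁ = 1/(18𝔡)`, `1/|u₀| = 2𝔡`, `ū₀ = b + 𝔡`, `ū = q³`, `u = q⁰ - q³`;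
thus `dū = dq³` and `du = dq⁰ - dq³`. -/
def conormal (ξ₀ : EuclideanSpace ℝ (Fin 2)) (b : ℝ) (q : Spacetime) : Fin 4 → ℝ :=
  let ξ : EuclideanSpace ℝ (Fin 2) := !₂[q 1, q 2]
  let u : ℝ := q 0 - q 3
  let k₁ : ℝ := 1 / (18 * dd)
  let θū : ℝ := k₁ * |1 / |u| - 2 * dd|
  let θu : ℝ := k₁ * (|b + dd - q 3| / |u| ^ 2)
  ![θu, (ξ 0 - ξ₀ 0) / ‖ξ - ξ₀‖, (ξ 1 - ξ₀ 1) / ‖ξ - ξ₀‖, θū - θu]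

/-- `θ_μ M^μ ≥ 0` on the lateral boundary `∂U ∩ ((t₀,t₁) × ℝ² × (0,b))`, where `M^μ` is extended
by continuity to the closure of `U`. -/
def SystemData.LateralBoundaryNonTimelike (S : SystemData P) (t₀ t₁ : ℝ)
    (ξ₀ : EuclideanSpace ℝ (Fin 2)) (b : ℝ) : Prop :=
  ∀ q ∈ frontier (region (Ioo t₀ t₁) (diskBundle ξ₀ b)), q 0 ∈ Ioo t₀ t₁ → q 3 ∈ Ioo 0 b →
    QuadLE 0 (∑ μ, conormal ξ₀ b q μ •
      Matrix.of fun a a' =>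
        extendFrom (region (Ioo t₀ t₁) (diskBundle ξ₀ b)) (fun q' => S.M μ q' a a') q)

end EnergyEstimate

end

open EnergyEstimate

open Set MeasureTheory
open scoped ENNReal Matrix

noncomputable section

namespace EnergyEstimate


/-! The proof is a weighted energy method for the commuted system, closed by suprema over time
instead of a Gronwall argument. Each `∂^α` with `|α| ≤ R` is applied to the system. Derivatives
falling on `M^μ` see only `M^μ - M_∞^μ`, since `M_∞^μ` is constant. Together with `H - H_∞` and the
source they form a remainder whose square integral is bounded by the source energy plus `c₂²` times
the full energy (`sqBd_remainder`). In each Leibniz product one factor is put in `L^∞`: the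
coefficient, directly or by a Sobolev inequality on convex slices (`sobolev_slice`), or, if the
coefficient carries almost all derivatives, the field. This last case is where `R ≥ 4` enters
(`product_estimate`).

For each diagonal block and each derivative `v`, the current `w v·M^μ v` with a weight `w` goes into
a divergence inequality (`divergence_le`, `energy_inequality`). Its boundary terms can be dropped:
near `ū = 0` the field vanishes, `M³ ≥ 0` makes the top an outflow boundary, and on the lateral
boundary of a disk bundle `θ_μ M^μ ≥ 0`. That last sign is not strict, so it says nothing about a
collar of the boundary; a small multiple of an outward field is added, and removed in the limit.

The weights depend on the block. In blocks 1 and 3 the errors carry a factor `|t|⁻¹`, which is not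
integrable in time. With the weight `|t|^(2J - J₀)`, and energies bounded by `A |t|^(-2J)`, the
errors become `|t|^(-1 - J₀)`, with integral of order `1/J₀` (`word_decay`). In block 2 the errors
have no decay relative to the energy, but the operator there is a multiple of `∂₀ + ∂₃`, whose
characteristics cross the slab in bounded time. The weight `exp(t - ū)` is constant along them, is
comparable to `exp t`, and makes such errors integrable (`word_transport`).

If `A_m` denotes the supremum over time of `|t|^(2J)` times the energy of block `m`, this gives
three scalar inequalities. The coupling through `H₁` and `H₂` is triangular: `A₀` is controlled by
the data, `A₁` by `A₀`, and `A₂` by `A₁`, up to small multiples of the total. The undifferentiated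
`|t|⁻¹ H₃` has a good sign, and its commutators gain a further `|t|⁻¹ ≤ c₃`. For `c₂` and `|t*|⁻¹`
small everything is absorbed (`exists_closing_constants`), because the suprema are finite beforehand
by compact support and continuity up to the closure.

Both families of domains are instances of `SliceDomain`, so the two statements follow from the
single estimate `exists_energy_estimate`. -/

/-! ### Iterated partial derivatives along words -/

/-- The iterated partial derivative along a word of coordinate indices. -/
def wd : List (Fin 4) → (Spacetime → ℝ) → Spacetime → ℝ
  | [], f => f
  | i :: L, f => pd i (wd L f)

@[simp] theorem wd_nil (f : Spacetime → ℝ) : wd [] f = f := rfl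

@[simp] theorem wd_cons (i : Fin 4) (L : List (Fin 4)) (f : Spacetime → ℝ) :
    wd (i :: L) f = pd i (wd L f) := rfl

theorem wd_append (A B : List (Fin 4)) (f : Spacetime → ℝ) : wd (A ++ B) f = wd A (wd B f) := by
  induction A with
  | nil => rfl
  | cons i A ih => simp [ih]

theorem wd_replicate (n : ℕ) (i : Fin 4) (f : Spacetime → ℝ) :
    wd (List.replicate n i) f = (pd i)^[n] f := by
  induction n with
  | zero => rfl
  | succ n ih => rw [List.replicate_succ, wd_cons, ih, Function.iterate_succ_apply']

/-- The sorted word of a multi-index. -/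
def word (α : Fin 4 → ℕ) : List (Fin 4) :=
  List.replicate (α 0) 0 ++ (List.replicate (α 1) 1 ++
    (List.replicate (α 2) 2 ++ List.replicate (α 3) 3))

theorem wd_word (α : Fin 4 → ℕ) (f : Spacetime → ℝ) : wd (word α) f = multiDeriv α f := by
  simp [word, wd_append, wd_replicate, multiDeriv]

theorem length_word (α : Fin 4 → ℕ) : (word α).length = ∑ μ, α μ := by
  simp [word, Fin.sum_univ_four]; ring

/-- The multi-index of a word. -/
def windex (L : List (Fin 4)) : Fin 4 → ℕ := fun i => L.count i

theorem sum_windex (L : List (Fin 4)) : ∑ μ, windex L μ = L.length := by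
  induction L with
  | nil => simp [windex]
  | cons i L ih =>
    simp only [windex, List.count_cons, Finset.sum_add_distrib] at ih ⊢
    rw [ih]
    simp

theorem windex_mem {L : List (Fin 4)} {k : ℕ} (h : L.length ≤ k) : windex L ∈ multiIndices k := by
  simp only [multiIndices, Finset.mem_filter, Fintype.mem_piFinset, Finset.mem_range]
  refine ⟨fun i => ?_, by rw [sum_windex]; exact h⟩
  have := List.count_le_length (a := i) (l := L)
  simp only [windex]; omega

theorem sum_le_of_mem_multiIndices {α : Fin 4 → ℕ} {k : ℕ} (h : α ∈ multiIndices k) :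
    ∑ μ, α μ ≤ k := (Finset.mem_filter.1 h).2

theorem perm_word_windex (L : List (Fin 4)) : L.Perm (word (windex L)) := by
  rw [List.perm_iff_count]
  intro i
  simp only [word, windex, List.count_append, List.count_replicate]
  fin_cases i <;> simp

variable {U : Set Spacetime}

theorem pd_congr (hU : IsOpen U) {f g : Spacetime → ℝ} (h : EqOn f g U) (i : Fin 4) :
    EqOn (pd i f) (pd i g) U := fun q hq => by
  have : f =ᶠ[nhds q] g := Filter.eventuallyEq_of_mem (hU.mem_nhds hq) h
  simp only [pd, this.fderiv_eq]

theorem wd_congr (hU : IsOpen U) {f g : Spacetime → ℝ} (h : EqOn f g U) (L : List (Fin 4)) :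
    EqOn (wd L f) (wd L g) U := by
  induction L with
  | nil => exact h
  | cons i L ih => exact pd_congr hU ih i

theorem pd_contDiffOn (hU : IsOpen U) {f : Spacetime → ℝ} {n : ℕ}
    (hf : ContDiffOn ℝ (n + 1 : ℕ) f U) (i : Fin 4) : ContDiffOn ℝ n (pd i f) U := by
  have h := hf.fderiv_of_isOpen hU (m := n) (by norm_cast)
  exact h.clm_apply contDiffOn_const

theorem wd_contDiffOn (hU : IsOpen U) {f : Spacetime → ℝ} (L : List (Fin 4)) {n : ℕ}
    (hf : ContDiffOn ℝ (n + L.length : ℕ) f U) : ContDiffOn ℝ n (wd L f) U := by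
  induction L generalizing n with
  | nil => simpa using hf
  | cons i L ih =>
    refine pd_contDiffOn hU (ih ?_) i
    convert hf using 2
    simp; ring

theorem pd_comm (hU : IsOpen U) {f : Spacetime → ℝ} (hf : ContDiffOn ℝ 2 f U) (i j : Fin 4) :
    EqOn (pd i (pd j f)) (pd j (pd i f)) U := fun q hq => by
  have hfq : ContDiffAt ℝ 2 f q := hf.contDiffAt (hU.mem_nhds hq)
  have hs : IsSymmSndFDerivAt ℝ f q := hfq.isSymmSndFDerivAt (by simp)
  have hd : DifferentiableAt ℝ (fderiv ℝ f) q :=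
    (hfq.fderiv_right (m := 1) (by norm_num)).differentiableAt (by norm_num)
  have key : ∀ a b : Fin 4, pd a (pd b f) q
      = fderiv ℝ (fderiv ℝ f) q (Pi.single a 1) (Pi.single b 1) := fun a b => by
    have : pd b f = fun q => fderiv ℝ f q (Pi.single b 1) := rfl
    rw [this]
    simp only [pd]
    rw [fderiv_clm_apply hd (differentiableAt_const _)]
    simp
  rw [key, key]
  exact hs _ _

/-- Adjacent transpositions generate all permutations, and each one is the symmetry of a second
derivative of the inner word. Differentiability of order `A.length` is just enough: it leaves the
inner word `C²`. -/
theorem wd_perm (hU : IsOpen U) {A B : List (Fin 4)} (h : A.Perm B) {f : Spacetime → ℝ}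
    (hf : ContDiffOn ℝ A.length f U) : EqOn (wd A f) (wd B f) U := by
  induction h with
  | nil => exact fun _ _ => rfl
  | cons i h ih =>
    exact pd_congr hU (ih (hf.of_le (by simp))) i
  | swap i j L =>
    have : ContDiffOn ℝ (2 : ℕ) (wd L f) U := wd_contDiffOn hU L (hf.of_le (by
      simp only [List.length_cons]; norm_cast; omega))
    exact pd_comm hU (by exact_mod_cast this) j i
  | trans h₁ h₂ ih₁ ih₂ =>
    exact (ih₁ hf).trans (ih₂ (by rwa [← h₁.length_eq]))

/-- Words are convenient for induction in the Leibniz rule, multi-indices index the energies;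
sorting the letters connects the two. -/
theorem wd_eq_multiDeriv (hU : IsOpen U) (L : List (Fin 4)) {f : Spacetime → ℝ}
    (hf : ContDiffOn ℝ L.length f U) : EqOn (wd L f) (multiDeriv (windex L) f) U := by
  rw [← wd_word]
  exact wd_perm hU (perm_word_windex L) hf

theorem wd_pd (hU : IsOpen U) (L : List (Fin 4)) (i : Fin 4) {f : Spacetime → ℝ}
    (hf : ContDiffOn ℝ (L.length + 1 : ℕ) f U) : EqOn (wd L (pd i f)) (pd i (wd L f)) U := by
  have h1 : wd L (pd i f) = wd (L ++ [i]) f := by simp [wd_append]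
  rw [h1, ← wd_cons]
  exact wd_perm hU (List.perm_append_singleton i L) (by simpa using hf)

theorem differentiableAt_of_contDiffOn (hU : IsOpen U) {f : Spacetime → ℝ} {n : ℕ}
    (hf : ContDiffOn ℝ n f U) (hn : n ≠ 0) {q : Spacetime} (hq : q ∈ U) :
    DifferentiableAt ℝ f q :=
  (hf.contDiffAt (hU.mem_nhds hq)).differentiableAt (by exact_mod_cast hn)

theorem pd_mul {f g : Spacetime → ℝ} {q : Spacetime} (hf : DifferentiableAt ℝ f q)
    (hg : DifferentiableAt ℝ g q) (i : Fin 4) :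
    pd i (fun q => f q * g q) q = pd i f q * g q + f q * pd i g q := by
  simp only [pd]
  rw [fderiv_fun_mul hf hg]
  simp; ring

theorem pd_add {f g : Spacetime → ℝ} {q : Spacetime} (hf : DifferentiableAt ℝ f q)
    (hg : DifferentiableAt ℝ g q) (i : Fin 4) :
    pd i (fun q => f q + g q) q = pd i f q + pd i g q := by
  simp only [pd]
  rw [fderiv_fun_add hf hg]
  simp

theorem pd_const (c : ℝ) (i : Fin 4) (q : Spacetime) : pd i (fun _ => c) q = 0 := by
  simp [pd]

theorem pd_const_mul {f : Spacetime → ℝ} {q : Spacetime} (hf : DifferentiableAt ℝ f q) (c : ℝ)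
    (i : Fin 4) : pd i (fun q => c * f q) q = c * pd i f q := by
  rw [pd_mul (differentiableAt_const c) hf, pd_const]; ring

theorem pd_sum {ι : Type*} (s : Finset ι) {f : ι → Spacetime → ℝ} {q : Spacetime}
    (hf : ∀ a ∈ s, DifferentiableAt ℝ (f a) q) (i : Fin 4) :
    pd i (fun q => ∑ a ∈ s, f a q) q = ∑ a ∈ s, pd i (f a) q := by
  simp only [pd]
  rw [fderiv_fun_sum hf]
  simp

theorem wd_add (hU : IsOpen U) (L : List (Fin 4)) {f g : Spacetime → ℝ}
    (hf : ContDiffOn ℝ L.length f U) (hg : ContDiffOn ℝ L.length g U) :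
    EqOn (wd L fun q => f q + g q) (fun q => wd L f q + wd L g q) U := by
  induction L with
  | nil => exact fun _ _ => rfl
  | cons i L ih =>
    have hle : ((L.length : ℕ) : WithTop ℕ∞) ≤ ((i :: L).length : ℕ) := by simp
    intro q hq
    rw [wd_cons, pd_congr hU (ih (hf.of_le hle) (hg.of_le hle)) i hq]
    have h1 : ∀ {h : Spacetime → ℝ}, ContDiffOn ℝ (i :: L).length h U →
        DifferentiableAt ℝ (wd L h) q := fun hh =>
      differentiableAt_of_contDiffOn hU (n := 1) (wd_contDiffOn hU L (hh.of_le (by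
        simp [add_comm]))) one_ne_zero hq
    exact pd_add (h1 hf) (h1 hg) i

theorem wd_zero (L : List (Fin 4)) : wd L (fun _ => 0) = fun _ => 0 := by
  induction L with
  | nil => rfl
  | cons i L ih => rw [wd_cons, ih]; funext q; exact pd_const 0 i q

theorem wd_sum (hU : IsOpen U) (L : List (Fin 4)) {ι : Type*} (s : Finset ι)
    {f : ι → Spacetime → ℝ} (hf : ∀ a ∈ s, ContDiffOn ℝ L.length (f a) U) :
    EqOn (wd L fun q => ∑ a ∈ s, f a q) (fun q => ∑ a ∈ s, wd L (f a) q) U := by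
  classical
  induction s using Finset.induction_on with
  | empty => intro q _; simp [wd_zero]
  | insert a s ha ih =>
    have h1 := fun b (hb : b ∈ s) => hf b (Finset.mem_insert_of_mem hb)
    intro q hq
    simp only [Finset.sum_insert ha]
    refine (wd_add hU L (hf a (Finset.mem_insert_self a s)) (ContDiffOn.sum h1) hq).trans ?_
    exact congrArg _ (ih h1 hq)

theorem wd_const_cons (c : ℝ) (i : Fin 4) (L : List (Fin 4)) :
    wd (i :: L) (fun _ => c) = fun _ => 0 := by
  induction L generalizing i with
  | nil => exact funext (pd_const c i)
  | cons j L ih => rw [wd_cons, ih j]; funext q; exact pd_const 0 i q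

theorem wd_sub_const (hU : IsOpen U) (i : Fin 4) (L : List (Fin 4)) {f : Spacetime → ℝ} (c : ℝ)
    (hf : ContDiffOn ℝ (i :: L).length f U) :
    EqOn (wd (i :: L) fun q => f q - c) (wd (i :: L) f) U := by
  intro q hq
  have h := wd_add hU (i :: L) hf (contDiffOn_const (c := -c)) hq
  rw [wd_const_cons] at h
  simpa [sub_eq_add_neg] using h

/-- The ways to distribute the letters of a word over two factors. -/
def splits : List (Fin 4) → List (List (Fin 4) × List (Fin 4))
  | [] => [([], [])]
  | i :: L => (splits L).map (fun p => (i :: p.1, p.2)) ++ (splits L).map (fun p => (p.1, i :: p.2))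

/-- The ways to distribute the letters of a word over two factors, the first one receiving at
least one letter. -/
def splits' : List (Fin 4) → List (List (Fin 4) × List (Fin 4))
  | [] => []
  | i :: L => ([i], L) :: ((splits' L).map (fun p => (i :: p.1, p.2)) ++
      (splits' L).map (fun p => (p.1, i :: p.2)))

theorem length_of_mem_splits {L : List (Fin 4)} {p} (hp : p ∈ splits L) :
    p.1.length + p.2.length = L.length := by
  induction L generalizing p with
  | nil => simp [splits] at hp; simp [hp]
  | cons i L ih =>
    simp only [splits, List.mem_append, List.mem_map] at hp
    rcases hp with ⟨r, hr, rfl⟩ | ⟨r, hr, rfl⟩ <;> have := ih hr <;> simp <;> omega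

theorem length_of_mem_splits' {L : List (Fin 4)} {p} (hp : p ∈ splits' L) :
    p.1.length + p.2.length = L.length ∧ p.1 ≠ [] := by
  induction L generalizing p with
  | nil => simp [splits'] at hp
  | cons i L ih =>
    simp only [splits', List.mem_cons, List.mem_append, List.mem_map] at hp
    rcases hp with rfl | ⟨r, hr, rfl⟩ | ⟨r, hr, rfl⟩
    · simp [add_comm]
    · have := ih hr; simp; omega
    · have := ih hr; simp; exact ⟨by omega, this.2⟩

theorem length_splits (L : List (Fin 4)) : (splits L).length = 2 ^ L.length := by
  induction L with
  | nil => rfl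
  | cons i L ih => simp [splits, ih]; ring

theorem length_splits' (L : List (Fin 4)) : (splits' L).length + 1 = 2 ^ L.length := by
  induction L with
  | nil => rfl
  | cons i L ih => simp [splits', pow_succ]; omega

theorem pd_list_sum {ι : Type*} (s : List ι) {f : ι → Spacetime → ℝ} {q : Spacetime}
    (hf : ∀ a ∈ s, DifferentiableAt ℝ (f a) q) (i : Fin 4) :
    pd i (fun q => (s.map fun a => f a q).sum) q = (s.map fun a => pd i (f a) q).sum := by
  have key : DifferentiableAt ℝ (fun q => (s.map fun a => f a q).sum) q ∧
      pd i (fun q => (s.map fun a => f a q).sum) q = (s.map fun a => pd i (f a) q).sum := by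
    induction s with
    | nil => simp [pd_const]
    | cons a s ih =>
      have h := ih fun b hb => hf b (List.mem_cons_of_mem a hb)
      have ha := hf a List.mem_cons_self
      simp only [List.map_cons, List.sum_cons]
      exact ⟨ha.add h.1, by rw [pd_add ha h.1, h.2]⟩
  exact key.2

theorem list_sum_map_add {ι : Type*} (s : List ι) (f g : ι → ℝ) :
    (s.map fun a => f a + g a).sum = (s.map f).sum + (s.map g).sum := by
  induction s with
  | nil => simp
  | cons a s ih => simp [ih]; ring

/-- Leibniz rule. -/
theorem wd_mul (hU : IsOpen U) (L : List (Fin 4)) {f g : Spacetime → ℝ}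
    (hf : ContDiffOn ℝ L.length f U) (hg : ContDiffOn ℝ L.length g U) :
    EqOn (wd L fun q => f q * g q)
      (fun q => ((splits L).map fun p => wd p.1 f q * wd p.2 g q).sum) U := by
  induction L with
  | nil => intro q _; simp [splits]
  | cons i L ih =>
    have hle : ((L.length : ℕ) : WithTop ℕ∞) ≤ ((i :: L).length : ℕ) := by simp
    intro q hq
    rw [wd_cons, pd_congr hU (ih (hf.of_le hle) (hg.of_le hle)) i hq]
    have h1 : ∀ {h : Spacetime → ℝ}, ContDiffOn ℝ (i :: L).length h U → ∀ A : List (Fin 4),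
        A.length ≤ L.length → DifferentiableAt ℝ (wd A h) q := fun hh A hA =>
      differentiableAt_of_contDiffOn hU (n := 1) (wd_contDiffOn hU A (hh.of_le (by
        simp only [List.length_cons]; norm_cast; omega))) one_ne_zero hq
    have hd : ∀ p ∈ splits L, DifferentiableAt ℝ (wd p.1 f) q ∧ DifferentiableAt ℝ (wd p.2 g) q :=
      fun p hp => by
        have := length_of_mem_splits hp
        exact ⟨h1 hf _ (by omega), h1 hg _ (by omega)⟩
    rw [pd_list_sum (splits L) (f := fun p q => wd p.1 f q * wd p.2 g q)
      (fun p hp => (hd p hp).1.mul (hd p hp).2)]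
    have : (splits L).map (fun p => pd i (fun q => wd p.1 f q * wd p.2 g q) q)
        = (splits L).map (fun p => wd (i :: p.1) f q * wd p.2 g q
          + wd p.1 f q * wd (i :: p.2) g q) :=
      List.map_congr_left fun p hp => pd_mul (hd p hp).1 (hd p hp).2 i
    rw [this, list_sum_map_add]
    simp [splits, Function.comp_def]

/-- Leibniz rule, with the term without derivatives on the first factor singled out. -/
theorem splits_sum (L : List (Fin 4)) (F : List (Fin 4) × List (Fin 4) → ℝ) :
    ((splits L).map F).sum = F ([], L) + ((splits' L).map F).sum := by
  induction L generalizing F with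
  | nil => simp [splits, splits']
  | cons i L ih =>
    simp only [splits, splits', List.map_append, List.sum_append, List.map_map, List.map_cons,
      List.sum_cons]
    rw [ih, ih]
    simp [Function.comp_def]; ring

theorem wd_mul' (hU : IsOpen U) (L : List (Fin 4)) {f g : Spacetime → ℝ}
    (hf : ContDiffOn ℝ L.length f U) (hg : ContDiffOn ℝ L.length g U) :
    EqOn (wd L fun q => f q * g q)
      (fun q => f q * wd L g q + ((splits' L).map fun p => wd p.1 f q * wd p.2 g q).sum) U :=
  fun _ hq => (wd_mul hU L hf hg hq).trans (splits_sum L _)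

/-! ### Continuous extension to the closure -/

/-- `f` extends from `U` to a continuous function on the closure of `U`. -/
def Ext (U : Set Spacetime) (f : Spacetime → ℝ) : Prop :=
  ∃ g : Spacetime → ℝ, ContinuousOn g (closure U) ∧ EqOn g f U

theorem Ext.congr {f g : Spacetime → ℝ} (hf : Ext U f) (h : EqOn f g U) : Ext U g := by
  obtain ⟨e, he, h1⟩ := hf
  exact ⟨e, he, h1.trans h⟩

theorem Ext.mul {f g : Spacetime → ℝ} (hf : Ext U f) (hg : Ext U g) :
    Ext U fun q => f q * g q := by
  obtain ⟨a, ha, h1⟩ := hf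
  obtain ⟨b, hb, h2⟩ := hg
  exact ⟨fun q => a q * b q, ha.mul hb, fun q hq => by simp [h1 hq, h2 hq]⟩

theorem Ext.add {f g : Spacetime → ℝ} (hf : Ext U f) (hg : Ext U g) :
    Ext U fun q => f q + g q := by
  obtain ⟨a, ha, h1⟩ := hf
  obtain ⟨b, hb, h2⟩ := hg
  exact ⟨fun q => a q + b q, ha.add hb, fun q hq => by simp [h1 hq, h2 hq]⟩

theorem Ext.const (c : ℝ) : Ext U fun _ => c := ⟨fun _ => c, continuousOn_const, fun _ _ => rfl⟩

theorem Ext.sum {ι : Type*} (s : Finset ι) {f : ι → Spacetime → ℝ} (hf : ∀ a ∈ s, Ext U (f a)) :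
    Ext U fun q => ∑ a ∈ s, f a q := by
  classical
  induction s using Finset.induction_on with
  | empty => simpa using Ext.const 0
  | insert a s ha ih =>
    simp only [Finset.sum_insert ha]
    exact (hf a (Finset.mem_insert_self a s)).add
      (ih fun b hb => hf b (Finset.mem_insert_of_mem hb))

theorem Ext.extendFrom {f : Spacetime → ℝ} (hf : Ext U f) :
    ContinuousOn (extendFrom U f) (closure U) ∧ EqOn (extendFrom U f) f U := by
  obtain ⟨g, hg, h⟩ := hf
  have key : EqOn (_root_.extendFrom U f) g (closure U) := fun q hq => by
    refine extendFrom_eq hq ?_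
    have h1 : Filter.Tendsto g (nhdsWithin q U) (nhds (g q)) :=
      (hg q hq).mono_left (nhdsWithin_mono q subset_closure)
    refine h1.congr' ?_
    filter_upwards [self_mem_nhdsWithin] with y hy using h hy
  exact ⟨hg.congr key, fun q hq => (key (subset_closure hq)).trans (h hq)⟩

theorem CnClosure.ext_wd (hU : IsOpen U) {κ : Type} {n : ℕ} {f : Spacetime → κ → ℝ}
    (hf : CnClosure n U f) (i : κ) {L : List (Fin 4)} (hL : L.length ≤ n) :
    Ext U (wd L fun q => f q i) := by
  obtain ⟨h1, h2⟩ := hf i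
  obtain ⟨g, hg, h⟩ := h2 _ (windex_mem hL)
  exact ⟨g, hg, h.trans (wd_eq_multiDeriv hU L (h1.of_le (by exact_mod_cast hL))).symm⟩

theorem CnClosure.mono {κ : Type} {n k : ℕ} {f : Spacetime → κ → ℝ}
    (hf : CnClosure n U f) (hk : k ≤ n) : CnClosure k U f := fun i =>
  ⟨(hf i).1.of_le (by exact_mod_cast hk), fun α hα => (hf i).2 α (by
    simp only [multiIndices, Finset.mem_filter, Fintype.mem_piFinset, Finset.mem_range] at hα ⊢
    exact ⟨fun μ => by have := hα.1 μ; omega, hα.2.trans hk⟩)⟩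

theorem closedDeriv_eq (hU : IsOpen U) {α : Fin 4 → ℕ} {f : Spacetime → ℝ}
    (hf : ContDiffOn ℝ (∑ μ, α μ : ℕ) f U) {q : Spacetime} (hq : q ∈ U) :
    closedDeriv U α f q = wd (word α) f q := by
  rw [wd_word]
  refine extendFrom_eq (subset_closure hq) ?_
  have h : ContinuousOn (wd (word α) f) U :=
    (wd_contDiffOn hU _ (n := 0) (by rwa [zero_add, length_word])).continuousOn
  rw [wd_word] at h
  exact h q hq

theorem derivNormSq_eq (hU : IsOpen U) {κ : Type} [Fintype κ] {n : ℕ} {f : Spacetime → κ → ℝ}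
    (hf : ∀ i, ContDiffOn ℝ n (fun q => f q i) U) {α : Fin 4 → ℕ} (hα : α ∈ multiIndices n)
    {q : Spacetime} (hq : q ∈ U) :
    derivNormSq U f α q = ∑ i, (wd (word α) (fun q => f q i) q) ^ 2 :=
  Finset.sum_congr rfl fun i _ => by
    rw [closedDeriv_eq hU ((hf i).of_le (by exact_mod_cast sum_le_of_mem_multiIndices hα)) hq]

/-- The squared Euclidean norm of the derivative along a word. -/
def wsq (L : List (Fin 4)) {κ : Type} [Fintype κ] (f : Spacetime → κ → ℝ) (q : Spacetime) : ℝ :=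
  ∑ i, (wd L (fun q => f q i) q) ^ 2

theorem wsq_nonneg (L : List (Fin 4)) {κ : Type} [Fintype κ] (f : Spacetime → κ → ℝ)
    (q : Spacetime) : 0 ≤ wsq L f q := Finset.sum_nonneg fun _ _ => sq_nonneg _

theorem derivNormSq_windex (hU : IsOpen U) {κ : Type} [Fintype κ] {n : ℕ}
    {f : Spacetime → κ → ℝ} (hf : ∀ i, ContDiffOn ℝ n (fun q => f q i) U) {L : List (Fin 4)}
    (hL : L.length ≤ n) {q : Spacetime} (hq : q ∈ U) :
    derivNormSq U f (windex L) q = wsq L f q := by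
  rw [derivNormSq_eq hU hf (windex_mem hL) hq]
  refine Finset.sum_congr rfl fun i _ => ?_
  rw [wd_perm hU (perm_word_windex L) ((hf i).of_le (by exact_mod_cast hL)) hq]

/-! ### A Sobolev inequality on slices -/

theorem pt_add_smul (t : ℝ) (x v : Space) (s : ℝ) : pt t (x + s • v) = pt t x + s • pt 0 v := by
  funext i
  refine Fin.cases ?_ (fun j => ?_) i <;> simp [pt]

theorem pt_zero_eq (v : Space) : pt 0 v = ∑ i : Fin 3, v i • Pi.single i.succ (1 : ℝ) := by
  funext μ
  rw [Finset.sum_apply]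
  simp only [Pi.smul_apply, smul_eq_mul]
  refine Fin.cases ?_ (fun j => ?_) μ
  · rw [Finset.sum_eq_zero fun i _ => by
      rw [Pi.single_eq_of_ne (Fin.succ_ne_zero i).symm, mul_zero]]
    rfl
  · rw [Finset.sum_eq_single j (fun i _ hi => by
      rw [Pi.single_eq_of_ne fun h => hi (Fin.succ_injective _ h).symm, mul_zero]) (by simp),
      Pi.single_eq_same, mul_one]
    rfl

theorem fderiv_pt_zero (f : Spacetime → ℝ) (q : Spacetime) (v : Space) :
    fderiv ℝ f q (pt 0 v) = ∑ i : Fin 3, v i * pd i.succ f q := by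
  rw [pt_zero_eq, map_sum]
  simp [pd]

@[fun_prop]
theorem continuous_pt : Continuous fun p : ℝ × Space => pt p.1 p.2 := by
  refine continuous_pi fun i => ?_
  refine Fin.cases ?_ (fun j => ?_) i
  · simpa [pt] using continuous_fst
  · exact (continuous_apply j).comp continuous_snd

theorem continuous_pt_right (t : ℝ) : Continuous fun x : Space => pt t x :=
  continuous_pt.comp (Continuous.prodMk_right t)

theorem hasDerivAt_segment {f : Spacetime → ℝ} (t : ℝ) (x v : Space) (s : ℝ)
    (hf : DifferentiableAt ℝ f (pt t (x + s • v))) :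
    HasDerivAt (fun s => f (pt t (x + s • v)))
      (∑ i : Fin 3, v i * pd i.succ f (pt t (x + s • v))) s := by
  have h1 : HasDerivAt (fun s : ℝ => pt t (x + s • v)) (pt 0 v) s := by
    simp only [pt_add_smul]
    simpa using ((hasDerivAt_id s).smul_const (pt 0 v)).const_add (pt t x)
  have h2 := hf.hasFDerivAt.comp_hasDerivAt s h1
  rwa [fderiv_pt_zero] at h2

theorem sq_sum_mul_le {ι : Type*} (s : Finset ι) {d : ℝ} (v a : ι → ℝ) (hv : ∀ i ∈ s, |v i| ≤ d) :
    (∑ i ∈ s, v i * a i) ^ 2 ≤ s.card * d ^ 2 * ∑ i ∈ s, a i ^ 2 := by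
  calc (∑ i ∈ s, v i * a i) ^ 2 ≤ (∑ i ∈ s, v i ^ 2) * ∑ i ∈ s, a i ^ 2 :=
        Finset.sum_mul_sq_le_sq_mul_sq s v a
    _ ≤ _ := by
        gcongr
        calc ∑ i ∈ s, v i ^ 2 ≤ ∑ _i ∈ s, d ^ 2 := Finset.sum_le_sum fun i hi =>
              sq_le_sq' (by linarith [neg_abs_le (v i), hv i hi]) ((le_abs_self _).trans (hv i hi))
          _ = _ := by simp

variable {U : Set Spacetime}

/-- A pointwise bound by the values at another point and an integral over the segment. -/
theorem sq_le_segment (hU : IsOpen U) {f : Spacetime → ℝ} (hf : ContDiffOn ℝ 2 f U) (t : ℝ)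
    (x y : Space) (hseg : ∀ s ∈ Icc (0 : ℝ) 1, pt t (x + s • (y - x)) ∈ U) (hd : ‖y - x‖ ≤ 4) :
    f (pt t x) ^ 2 ≤ 3 * f (pt t y) ^ 2
      + 144 * ∑ i : Fin 3, pd i.succ f (pt t y) ^ 2
      + 27648 * ∫ r in (0 : ℝ)..1, r ^ 6 * ∑ i : Fin 3, ∑ j : Fin 3,
          pd j.succ (pd i.succ f) (pt t (x + r ^ 2 • (y - x))) ^ 2 := by
  set v : Space := y - x with hv
  have hvi : ∀ i, |v i| ≤ 4 := fun i => (norm_le_pi_norm v i).trans hd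
  set g : ℝ → ℝ := fun s => f (pt t (x + s • v)) with hg
  set g1 : ℝ → ℝ := fun s => ∑ i : Fin 3, v i * pd i.succ f (pt t (x + s • v)) with hg1
  set g2 : ℝ → ℝ := fun s => ∑ i : Fin 3, v i * ∑ j : Fin 3,
    v j * pd j.succ (pd i.succ f) (pt t (x + s • v)) with hg2
  have hpd : ∀ i, ContDiffOn ℝ 1 (pd i f) U := fun i => by
    exact_mod_cast pd_contDiffOn hU (n := 1) (by exact_mod_cast hf) i
  have hpd2 : ∀ i j, ContinuousOn (pd j (pd i f)) U := fun i j => by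
    have := pd_contDiffOn hU (n := 0) (by exact_mod_cast hpd i) j
    exact this.continuousOn
  have hgd : ∀ s ∈ Icc (0 : ℝ) 1, HasDerivAt g (g1 s) s := fun s hs =>
    hasDerivAt_segment t x v s (differentiableAt_of_contDiffOn hU (n := 2) (by exact_mod_cast hf)
      two_ne_zero (hseg s hs))
  have hg1d : ∀ s ∈ Icc (0 : ℝ) 1, HasDerivAt g1 (g2 s) s := fun s hs => by
    refine HasDerivAt.fun_sum fun i _ => ?_
    exact (hasDerivAt_segment t x v s (differentiableAt_of_contDiffOn hU (n := 1)
      (by exact_mod_cast hpd i.succ) one_ne_zero (hseg s hs))).const_mul (v i)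
  have hsq : ∀ r ∈ Icc (0 : ℝ) 1, r ^ 2 ∈ Icc (0 : ℝ) 1 := fun r hr =>
    ⟨sq_nonneg r, pow_le_one₀ hr.1 hr.2⟩
  have hcont2 : ∀ i j : Fin 3, ContinuousOn
      (fun r : ℝ => pd j.succ (pd i.succ f) (pt t (x + r ^ 2 • v))) (Icc 0 1) := fun i j => by
    refine (hpd2 i.succ j.succ).comp (Continuous.continuousOn ?_) fun r hr => hseg _ (hsq r hr)
    exact (continuous_pt_right t).comp (by fun_prop)
  have hg2c : ContinuousOn (fun r : ℝ => g2 (r ^ 2)) (Icc 0 1) := by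
    refine continuousOn_finsetSum _ fun i _ => continuousOn_const.mul ?_
    exact continuousOn_finsetSum _ fun j _ => continuousOn_const.mul (hcont2 i j)
  -- The first derivatives cancel, so only `g2` survives under the integral, with the factor `r ^
  -- 3`.
  have hder : ∀ r ∈ uIcc (0 : ℝ) 1, HasDerivAt (fun r => g (r ^ 2) - r ^ 2 * g1 (r ^ 2))
      (-(2 * r ^ 3 * g2 (r ^ 2))) r := fun r hr => by
    rw [uIcc_of_le zero_le_one] at hr
    have hr2 : HasDerivAt (fun r : ℝ => r ^ 2) (2 * r) r := by simpa using hasDerivAt_pow 2 r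
    have h1 : HasDerivAt (fun r => g (r ^ 2)) (g1 (r ^ 2) * (2 * r)) r :=
      HasDerivAt.comp r (h₂ := g) (h := fun r => r ^ 2) (hgd _ (hsq r hr)) hr2
    have h2 : HasDerivAt (fun r => g1 (r ^ 2)) (g2 (r ^ 2) * (2 * r)) r :=
      HasDerivAt.comp r (h₂ := g1) (h := fun r => r ^ 2) (hg1d _ (hsq r hr)) hr2
    exact (h1.sub (hr2.mul h2)).congr_deriv (by ring)
  have hint : ContinuousOn (fun r : ℝ => 2 * r ^ 3 * g2 (r ^ 2)) (Icc 0 1) :=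
    (by fun_prop : Continuous fun r : ℝ => 2 * r ^ 3).continuousOn.mul hg2c
  have hftc := intervalIntegral.integral_eq_sub_of_hasDerivAt hder
    ((by simpa only [uIcc_of_le (zero_le_one' ℝ)] using hint.fun_neg : ContinuousOn
      (fun r : ℝ => -(2 * r ^ 3 * g2 (r ^ 2))) (uIcc 0 1)).intervalIntegrable)
  rw [intervalIntegral.integral_neg] at hftc
  have hx : g (0 ^ 2) = f (pt t x) := by simp [hg]
  have hy : g (1 ^ 2) = f (pt t y) := by simp [hg, hv]
  set I := ∫ r in (0 : ℝ)..1, 2 * r ^ 3 * g2 (r ^ 2) with hI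
  have hrep : f (pt t x) = f (pt t y) - g1 1 + I := by
    rw [← hx, ← hy]; simp only [one_pow] at hftc ⊢; norm_num at hftc ⊢; linarith
  have hg1y : g1 1 ^ 2 ≤ 48 * ∑ i : Fin 3, pd i.succ f (pt t y) ^ 2 := by
    have := sq_sum_mul_le Finset.univ v (fun i : Fin 3 => pd i.succ f (pt t y))
      (fun i _ => hvi i)
    have e : g1 1 = ∑ i : Fin 3, v i * pd i.succ f (pt t y) := by simp [hg1, hv]
    rw [e]; norm_num at this ⊢; exact this
  have hg2b : ∀ s, g2 s ^ 2 ≤ 2304 * ∑ i : Fin 3, ∑ j : Fin 3,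
      pd j.succ (pd i.succ f) (pt t (x + s • v)) ^ 2 := fun s => by
    have h1 := sq_sum_mul_le Finset.univ v (fun i : Fin 3 => ∑ j : Fin 3,
      v j * pd j.succ (pd i.succ f) (pt t (x + s • v))) (fun i _ => hvi i)
    refine h1.trans ?_
    rw [Finset.mul_sum, Finset.mul_sum]
    refine Finset.sum_le_sum fun i _ => ?_
    have := sq_sum_mul_le Finset.univ v (fun j : Fin 3 =>
      pd j.succ (pd i.succ f) (pt t (x + s • v))) (fun i _ => hvi i)
    norm_num at this ⊢; linarith
  -- Cauchy–Schwarz on an interval of length one, by expanding the nonnegative variance.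
  have hI2 : I ^ 2 ≤ ∫ r in (0 : ℝ)..1, (2 * r ^ 3 * g2 (r ^ 2)) ^ 2 := by
    have i1 : IntervalIntegrable (fun r : ℝ => 2 * r ^ 3 * g2 (r ^ 2)) volume 0 1 := by
      apply ContinuousOn.intervalIntegrable; rwa [uIcc_of_le zero_le_one]
    have i2 : IntervalIntegrable (fun r : ℝ => (2 * r ^ 3 * g2 (r ^ 2)) ^ 2) volume 0 1 := by
      apply ContinuousOn.intervalIntegrable; rw [uIcc_of_le zero_le_one]; exact hint.pow 2
    have h0 : 0 ≤ ∫ r in (0 : ℝ)..1, (2 * r ^ 3 * g2 (r ^ 2) - I) ^ 2 :=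
      intervalIntegral.integral_nonneg zero_le_one fun _ _ => sq_nonneg _
    have h1 : ∫ r in (0 : ℝ)..1, (2 * r ^ 3 * g2 (r ^ 2) - I) ^ 2 =
        (∫ r in (0 : ℝ)..1, (2 * r ^ 3 * g2 (r ^ 2)) ^ 2) - 2 * I * I + I ^ 2 := by
      have : (fun r : ℝ => (2 * r ^ 3 * g2 (r ^ 2) - I) ^ 2) = fun r =>
          (2 * r ^ 3 * g2 (r ^ 2)) ^ 2 - (2 * I) * (2 * r ^ 3 * g2 (r ^ 2)) + I ^ 2 := by
        funext r; ring
      rw [this, intervalIntegral.integral_add (i2.sub (i1.const_mul _)) (by simp),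
        intervalIntegral.integral_sub i2 (i1.const_mul _), intervalIntegral.integral_const_mul]
      simp [hI]
    rw [h1] at h0; nlinarith
  have hI3 : ∫ r in (0 : ℝ)..1, (2 * r ^ 3 * g2 (r ^ 2)) ^ 2 ≤
      ∫ r in (0 : ℝ)..1, 9216 * (r ^ 6 * ∑ i : Fin 3, ∑ j : Fin 3,
          pd j.succ (pd i.succ f) (pt t (x + r ^ 2 • v)) ^ 2) := by
    refine intervalIntegral.integral_mono_on zero_le_one ?_ ?_ fun r hr => ?_
    · apply ContinuousOn.intervalIntegrable; rw [uIcc_of_le zero_le_one]; exact hint.pow 2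
    · apply ContinuousOn.intervalIntegrable; rw [uIcc_of_le zero_le_one]
      refine continuousOn_const.mul ((by fun_prop : Continuous fun r : ℝ => r ^ 6).continuousOn.mul ?_)
      exact continuousOn_finsetSum _ fun i _ => continuousOn_finsetSum _ fun j _ =>
        (hcont2 i j).pow 2
    · have := mul_le_mul_of_nonneg_left (hg2b (r ^ 2)) (by positivity : 0 ≤ 4 * r ^ 6)
      nlinarith
  rw [intervalIntegral.integral_const_mul] at hI3
  rw [hrep]
  -- This is `(a - b + c)² ≤ 3 (a² + b² + c²)`, whence `144 = 3 * 48` and `27648 = 3 * 9216`.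
  nlinarith [sq_nonneg (f (pt t y) + g1 1), sq_nonneg (f (pt t y) - I), sq_nonneg (g1 1 + I)]

theorem continuousOn_wsq (hU : IsOpen U) {κ : Type} [Fintype κ] {f : Spacetime → κ → ℝ}
    (L : List (Fin 4)) (hf : ∀ i, ContDiffOn ℝ L.length (fun q => f q i) U) :
    ContinuousOn (wsq L f) U :=
  continuousOn_finsetSum _ fun i _ =>
    (wd_contDiffOn hU L (n := 0) (by simpa using hf i)).continuousOn.pow 2

/-- Change of variables under the homothety with centre `x` and ratio `r ^ 2`: its Jacobian is `r ^
6`, and convexity keeps the image of `B` inside `X`. -/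
theorem lintegral_homothety_le {X B : Set Space} (hX : Convex ℝ X) (hB : MeasurableSet B)
    (hBX : B ⊆ X) {x : Space} (hx : x ∈ X) {r : ℝ} (hr : r ∈ Ioc (0 : ℝ) 1) (F : Space → ℝ≥0∞) :
    ∫⁻ y in B, ENNReal.ofReal (r ^ 6) * F (x + r ^ 2 • (y - x)) ≤ ∫⁻ y in X, F y := by
  have hr2 : 0 < r ^ 2 := by have := hr.1; positivity
  have hder : ∀ y ∈ B, HasFDerivWithinAt (fun y => x + r ^ 2 • (y - x))
      (r ^ 2 • ContinuousLinearMap.id ℝ Space) B y := fun y _ =>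
    ((((hasFDerivAt_id y).sub_const x).const_smul (r ^ 2)).const_add x).hasFDerivWithinAt
  have hinj : InjOn (fun y : Space => x + r ^ 2 • (y - x)) B := fun y _ z _ h => by
    simpa [hr.1.ne'] using h
  have h := lintegral_image_eq_lintegral_abs_det_fderiv_mul volume hB hder hinj F
  have hdet : |(r ^ 2 • ContinuousLinearMap.id ℝ Space).det| = r ^ 6 := by
    have : (r ^ 2 • ContinuousLinearMap.id ℝ Space).det = (r ^ 2) ^ 3 := by
      simp [ContinuousLinearMap.det]
    rw [this, abs_of_nonneg (by positivity)]; ring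
  rw [hdet] at h
  rw [← h]
  refine lintegral_mono_set ?_
  rintro _ ⟨y, hy, rfl⟩
  have := hX.add_smul_sub_mem hx (hBX hy) ⟨hr2.le, pow_le_one₀ hr.1.le hr.2⟩
  exact this

/-- Sobolev inequality: on a convex slice, the supremum norm is controlled by the square integrals
of the derivatives of order at most two. -/
theorem sobolev_slice (hU : IsOpen U) {κ : Type} [Fintype κ] {f : Spacetime → κ → ℝ}
    (hf : ∀ i, ContDiffOn ℝ 2 (fun q => f q i) U) (t : ℝ) {X B : Set Space}
    (hXo : IsOpen X) (hX : Convex ℝ X) (hXU : ∀ x ∈ X, pt t x ∈ U) {x : Space} (hx : x ∈ X)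
    (hB : MeasurableSet B) (hBX : B ⊆ X) (hvol : ENNReal.ofReal (1 / 64) ≤ volume B)
    (hd : ∀ y ∈ B, ‖y - x‖ ≤ 4) {T : ℝ≥0∞}
    (hT : ∀ L : List (Fin 4), L.length ≤ 2 → ∫⁻ y in X, ENNReal.ofReal (wsq L f (pt t y)) ≤ T) :
    ENNReal.ofReal (wsq [] f (pt t x)) ≤ ENNReal.ofReal 16000000 * T := by
  have hcL : ∀ L : List (Fin 4), L.length ≤ 2 → ContinuousOn (wsq L f) U := fun L hL =>
    continuousOn_wsq hU L fun i => (hf i).of_le (by exact_mod_cast hL)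
  set F2 : Spacetime → ℝ := fun q => ∑ i : Fin 3, ∑ j : Fin 3, wsq [j.succ, i.succ] f q with hF2
  have hF2c : ContinuousOn F2 U := continuousOn_finsetSum _ fun i _ =>
    continuousOn_finsetSum _ fun j _ => hcL _ (by simp)
  have hF20 : ∀ q, 0 ≤ F2 q := fun q =>
    Finset.sum_nonneg fun i _ => Finset.sum_nonneg fun j _ => wsq_nonneg _ _ _
  have hsegX : ∀ y ∈ X, ∀ s ∈ Icc (0 : ℝ) 1, x + s • (y - x) ∈ X := fun y hy s hs =>
    hX.add_smul_sub_mem hx hy hs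
  have hF2line : ∀ y ∈ X, ContinuousOn (fun r : ℝ => r ^ 6 * F2 (pt t (x + r ^ 2 • (y - x))))
      (Icc 0 1) := fun y hy => by
    refine (by fun_prop : Continuous fun r : ℝ => r ^ 6).continuousOn.mul
      (hF2c.comp (Continuous.continuousOn ?_) fun r hr => hXU _ (hsegX y hy _
        ⟨sq_nonneg r, pow_le_one₀ hr.1 hr.2⟩))
    exact (continuous_pt_right t).comp (by fun_prop)
  -- The segment estimate summed over the components; it is averaged over `y ∈ B` in `hmain`.
  have hpt : ∀ y ∈ B, wsq [] f (pt t x) ≤ 3 * wsq [] f (pt t y)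
      + 144 * ∑ i : Fin 3, wsq [i.succ] f (pt t y)
      + 27648 * ∫ r in (0 : ℝ)..1, r ^ 6 * F2 (pt t (x + r ^ 2 • (y - x))) := fun y hy => by
    have h := Finset.sum_le_sum fun (i : κ) (_ : i ∈ Finset.univ) =>
      sq_le_segment hU (hf i) t x y (fun s hs => hXU _ (hsegX y (hBX hy) s hs)) (hd y hy)
    simp only [Finset.sum_add_distrib, ← Finset.mul_sum] at h
    rw [← intervalIntegral.integral_finsetSum] at h
    · refine h.trans (le_of_eq ?_)
      simp only [wsq, hF2, wd_cons, wd_nil]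
      rw [Finset.sum_comm]
      congr 2
      refine intervalIntegral.integral_congr fun r _ => ?_
      simp only [← Finset.mul_sum]
      rw [Finset.sum_comm]
      congr 2
      funext j
      rw [Finset.sum_comm]
    · intro i _
      apply ContinuousOn.intervalIntegrable
      rw [uIcc_of_le zero_le_one]
      refine (by fun_prop : Continuous fun r : ℝ => r ^ 6).continuousOn.mul
        (continuousOn_finsetSum _ fun k _ => continuousOn_finsetSum _ fun l _ => ?_)
      have hc : ContinuousOn (wd [l.succ, k.succ] fun q => f q i) U :=
        (wd_contDiffOn hU _ (n := 0) (by simpa using hf i)).continuousOn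
      refine (hc.comp (Continuous.continuousOn ?_) fun r hr => hXU _ (hsegX y (hBX hy) _
        ⟨sq_nonneg r, pow_le_one₀ hr.1 hr.2⟩)).pow 2
      exact (continuous_pt_right t).comp (by fun_prop)
  have hpt' : ∀ y ∈ B, ENNReal.ofReal (wsq [] f (pt t x)) ≤
      ENNReal.ofReal 3 * ENNReal.ofReal (wsq [] f (pt t y))
      + ENNReal.ofReal 144 * ∑ i : Fin 3, ENNReal.ofReal (wsq [i.succ] f (pt t y))
      + ENNReal.ofReal 27648 * ∫⁻ r in Ioc (0 : ℝ) 1,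
        ENNReal.ofReal (r ^ 6) * ENNReal.ofReal (F2 (pt t (x + r ^ 2 • (y - x)))) := by
    intro y hy
    have e1 : ∫⁻ r in Ioc (0 : ℝ) 1,
        ENNReal.ofReal (r ^ 6) * ENNReal.ofReal (F2 (pt t (x + r ^ 2 • (y - x))))
        = ENNReal.ofReal (∫ r in (0 : ℝ)..1, r ^ 6 * F2 (pt t (x + r ^ 2 • (y - x)))) := by
      rw [intervalIntegral.integral_of_le zero_le_one, ofReal_integral_eq_lintegral_ofReal]
      · refine lintegral_congr fun r => ?_
        rw [ENNReal.ofReal_mul (by positivity)]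
      · exact ((hF2line y (hBX hy)).integrableOn_Icc).mono_set Ioc_subset_Icc_self
      · exact Filter.Eventually.of_forall fun r => mul_nonneg (by positivity) (hF20 _)
    have h0 : 0 ≤ ∑ i : Fin 3, wsq [i.succ] f (pt t y) :=
      Finset.sum_nonneg fun _ _ => wsq_nonneg _ _ _
    have h1 : 0 ≤ ∫ r in (0 : ℝ)..1, r ^ 6 * F2 (pt t (x + r ^ 2 • (y - x))) :=
      intervalIntegral.integral_nonneg zero_le_one fun r _ => mul_nonneg (by positivity) (hF20 _)
    have h2 := wsq_nonneg [] f (pt t y)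
    rw [e1, ← ENNReal.ofReal_sum_of_nonneg fun _ _ => wsq_nonneg _ _ _,
      ← ENNReal.ofReal_mul (by norm_num), ← ENNReal.ofReal_mul (by norm_num),
      ← ENNReal.ofReal_mul (by norm_num), ← ENNReal.ofReal_add (by positivity) (by positivity),
      ← ENNReal.ofReal_add (by positivity) (by positivity)]
    exact ENNReal.ofReal_le_ofReal (hpt y hy)
  have hmeas : ∀ L : List (Fin 4), L.length ≤ 2 →
      AEMeasurable (fun y => ENNReal.ofReal (wsq L f (pt t y))) (volume.restrict X) :=
    fun L hL => (((hcL L hL).comp (continuous_pt_right t).continuousOn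
      fun y hy => hXU y hy).aemeasurable hXo.measurableSet).ennreal_ofReal
  have hmeasB := fun L hL => (hmeas L hL).mono_measure (Measure.restrict_mono hBX le_rfl)
  have hTB : ∀ L : List (Fin 4), L.length ≤ 2 →
      ∫⁻ y in B, ENNReal.ofReal (wsq L f (pt t y)) ≤ T := fun L hL =>
    (lintegral_mono_set hBX).trans (hT L hL)
  have hswapm : AEMeasurable (Function.uncurry fun (y : Space) (r : ℝ) =>
      ENNReal.ofReal (r ^ 6) * ENNReal.ofReal (F2 (pt t (x + r ^ 2 • (y - x)))))
      ((volume.restrict B).prod (volume.restrict (Ioc (0 : ℝ) 1))) := by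
    rw [Measure.prod_restrict]
    have hc : ContinuousOn (fun p : Space × ℝ => F2 (pt t (x + p.2 ^ 2 • (p.1 - x))))
        (X ×ˢ Ioc (0 : ℝ) 1) := by
      refine hF2c.comp (Continuous.continuousOn ?_) fun p hp => hXU _ (hsegX p.1 hp.1 _
        ⟨sq_nonneg _, pow_le_one₀ hp.2.1.le hp.2.2⟩)
      exact (continuous_pt_right t).comp (by fun_prop)
    have hm := (hc.mono (prod_mono hBX subset_rfl)).aemeasurable (μ := volume.prod volume)
      (hB.prod measurableSet_Ioc)
    exact AEMeasurable.mul (by fun_prop) hm.ennreal_ofReal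
  have hF2T : ∫⁻ y in X, ENNReal.ofReal (F2 (pt t y)) ≤ 9 * T := by
    have : ∀ y, ENNReal.ofReal (F2 (pt t y)) = ∑ i : Fin 3, ∑ j : Fin 3,
        ENNReal.ofReal (wsq [j.succ, i.succ] f (pt t y)) := fun y => by
      simp only [hF2]
      rw [ENNReal.ofReal_sum_of_nonneg fun i _ => Finset.sum_nonneg fun j _ => wsq_nonneg _ _ _]
      refine Finset.sum_congr rfl fun i _ => ?_
      rw [ENNReal.ofReal_sum_of_nonneg fun j _ => wsq_nonneg _ _ _]
    simp only [this]
    rw [lintegral_finsetSum' _ fun i _ => Finset.aemeasurable_fun_sum _ fun j _ => hmeas _ (by simp)]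
    calc _ ≤ ∑ _i : Fin 3, ∑ _j : Fin 3, T := by
          refine Finset.sum_le_sum fun i _ => ?_
          rw [lintegral_finsetSum' _ fun j _ => hmeas _ (by simp)]
          exact Finset.sum_le_sum fun j _ => hT _ (by simp)
      _ = 9 * T := by simp; rw [← mul_assoc]; norm_num
  have hmain : volume B * ENNReal.ofReal (wsq [] f (pt t x)) ≤
      ENNReal.ofReal 3 * T + ENNReal.ofReal 144 * (3 * T) + ENNReal.ofReal 27648 * (9 * T) := by
    calc volume B * ENNReal.ofReal (wsq [] f (pt t x))
        = ∫⁻ _ in B, ENNReal.ofReal (wsq [] f (pt t x)) := by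
          rw [setLIntegral_const, mul_comm]
      _ ≤ ∫⁻ y in B, _ := setLIntegral_mono' hB hpt'
      _ = ENNReal.ofReal 3 * (∫⁻ y in B, ENNReal.ofReal (wsq [] f (pt t y)))
          + ENNReal.ofReal 144 * (∑ i : Fin 3, ∫⁻ y in B, ENNReal.ofReal (wsq [i.succ] f (pt t y)))
          + ENNReal.ofReal 27648 * ∫⁻ y in B, ∫⁻ r in Ioc (0 : ℝ) 1,
            ENNReal.ofReal (r ^ 6) * ENNReal.ofReal (F2 (pt t (x + r ^ 2 • (y - x)))) := by
          have m1 := hmeasB [] (by simp)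
          have m2 : AEMeasurable (fun y => ∑ i : Fin 3, ENNReal.ofReal (wsq [i.succ] f (pt t y)))
              (volume.restrict B) := Finset.aemeasurable_fun_sum _ fun j _ => hmeasB _ (by simp)
          rw [lintegral_add_left' ((m1.const_mul _).fun_add (m2.const_mul _)),
            lintegral_add_left' (m1.const_mul _), lintegral_const_mul'' _ m1,
            lintegral_const_mul'' _ m2, lintegral_finsetSum' _ fun i _ => hmeasB _ (by simp),
            lintegral_const_mul' _ _ ENNReal.ofReal_ne_top]
      _ ≤ _ := by
          have e1 : ∑ i : Fin 3, ∫⁻ y in B, ENNReal.ofReal (wsq [i.succ] f (pt t y)) ≤ 3 * T := by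
            calc _ ≤ ∑ _i : Fin 3, T := Finset.sum_le_sum fun i _ => hTB _ (by simp)
              _ = 3 * T := by simp
          -- After exchanging the integrals, the homothety bound is applied for each fixed `r`,
          -- uniformly in `r`.
          have e2 : ∫⁻ y in B, ∫⁻ r in Ioc (0 : ℝ) 1, ENNReal.ofReal (r ^ 6) *
              ENNReal.ofReal (F2 (pt t (x + r ^ 2 • (y - x)))) ≤ 9 * T := by
            rw [lintegral_lintegral_swap hswapm]
            calc _ ≤ ∫⁻ _r in Ioc (0 : ℝ) 1, 9 * T :=
                  setLIntegral_mono' measurableSet_Ioc fun r hr =>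
                    (lintegral_homothety_le hX hB hBX hx hr
                      (fun y => ENNReal.ofReal (F2 (pt t y)))).trans hF2T
              _ = 9 * T := by simp
          gcongr
          exact hTB _ (by simp)
  calc ENNReal.ofReal (wsq [] f (pt t x))
      = ENNReal.ofReal 64 * (ENNReal.ofReal (1 / 64) * ENNReal.ofReal (wsq [] f (pt t x))) := by
        rw [← mul_assoc, ← ENNReal.ofReal_mul (by norm_num)]; norm_num
    _ ≤ ENNReal.ofReal 64 * (ENNReal.ofReal 3 * T + ENNReal.ofReal 144 * (3 * T)
          + ENNReal.ofReal 27648 * (9 * T)) := by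
        gcongr
        exact (mul_le_mul_left hvol _).trans hmain
    _ = ENNReal.ofReal (64 * (3 + 144 * 3 + 27648 * 9)) * T := by
        have e3 : (3 : ℝ≥0∞) = ENNReal.ofReal 3 := by simp
        have e9 : (9 : ℝ≥0∞) = ENNReal.ofReal 9 := by simp
        rw [e3, e9, ← mul_assoc, ← mul_assoc, ← ENNReal.ofReal_mul (by norm_num),
          ← ENNReal.ofReal_mul (by norm_num), ← add_mul, ← add_mul,
          ← ENNReal.ofReal_add (by norm_num) (by norm_num),
          ← ENNReal.ofReal_add (by norm_num) (by norm_num), ← mul_assoc,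
          ← ENNReal.ofReal_mul (by norm_num)]
    -- The exact constant is `64 * 249267 = 15953088`, rounded up to a number with square root
    -- `4000`.
    _ ≤ _ := by gcongr; norm_num

/-! ### The divergence theorem for compactly supported currents -/

/-- The space part of a spacetime point. -/
def sp (q : Spacetime) : Space := fun i => q i.succ

@[simp] theorem pt_sp (q : Spacetime) : pt (q 0) (sp q) = q := by
  funext i
  refine Fin.cases rfl (fun j => rfl) i

@[simp] theorem sp_pt (t : ℝ) (x : Space) : sp (pt t x) = x := rfl

@[simp] theorem pt_apply_zero (t : ℝ) (x : Space) : pt t x 0 = t := rfl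

@[simp] theorem pt_apply_three (t : ℝ) (x : Space) : pt t x 3 = x 2 := rfl

theorem continuous_sp : Continuous sp := continuous_pi fun i => continuous_apply i.succ

theorem mem_region {I : Set ℝ} {O : ℝ → Set Space} {q : Spacetime} :
    q ∈ region I O ↔ q 0 ∈ I ∧ sp q ∈ O (q 0) := Iff.rfl

theorem pt_mem_region {I : Set ℝ} {O : ℝ → Set Space} {t : ℝ} {x : Space} :
    pt t x ∈ region I O ↔ t ∈ I ∧ x ∈ O t := Iff.rfl

theorem pt_zero_single (i : Fin 3) : pt 0 (Pi.single i 1) = Pi.single i.succ (1 : ℝ) := by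
  rw [pt_zero_eq, Finset.sum_eq_single i (fun j _ hj => by rw [Pi.single_eq_of_ne hj, zero_smul])
    (by simp), Pi.single_eq_same, one_smul]

theorem hasFDerivAt_pt_right (t : ℝ) (x : Space) :
    ∃ A : Space →L[ℝ] Spacetime, HasFDerivAt (fun x => pt t x) A x ∧
      ∀ i, A (Pi.single i 1) = Pi.single i.succ 1 := by
  let A : Space →ₗ[ℝ] Spacetime :=
    { toFun := fun v => pt 0 v
      map_add' := fun v w => by
        funext i; refine Fin.cases ?_ (fun j => ?_) i <;> simp [pt]
      map_smul' := fun c v => by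
        funext i; refine Fin.cases ?_ (fun j => ?_) i <;> simp [pt] }
  refine ⟨LinearMap.toContinuousLinearMap A, ?_, fun i => pt_zero_single i⟩
  have h : (fun x => pt t x) = fun x => pt t 0 + LinearMap.toContinuousLinearMap A x := by
    funext x
    have := pt_add_smul t 0 x 1
    rw [zero_add, one_smul, one_smul] at this
    exact this
  rw [h]
  exact ((LinearMap.toContinuousLinearMap A).hasFDerivAt).const_add _

theorem fderiv_slice {f : Spacetime → ℝ} (t : ℝ) (x : Space)
    (hf : DifferentiableAt ℝ f (pt t x)) (i : Fin 3) :
    DifferentiableAt ℝ (fun x => f (pt t x)) x ∧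
      fderiv ℝ (fun x => f (pt t x)) x (Pi.single i 1) = pd i.succ f (pt t x) := by
  obtain ⟨A, hA, hi⟩ := hasFDerivAt_pt_right t x
  have h := hf.hasFDerivAt.comp x hA
  refine ⟨h.differentiableAt, ?_⟩
  have h2 : fderiv ℝ (fun x => f (pt t x)) x = _ := h.fderiv
  rw [h2, ContinuousLinearMap.comp_apply, hi]
  rfl

theorem hasDerivAt_time {f : Spacetime → ℝ} (t : ℝ) (x : Space)
    (hf : DifferentiableAt ℝ f (pt t x)) :
    HasDerivAt (fun t => f (pt t x)) (pd 0 f (pt t x)) t := by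
  have h1 : HasDerivAt (fun t : ℝ => pt t x) (Pi.single 0 1) t := by
    rw [hasDerivAt_pi]
    intro i
    refine Fin.cases ?_ (fun j => ?_) i
    · exact hasDerivAt_id' t
    · rw [Pi.single_eq_of_ne (Fin.succ_ne_zero j)]
      exact hasDerivAt_const t _
  exact hf.hasFDerivAt.comp_hasDerivAt t h1

/-- The open slab of spacetime over a time interval. -/
def strip (t₀ t₁ : ℝ) : Set Spacetime := {q | q 0 ∈ Ioo t₀ t₁}

theorem isOpen_strip (t₀ t₁ : ℝ) : IsOpen (strip t₀ t₁) :=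
  isOpen_Ioo.preimage (continuous_apply 0)

/-- For a current of compact spatial support the space derivatives integrate to zero on every slice,
so only `∂₀ k⁰` contributes; Fubini and the fundamental theorem of calculus in time do the rest. -/
theorem integral_divergence {t₀ t₁ ρ : ℝ} {k : Fin 4 → Spacetime → ℝ}
    (hk : ∀ μ, ContDiffOn ℝ 1 (k μ) (strip t₀ t₁))
    (hρ : ∀ μ, ∀ q ∈ strip t₀ t₁, ρ < ‖sp q‖ → k μ q = 0) {s t : ℝ} (hs : t₀ < s) (hst : s ≤ t)
    (ht : t < t₁) :
    Integrable (fun p : ℝ × Space => ∑ μ, pd μ (k μ) (pt p.1 p.2))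
      ((volume.restrict (Ioc s t)).prod volume) ∧
    ∫ x, k 0 (pt t x) = (∫ x, k 0 (pt s x)) +
      ∫ p, ∑ μ, pd μ (k μ) (pt p.1 p.2) ∂(volume.restrict (Ioc s t)).prod volume := by
  have hO := isOpen_strip t₀ t₁
  have hmem : ∀ τ ∈ Icc s t, ∀ x, pt τ x ∈ strip t₀ t₁ := fun τ hτ x =>
    ⟨hs.trans_le hτ.1, hτ.2.trans_lt ht⟩
  have hdiff : ∀ μ, ∀ q ∈ strip t₀ t₁, DifferentiableAt ℝ (k μ) q := fun μ q hq =>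
    differentiableAt_of_contDiffOn hO (n := 1) (by exact_mod_cast hk μ) one_ne_zero hq
  have hpdc : ∀ μ ν, ContinuousOn (pd ν (k μ)) (strip t₀ t₁) := fun μ ν =>
    (pd_contDiffOn hO (n := 0) (by exact_mod_cast hk μ) ν).continuousOn
  have hpdρ : ∀ μ ν, ∀ q ∈ strip t₀ t₁, ρ < ‖sp q‖ → pd ν (k μ) q = 0 := fun μ ν q hq hqρ => by
    have hO' : IsOpen (strip t₀ t₁ ∩ {q | ρ < ‖sp q‖}) :=
      hO.inter (isOpen_lt continuous_const continuous_sp.norm)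
    rw [pd_congr hO' (g := fun _ => 0) (fun q hq => hρ μ q hq.1 hq.2) ν ⟨hq, hqρ⟩]
    exact pd_const 0 ν q
  have hslice : ∀ f : Spacetime → ℝ, ContinuousOn f (strip t₀ t₁) →
      (∀ q ∈ strip t₀ t₁, ρ < ‖sp q‖ → f q = 0) → ∀ τ ∈ Icc s t,
      Integrable (fun x => f (pt τ x)) := fun f hf hf0 τ hτ => by
    have hc : Continuous fun x => f (pt τ x) := by
      rw [← continuousOn_univ]
      exact hf.comp (continuous_pt_right τ).continuousOn fun x _ => hmem τ hτ x
    refine hc.integrable_of_hasCompactSupport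
      (HasCompactSupport.intro (isCompact_closedBall 0 ρ) fun x hx => hf0 _ (hmem τ hτ x) ?_)
    simpa using hx
  have hspace : ∀ τ ∈ Icc s t, ∀ i : Fin 3, ∫ x, pd i.succ (k i.succ) (pt τ x) = 0 := by
    intro τ hτ i
    have hd := fun x => fderiv_slice τ x (hdiff i.succ _ (hmem τ hτ x)) i
    -- Integration by parts against the constant function `1`.
    have h := integral_mul_fderiv_eq_neg_fderiv_mul_of_integrable (𝕜 := ℝ) (μ := volume)
      (f := fun _ : Space => (1 : ℝ)) (g := fun x => k i.succ (pt τ x)) (v := Pi.single i 1)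
      (by simp) (by
        simp only [(hd _).2, one_mul]
        exact hslice _ (hpdc _ _) (hpdρ _ _) τ hτ) (by
        simp only [one_mul]
        exact hslice _ (hk _).continuousOn (hρ _) τ hτ) (fun x _ => by fun_prop) (fun x _ => (hd x).1)
    simpa [(hd _).2] using h
  have hint : ∀ μ, Integrable (fun p : ℝ × Space => pd μ (k μ) (pt p.1 p.2))
      ((volume.restrict (Ioc s t)).prod volume) := fun μ => by
    have hcomp : IsCompact (Icc s t ×ˢ (Metric.closedBall (0 : Space) ρ)) :=
      isCompact_Icc.prod (isCompact_closedBall 0 ρ)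
    have hc : ContinuousOn (fun p : ℝ × Space => pd μ (k μ) (pt p.1 p.2)) (Icc s t ×ˢ univ) :=
      (hpdc μ μ).comp continuous_pt.continuousOn fun p hp => hmem p.1 hp.1 p.2
    have h1 := (hc.mono (prod_mono subset_rfl (subset_univ _))).integrableOn_compact
      (μ := volume.prod volume) hcomp
    have h2 : IntegrableOn (fun p : ℝ × Space => pd μ (k μ) (pt p.1 p.2)) (Ioc s t ×ˢ univ)
        (volume.prod volume) := by
      refine IntegrableOn.of_forall_sdiff_eq_zero (h1.mono_set (prod_mono
        Ioc_subset_Icc_self subset_rfl)) (measurableSet_Ioc.prod MeasurableSet.univ) fun p hp => ?_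
      refine hpdρ μ μ _ (hmem _ (Ioc_subset_Icc_self hp.1.1) _) ?_
      by_contra hcon
      exact hp.2 ⟨hp.1.1, by simpa using hcon⟩
    rwa [IntegrableOn, ← Measure.prod_restrict, Measure.restrict_univ] at h2
  have hftc : ∀ x, k 0 (pt t x) - k 0 (pt s x) = ∫ τ in Ioc s t, pd 0 (k 0) (pt τ x) := by
    intro x
    rw [← intervalIntegral.integral_of_le hst]
    symm
    refine intervalIntegral.integral_eq_sub_of_hasDerivAt (f := fun τ => k 0 (pt τ x))
      (fun τ hτ => ?_) ?_
    · rw [uIcc_of_le hst] at hτ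
      exact hasDerivAt_time τ x (hdiff 0 _ (hmem τ hτ x))
    · apply ContinuousOn.intervalIntegrable
      rw [uIcc_of_le hst]
      refine (hpdc 0 0).comp (Continuous.continuousOn ?_) fun τ hτ => hmem τ hτ x
      exact continuous_pt.comp (Continuous.prodMk_left x)
  have h0 := fun τ hτ => hslice (k 0) (hk 0).continuousOn (hρ 0) τ hτ
  have hsum := integrable_finsetSum Finset.univ fun μ _ => hint μ
  have hsplit : ∫ p, ∑ μ, pd μ (k μ) (pt p.1 p.2) ∂(volume.restrict (Ioc s t)).prod volume =
      ∫ τ in Ioc s t, ∫ x, pd 0 (k 0) (pt τ x) := by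
    rw [integral_prod _ hsum]
    refine setIntegral_congr_fun measurableSet_Ioc fun τ hτ => ?_
    have hτ' := Ioc_subset_Icc_self hτ
    simp only
    rw [integral_finsetSum _ fun μ _ => hslice _ (hpdc μ μ) (hpdρ μ μ) τ hτ', Fin.sum_univ_succ]
    simp [hspace τ hτ']
  refine ⟨hsum, ?_⟩
  rw [hsplit, integral_integral_swap (hint 0),
    ← integral_congr_ae (Filter.Eventually.of_forall hftc),
    integral_sub (h0 t ⟨hst, le_rfl⟩) (h0 s ⟨le_rfl, hst⟩)]
  ring

/-! ### Domains with a defining function -/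

/-- The slices `O t` are cut out of `ℝ² × (0, b)` by `φ > 0`, they are convex, decrease in time, and
contain large sets close to every point; `Y` is an outward field near the lateral boundary. -/
structure SliceDomain (t₀ t₁ b : ℝ) (O : ℝ → Set Space) (φ : Spacetime → ℝ)
    (Y : Fin 4 → Spacetime → ℝ) : Prop where
  lt : t₀ < t₁
  le_neg_one : t₁ ≤ -1
  b_le : b ≤ 2
  mem_iff : ∀ t ≤ t₁, ∀ x, x ∈ O t ↔ x 2 ∈ Ioo 0 b ∧ 0 < φ (pt t x)
  smooth : ContDiffOn ℝ 1 φ {q | q 0 < 0 ∧ 0 < q 3}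
  anti : ∀ s t, s ≤ t → t ≤ t₁ → O t ⊆ O s
  convex : ∀ t ≤ t₁, Convex ℝ (O t)
  exists_box : ∀ t ≤ t₁, ∀ x ∈ O t, ∃ B ⊆ O t, MeasurableSet B ∧
    ENNReal.ofReal (1 / 64) ≤ volume B ∧ ∀ y ∈ B, ‖y - x‖ ≤ 4
  Y_smooth : ∀ μ, ContDiff ℝ 1 (Y μ)
  Y_zero : ∀ q, Y 0 q = 0
  Y_three : ∀ q, Y 3 q = 0
  Y_low : ∀ q, q 3 ≤ 1 / 4 → ∀ μ, Y μ q = 0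
  Y_support : ∃ ρ : ℝ, ∀ q ∈ region (Ioo t₀ t₁) O, ρ ≤ ‖sp q‖ → ∀ μ, Y μ q = 0
  Y_flux : ∀ q ∈ region (Ioo t₀ t₁) O, ∑ μ, pd μ φ q * Y μ q ≤ 0
  Y_flux_lt : ∀ q, q 0 ∈ Ioo t₀ t₁ → 1 / 2 ≤ q 3 → q 3 < b → φ q = 0 →
    ∑ μ, pd μ φ q * Y μ q < 0

section

variable {t₀ t₁ b : ℝ} {O : ℝ → Set Space} {φ : Spacetime → ℝ} {Y : Fin 4 → Spacetime → ℝ}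

theorem isOpen_smoothSet : IsOpen {q : Spacetime | q 0 < 0 ∧ 0 < q 3} :=
  (isOpen_lt (continuous_apply 0) continuous_const).inter
    (isOpen_lt continuous_const (continuous_apply 3))

theorem SliceDomain.mem_region_iff (D : SliceDomain t₀ t₁ b O φ Y) {q : Spacetime} :
    q ∈ region (Ioo t₀ t₁) O ↔ q 0 ∈ Ioo t₀ t₁ ∧ q 3 ∈ Ioo 0 b ∧ 0 < φ q := by
  rw [mem_region]
  refine and_congr_right fun h => ?_
  rw [D.mem_iff _ h.2.le, pt_sp]
  rfl

theorem SliceDomain.isOpen_region (D : SliceDomain t₀ t₁ b O φ Y) :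
    IsOpen (region (Ioo t₀ t₁) O) := by
  have hS : IsOpen {q : Spacetime | q 0 ∈ Ioo t₀ t₁ ∧ q 3 ∈ Ioo 0 b} :=
    (isOpen_Ioo.preimage (continuous_apply 0)).inter (isOpen_Ioo.preimage (continuous_apply 3))
  have hc : ContinuousOn φ {q : Spacetime | q 0 ∈ Ioo t₀ t₁ ∧ q 3 ∈ Ioo 0 b} :=
    D.smooth.continuousOn.mono fun q hq =>
      ⟨by have := hq.1.2; have := D.le_neg_one; linarith, hq.2.1⟩
  convert hc.isOpen_inter_preimage hS isOpen_Ioi (t := Ioi 0) using 1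
  ext q
  rw [D.mem_region_iff]
  exact and_assoc.symm

theorem SliceDomain.isOpen_slice (D : SliceDomain t₀ t₁ b O φ Y) {t : ℝ} (ht : t ∈ Ioo t₀ t₁) :
    IsOpen (O t) := by
  have h := D.isOpen_region.preimage (continuous_pt_right t)
  convert h using 1
  ext x
  rw [mem_preimage, pt_mem_region]
  simp [ht.1, ht.2]

/-- The part of the closure of the region over a closed ball is compact, because the time interval
is bounded. Continuous extension to the closure therefore gives bounds that are uniform up to both
end times. -/
theorem exists_bound_of_ext {f : Spacetime → ℝ} (hf : Ext (region (Ioo t₀ t₁) O) f) {ρ : ℝ}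
    (hρ : ∀ q ∈ region (Ioo t₀ t₁) O, ρ < ‖sp q‖ → f q = 0) :
    ∃ C, 0 ≤ C ∧ ∀ q ∈ region (Ioo t₀ t₁) O, |f q| ≤ C := by
  obtain ⟨g, hg, hgf⟩ := hf
  have hK : IsCompact (closure (region (Ioo t₀ t₁) O) ∩
      (fun p : ℝ × Space => pt p.1 p.2) '' (Icc t₀ t₁ ×ˢ Metric.closedBall 0 ρ)) :=
    ((isCompact_Icc.prod (isCompact_closedBall 0 ρ)).image continuous_pt).inter_left isClosed_closure
  obtain ⟨C, hC⟩ := hK.exists_bound_of_continuousOn (hg.mono inter_subset_left)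
  refine ⟨max C 0, le_max_right _ _, fun q hq => ?_⟩
  by_cases h : ρ < ‖sp q‖
  · simp [hρ q hq h]
  · rw [← hgf hq]
    refine (hC q ⟨subset_closure hq, (q 0, sp q), ⟨Ioo_subset_Icc_self hq.1, ?_⟩, pt_sp q⟩).trans
      (le_max_left _ _)
    simpa using h

theorem integrableOn_slice (D : SliceDomain t₀ t₁ b O φ Y) {f : Spacetime → ℝ}
    (hf : ContinuousOn f (region (Ioo t₀ t₁) O)) {C ρ : ℝ}
    (hC : ∀ q ∈ region (Ioo t₀ t₁) O, |f q| ≤ C)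
    (hρ : ∀ q ∈ region (Ioo t₀ t₁) O, ρ < ‖sp q‖ → f q = 0) {τ : ℝ} (hτ : τ ∈ Ioo t₀ t₁) :
    IntegrableOn (fun x => f (pt τ x)) (O τ) := by
  have hm := (D.isOpen_slice hτ).measurableSet
  have hmem : ∀ x ∈ O τ, pt τ x ∈ region (Ioo t₀ t₁) O := fun x hx => ⟨hτ, hx⟩
  have h1 : IntegrableOn (fun x => f (pt τ x)) (O τ ∩ Metric.closedBall 0 ρ) := by
    refine IntegrableOn.of_bound ?_ ?_ C ?_
    · exact (measure_mono inter_subset_right).trans_lt measure_closedBall_lt_top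
    · exact ((hf.comp (continuous_pt_right τ).continuousOn hmem).mono
        inter_subset_left).aestronglyMeasurable (hm.inter measurableSet_closedBall)
    · refine (ae_restrict_iff' (hm.inter measurableSet_closedBall)).2
        (Filter.Eventually.of_forall fun x hx => hC _ (hmem x hx.1))
  refine h1.of_forall_sdiff_eq_zero hm fun x hx => hρ _ (hmem x hx.1) ?_
  by_contra hcon
  exact hx.2 ⟨hx.1, by simpa using hcon⟩

/-- The part of the region in a time interval as a subset of a product. -/
theorem integrable_prod_region (D : SliceDomain t₀ t₁ b O φ Y) {f : Spacetime → ℝ}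
    (hf : ContinuousOn f (region (Ioo t₀ t₁) O)) {C ρ : ℝ}
    (hC : ∀ q ∈ region (Ioo t₀ t₁) O, |f q| ≤ C)
    (hρ : ∀ q ∈ region (Ioo t₀ t₁) O, ρ < ‖sp q‖ → f q = 0) (s t : ℝ) :
    AEStronglyMeasurable (fun p : ℝ × Space => (region (Ioo t₀ t₁) O).indicator f (pt p.1 p.2))
      ((volume.restrict (Ioc s t)).prod volume) ∧
    (∀ p : ℝ × Space, ‖(region (Ioo t₀ t₁) O).indicator f (pt p.1 p.2)‖ ≤
      (univ ×ˢ Metric.closedBall (0 : Space) ρ).indicator (fun _ => max C 0) p) ∧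
    Integrable ((univ ×ˢ Metric.closedBall (0 : Space) ρ).indicator fun _ => max C 0)
      ((volume.restrict (Ioc s t)).prod (volume : Measure Space)) := by
  refine ⟨?_, fun p => ?_, ?_⟩
  · have hV : IsOpen ((fun p : ℝ × Space => pt p.1 p.2) ⁻¹' region (Ioo t₀ t₁) O) :=
      D.isOpen_region.preimage continuous_pt
    have : (fun p : ℝ × Space => (region (Ioo t₀ t₁) O).indicator f (pt p.1 p.2)) =
        ((fun p : ℝ × Space => pt p.1 p.2) ⁻¹' region (Ioo t₀ t₁) O).indicator
          fun p => f (pt p.1 p.2) := rfl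
    rw [this, aestronglyMeasurable_indicator_iff hV.measurableSet]
    exact (hf.comp continuous_pt.continuousOn fun p hp => hp).aestronglyMeasurable hV.measurableSet
  · by_cases hq : pt p.1 p.2 ∈ region (Ioo t₀ t₁) O
    · rw [indicator_of_mem hq]
      by_cases hp : p ∈ univ ×ˢ Metric.closedBall (0 : Space) ρ
      · rw [indicator_of_mem hp]
        exact (hC _ hq).trans (le_max_left _ _)
      · rw [indicator_of_notMem hp, hρ _ hq, norm_zero]
        by_contra hcon
        exact hp ⟨trivial, by simpa using hcon⟩
    · rw [indicator_of_notMem hq, norm_zero]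
      exact indicator_nonneg (fun _ _ => le_max_right _ _) _
  · refine (integrable_indicator_iff (MeasurableSet.univ.prod measurableSet_closedBall)).2 ?_
    refine integrableOn_const ?_
    rw [Measure.prod_prod]
    exact ENNReal.mul_ne_top (by simp) measure_closedBall_lt_top.ne

/-! ### Cutoffs -/

/-- The cutoff function with widths `δ` at the top and `ε` at the lateral boundary. -/
def cutoff (b : ℝ) (φ : Spacetime → ℝ) (δ ε : ℝ) (q : Spacetime) : ℝ :=
  Real.smoothTransition ((b - q 3) / δ - 1) * Real.smoothTransition (φ q / ε - 1)

theorem cutoff_nonneg (δ ε : ℝ) (q : Spacetime) : 0 ≤ cutoff b φ δ ε q :=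
  mul_nonneg (Real.smoothTransition.nonneg _) (Real.smoothTransition.nonneg _)

theorem cutoff_le_one (δ ε : ℝ) (q : Spacetime) : cutoff b φ δ ε q ≤ 1 :=
  mul_le_one₀ (Real.smoothTransition.le_one _) (Real.smoothTransition.nonneg _)
    (Real.smoothTransition.le_one _)

theorem contDiffAt_cutoff {q : Spacetime} (hφ : ContDiffAt ℝ 1 φ q) (δ ε : ℝ) :
    ContDiffAt ℝ 1 (cutoff b φ δ ε) q := by
  refine ContDiffAt.mul ?_ ?_
  · refine (Real.smoothTransition.contDiff (n := 1)).contDiffAt.comp q (f := fun q : Spacetime =>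
      (b - q 3) / δ - 1) ?_
    exact (((contDiff_const.sub (contDiff_apply ℝ ℝ (3 : Fin 4))).div_const δ).sub
      contDiff_const).contDiffAt
  · exact (Real.smoothTransition.contDiff (n := 1)).contDiffAt.comp q (f := fun q : Spacetime =>
      φ q / ε - 1) ((hφ.div_const ε).sub contDiffAt_const)

theorem pd_comp {η : ℝ → ℝ} {g : Spacetime → ℝ} {q : Spacetime}
    (hη : DifferentiableAt ℝ η (g q)) (hg : DifferentiableAt ℝ g q) (μ : Fin 4) :
    pd μ (fun q => η (g q)) q = deriv η (g q) * pd μ g q := by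
  have h := hη.hasDerivAt.comp_hasFDerivAt q hg.hasFDerivAt
  have h2 : fderiv ℝ (fun q => η (g q)) q = _ := h.fderiv
  simp [pd, h2]

theorem pd_coord (ν μ : Fin 4) (q : Spacetime) :
    pd μ (fun q : Spacetime => q ν) q = if μ = ν then 1 else 0 := by
  have h : HasFDerivAt (fun q : Spacetime => q ν)
    (ContinuousLinearMap.proj (R := ℝ) (φ := fun _ : Fin 4 => ℝ) ν) q :=
    (ContinuousLinearMap.proj (R := ℝ) (φ := fun _ : Fin 4 => ℝ) ν).hasFDerivAt
  simp only [pd, h.fderiv, ContinuousLinearMap.proj_apply, Pi.single_apply]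
  simp [eq_comm]

/-- The derivative of the cutoff along a current with the right signs is nonpositive. -/
theorem cutoff_flux_nonpos {q : Spacetime} (hφ : ContDiffAt ℝ 1 φ q) {δ ε : ℝ} (hδ : 0 < δ)
    (hε : 0 < ε) (j : Fin 4 → ℝ) (h3 : 0 ≤ j 3)
    (hflux : q 3 ≤ b - δ → φ q ≤ 2 * ε → ∑ μ, pd μ φ q * j μ ≤ 0) :
    ∑ μ, pd μ (cutoff b φ δ ε) q * j μ ≤ 0 := by
  have hd := hφ.differentiableAt one_ne_zero
  have hη : ∀ x, DifferentiableAt ℝ Real.smoothTransition x := fun x =>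
    (Real.smoothTransition.contDiff (n := 1)).contDiffAt.differentiableAt one_ne_zero
  have hη0 : ∀ x, 0 ≤ deriv Real.smoothTransition x := fun x =>
    Real.smoothTransition.monotone.deriv_nonneg
  have hd1 : DifferentiableAt ℝ (fun q : Spacetime => (b - q 3) / δ - 1) q := by fun_prop
  have hd2 : DifferentiableAt ℝ (fun q : Spacetime => φ q / ε - 1) q :=
    by fun_prop
  set A := Real.smoothTransition ((b - q 3) / δ - 1) with hA
  set B := Real.smoothTransition (φ q / ε - 1) with hB
  set A' := deriv Real.smoothTransition ((b - q 3) / δ - 1) with hA'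
  set B' := deriv Real.smoothTransition (φ q / ε - 1) with hB'
  have e1 : ∀ μ, pd μ (fun q : Spacetime => (b - q 3) / δ - 1) q = if μ = 3 then -δ⁻¹ else 0 := by
    intro μ
    have h3d : DifferentiableAt ℝ (fun q : Spacetime => q 3) q := by fun_prop
    have : (fun q : Spacetime => (b - q 3) / δ - 1) = fun q => (-δ⁻¹) * q 3 + (b / δ - 1) := by
      funext q; field_simp; ring
    rw [this, pd_add (h3d.const_mul _) (differentiableAt_const _), pd_const_mul h3d, pd_const,
      pd_coord]
    split_ifs <;> simp
  have e2 : ∀ μ, pd μ (fun q : Spacetime => φ q / ε - 1) q = ε⁻¹ * pd μ φ q := by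
    intro μ
    have : (fun q : Spacetime => φ q / ε - 1) = fun q => ε⁻¹ * φ q + (-1) := by
      funext q; field_simp; ring
    rw [this, pd_add (hd.const_mul _) (differentiableAt_const _), pd_const_mul hd, pd_const,
      add_zero]
  have e : ∀ μ, pd μ (cutoff b φ δ ε) q =
      A' * (if μ = 3 then -δ⁻¹ else 0) * B + A * (B' * (ε⁻¹ * pd μ φ q)) := fun μ => by
    have hp := pd_mul (f := fun q => Real.smoothTransition ((b - q 3) / δ - 1))
      (g := fun q => Real.smoothTransition (φ q / ε - 1)) (q := q)
      (DifferentiableAt.comp q (g := Real.smoothTransition) (hη _) hd1)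
      (DifferentiableAt.comp q (g := Real.smoothTransition) (hη _) hd2) μ
    rw [pd_comp (hη _) hd1, pd_comp (hη _) hd2, e1, e2] at hp
    exact hp
  have e3 : ∑ μ, pd μ (cutoff b φ δ ε) q * j μ =
      -(A' * δ⁻¹ * B * j 3) + A * B' * ε⁻¹ * ∑ μ, pd μ φ q * j μ := by
    simp only [e, Fin.sum_univ_four]
    simp; ring
  have hA0 : 0 ≤ A := Real.smoothTransition.nonneg _
  have hB0 : 0 ≤ B := Real.smoothTransition.nonneg _
  have hA'0 : 0 ≤ A' := hη0 _
  have hB'0 : 0 ≤ B' := hη0 _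
  have hi1 : 0 < δ⁻¹ := inv_pos.2 hδ
  have hi2 : 0 < ε⁻¹ := inv_pos.2 hε
  rw [e3]
  have k1 : 0 ≤ A' * δ⁻¹ * B * j 3 := by positivity
  suffices A * B' * ε⁻¹ * ∑ μ, pd μ φ q * j μ ≤ 0 by linarith
  -- Outside the zone where the flux hypothesis applies, the lateral term vanishes: for `q 3 > b -
  -- δ` the top factor is zero, and for `φ > 2 ε` the lateral factor is locally constant.
  by_cases h1 : q 3 ≤ b - δ
  · by_cases h2 : φ q ≤ 2 * ε
    · exact mul_nonpos_of_nonneg_of_nonpos (by positivity) (hflux h1 h2)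
    · have : B' = 0 := by
        have hx : 1 < φ q / ε - 1 := by
          rw [lt_sub_iff_add_lt, lt_div_iff₀ hε]; linarith
        have : Real.smoothTransition =ᶠ[nhds (φ q / ε - 1)] fun _ => 1 := by
          filter_upwards [Ioi_mem_nhds hx] with y hy
          exact Real.smoothTransition.one_of_one_le (le_of_lt hy)
        rw [hB', this.deriv_eq, deriv_const]
      simp [this]
  · have : A = 0 := by
      refine Real.smoothTransition.zero_of_nonpos ?_
      rw [sub_nonpos, div_le_one hδ]; linarith
    simp [this]

end

/-! ### The divergence inequality on the region -/

section

variable {t₀ t₁ b : ℝ} {O : ℝ → Set Space} {φ : Spacetime → ℝ} {Y : Fin 4 → Spacetime → ℝ}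

theorem SliceDomain.contDiffAt (D : SliceDomain t₀ t₁ b O φ Y) {q : Spacetime} (h0 : q 0 < t₁)
    (h3 : 0 < q 3) : ContDiffAt ℝ 1 φ q :=
  D.smooth.contDiffAt (isOpen_smoothSet.mem_nhds ⟨by have := D.le_neg_one; linarith, h3⟩)

theorem SliceDomain.pd_continuousOn (D : SliceDomain t₀ t₁ b O φ Y) (μ : Fin 4) :
    ContinuousOn (pd μ φ) {q | q 0 < 0 ∧ 0 < q 3} :=
  (pd_contDiffOn isOpen_smoothSet (n := 0) (by exact_mod_cast D.smooth) μ).continuousOn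

/-- A current whose flux through the lateral boundary is strictly outward has outward flux near the
lateral boundary. -/
theorem SliceDomain.exists_flux_nonpos (D : SliceDomain t₀ t₁ b O φ Y) {je : Fin 4 → Spacetime → ℝ}
    (hje : ∀ μ, ContinuousOn (je μ) (closure (region (Ioo t₀ t₁) O)))
    (hlat : ∀ q ∈ closure (region (Ioo t₀ t₁) O), q 0 ∈ Ioo t₀ t₁ → q 3 ∈ Ioo 0 b → φ q = 0 →
      ∑ μ, pd μ φ q * je μ q ≤ 0) {s t : ℝ} (hs : t₀ < s) (ht : t < t₁) (ρ : ℝ) {κ δ : ℝ}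
    (hκ : 0 < κ) (hδ : 0 < δ) :
    ∃ ε > 0, ∀ q ∈ closure (region (Ioo t₀ t₁) O), q 0 ∈ Icc s t → 1 / 2 ≤ q 3 → q 3 ≤ b - δ →
      ‖sp q‖ ≤ ρ → 0 ≤ φ q → φ q ≤ 2 * ε → ∑ μ, pd μ φ q * (je μ q + κ * Y μ q) ≤ 0 := by
  set K : Set Spacetime := closure (region (Ioo t₀ t₁) O) ∩
    ((fun p : ℝ × Space => pt p.1 p.2) '' (Icc s t ×ˢ Metric.closedBall 0 ρ) ∩
      {q | q 3 ∈ Icc (1 / 2) (b - δ)}) with hK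
  have hKc : IsCompact K :=
    (((isCompact_Icc.prod (isCompact_closedBall 0 ρ)).image continuous_pt).inter_right
      (isClosed_Icc.preimage (continuous_apply 3))).inter_left isClosed_closure
  have hK0 : ∀ q ∈ K, q 0 ∈ Icc s t := by
    rintro q ⟨-, ⟨p, hp, rfl⟩, -⟩
    exact hp.1
  have hKW : K ⊆ {q | q 0 < 0 ∧ 0 < q 3} := fun q hq =>
    ⟨by have := (hK0 q hq).2; have := D.le_neg_one; linarith,
      by have := hq.2.2.1; linarith⟩
  have hfc : ContinuousOn (fun q => ∑ μ, pd μ φ q * (je μ q + κ * Y μ q)) K :=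
    continuousOn_finsetSum _ fun μ _ => ((D.pd_continuousOn μ).mono hKW).mul
      (((hje μ).mono inter_subset_left).add (continuousOn_const.mul (D.Y_smooth μ).continuous.continuousOn))
  have hφc : ContinuousOn φ K := D.smooth.continuousOn.mono hKW
  -- The bad points: those of `K` with `φ ≥ 0` where the perturbed flux fails to be strictly
  -- outward. This set is compact and misses `φ = 0`, because there the flux of `je` has the weak
  -- sign and that of `Y` the strict one. Hence `φ` has a positive lower bound on it.
  set K' : Set Spacetime := K ∩ (fun q => (∑ μ, pd μ φ q * (je μ q + κ * Y μ q), φ q)) ⁻¹'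
    (Ici 0 ×ˢ Ici 0) with hK'
  have hK'c : IsCompact K' := hKc.of_isClosed_subset
    ((hfc.prodMk hφc).preimage_isClosed_of_isClosed hKc.isClosed (isClosed_Ici.prod isClosed_Ici))
    inter_subset_left
  have hpos : ∀ q ∈ K', 0 < φ q := fun q hq => by
    refine lt_of_le_of_ne hq.2.2 fun h => ?_
    have h0 := hK0 q hq.1
    have h0' : q 0 ∈ Ioo t₀ t₁ := ⟨hs.trans_le h0.1, h0.2.trans_lt ht⟩
    have h3 : q 3 ∈ Icc (1 / 2) (b - δ) := hq.1.2.2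
    have h1 := hlat q hq.1.1 h0' ⟨by linarith [h3.1], by linarith [h3.2]⟩ h.symm
    have h2 := D.Y_flux_lt q h0' h3.1 (by linarith [h3.2]) h.symm
    have h4 : 0 ≤ ∑ μ, pd μ φ q * (je μ q + κ * Y μ q) := hq.2.1
    have h5 : ∑ μ, pd μ φ q * (je μ q + κ * Y μ q) =
        ∑ μ, pd μ φ q * je μ q + κ * ∑ μ, pd μ φ q * Y μ q := by
      rw [Finset.mul_sum, ← Finset.sum_add_distrib]
      exact Finset.sum_congr rfl fun μ _ => by ring
    have h6 := mul_neg_of_pos_of_neg hκ h2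
    linarith
  obtain ⟨m, hm, hmin⟩ : ∃ m > 0, ∀ q ∈ K', m ≤ φ q := by
    rcases K'.eq_empty_or_nonempty with he | hne
    · exact ⟨1, one_pos, by simp [he]⟩
    · obtain ⟨q₀, hq₀, h⟩ := hK'c.exists_isMinOn hne (hφc.mono inter_subset_left)
      exact ⟨φ q₀, hpos q₀ hq₀, fun q hq => h hq⟩
  refine ⟨m / 4, by positivity, fun q hq h0 h3 h3' hqρ hφ0 hφ => ?_⟩
  by_contra hcon
  have hqK : q ∈ K := ⟨hq, ⟨(q 0, sp q), ⟨h0, by simpa using hqρ⟩, pt_sp q⟩, h3, h3'⟩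
  have := hmin q ⟨hqK, (not_le.1 hcon).le, hφ0⟩
  linarith

/-- The cut off divergence inequality for a current with a small outward current added. -/
theorem SliceDomain.cutoff_divergence_le (D : SliceDomain t₀ t₁ b O φ Y)
    {j je : Fin 4 → Spacetime → ℝ} (hj : ∀ μ, ContDiffOn ℝ 1 (j μ) (region (Ioo t₀ t₁) O))
    (hje : ∀ μ, ContinuousOn (je μ) (closure (region (Ioo t₀ t₁) O)))
    (hjeq : ∀ μ, EqOn (je μ) (j μ) (region (Ioo t₀ t₁) O)) {ρ : ℝ}
    (hρ : ∀ μ, ∀ q ∈ region (Ioo t₀ t₁) O, ρ < ‖sp q‖ → j μ q = 0)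
    (hlow : ∀ μ, ∀ q ∈ region (Ioo t₀ t₁) O, q 3 < 1 / 2 → j μ q = 0)
    (hj3 : ∀ q ∈ region (Ioo t₀ t₁) O, 0 ≤ j 3 q)
    (hlat : ∀ q ∈ closure (region (Ioo t₀ t₁) O), q 0 ∈ Ioo t₀ t₁ → q 3 ∈ Ioo 0 b → φ q = 0 →
      ∑ μ, pd μ φ q * je μ q ≤ 0) {C : ℝ}
    (hC : ∀ q ∈ region (Ioo t₀ t₁) O, |∑ μ, pd μ (fun q => j μ q) q| ≤ C)
    {CY ρY : ℝ} (hCY : ∀ q ∈ region (Ioo t₀ t₁) O, |∑ μ, pd μ (fun q => Y μ q) q| ≤ CY)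
    (hρY : ∀ q ∈ region (Ioo t₀ t₁) O, ρY ≤ ‖sp q‖ → ∀ μ, Y μ q = 0)
    {s t : ℝ} (hs : t₀ < s) (hst : s ≤ t) (ht : t < t₁) {κ δ : ℝ} (hκ : 0 < κ) (hδ : 0 < δ)
    (hκ1 : κ ≤ 1) :
    ∃ ε > 0, ε ≤ δ ∧
      ∫ x in O t, cutoff b φ δ ε (pt t x) * j 0 (pt t x) ≤
        (∫ x in O s, cutoff b φ δ ε (pt s x) * j 0 (pt s x)) +
        ∫ p, (region (Ioo t₀ t₁) O).indicator (fun q => cutoff b φ δ ε q *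
          (∑ μ, pd μ (j μ) q + κ * ∑ μ, pd μ (Y μ) q)) (pt p.1 p.2)
          ∂(volume.restrict (Ioc s t)).prod volume := by
  set U := region (Ioo t₀ t₁) O with hUdef
  have hU : IsOpen U := D.isOpen_region
  obtain ⟨ε', hε', hflux⟩ := D.exists_flux_nonpos hje hlat hs ht ρ hκ hδ
  refine ⟨min ε' δ, lt_min hε' hδ, min_le_right _ _, ?_⟩
  set ε := min ε' δ with hε
  have hε0 : 0 < ε := lt_min hε' hδ
  set ψ := cutoff b φ δ ε with hψ
  -- The lateral flux of `j` has only a weak sign on the boundary. Adding `κ Y` makes it strict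
  -- there, hence nonpositive in the collar where the cutoff varies.
  set J : Fin 4 → Spacetime → ℝ := fun μ q => j μ q + κ * Y μ q with hJ
  have hJc : ∀ μ, ContDiffOn ℝ 1 (J μ) U := fun μ =>
    (hj μ).add (contDiffOn_const.mul (D.Y_smooth μ).contDiffOn)
  have hUt : ∀ q ∈ U, q 0 < t₁ := fun q hq => hq.1.2
  have hU3 : ∀ q ∈ U, 0 < q 3 := fun q hq => (D.mem_region_iff.1 hq).2.1.1
  have hψc : ∀ q ∈ U, ContDiffAt ℝ 1 ψ q := fun q hq =>
    contDiffAt_cutoff (D.contDiffAt (hUt q hq) (hU3 q hq)) δ ε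
  set k : Fin 4 → Spacetime → ℝ := fun μ => U.indicator fun q => ψ q * J μ q with hk
  have hkU : ∀ μ, ∀ q ∈ U, k μ =ᶠ[nhds q] fun q => ψ q * J μ q := fun μ q hq =>
    Filter.eventuallyEq_of_mem (hU.mem_nhds hq) fun q hq => indicator_of_mem hq _
  have hk0 : ∀ μ, ∀ q ∈ strip t₀ t₁, q ∉ U → k μ =ᶠ[nhds q] fun _ => 0 := by
    intro μ q hqs hq
    have main : ∀ V ∈ nhds q, (∀ q ∈ V, q ∈ U → ψ q * J μ q = 0) → k μ =ᶠ[nhds q] fun _ => 0 := by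
      intro V hV h
      filter_upwards [hV] with y hy
      by_cases hyU : y ∈ U
      · rw [hk]; simp only; rw [indicator_of_mem hyU, h y hy hyU]
      · exact indicator_of_notMem hyU _
    -- The extension by zero is `C¹` on the whole strip because `ψ J` vanishes near every boundary
    -- point: near the bottom by the supports of `j` and `Y`, near the top by the first cutoff
    -- factor, and near the lateral boundary by the second.
    by_cases h1 : q 3 ≤ 0
    · refine main {q | q 3 < 1 / 4} ((isOpen_lt (continuous_apply 3) continuous_const).mem_nhds
        (by simp only [mem_ofPred_eq]; linarith)) fun y hy hyU => ?_
      have hy' : y 3 < 1 / 4 := hy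
      simp [hJ, hlow μ y hyU (by linarith), D.Y_low y hy'.le μ]
    by_cases h2 : b ≤ q 3
    · refine main {q | b - δ < q 3} ((isOpen_lt continuous_const (continuous_apply 3)).mem_nhds
        (by simp only [mem_ofPred_eq]; linarith)) fun y hy hyU => ?_
      have hy' : b - δ < y 3 := hy
      have : ψ y = 0 := by
        rw [hψ, cutoff, Real.smoothTransition.zero_of_nonpos, zero_mul]
        rw [sub_nonpos, div_le_one hδ]; linarith
      simp [this]
    · push Not at h1 h2
      have hφq : φ q ≤ 0 := by
        by_contra hcon
        exact hq (D.mem_region_iff.2 ⟨hqs, ⟨h1, h2⟩, not_le.1 hcon⟩)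
      have hc := (D.contDiffAt hqs.2 h1).continuousAt
      refine main (φ ⁻¹' Iio ε) (hc (Iio_mem_nhds (by linarith))) fun y hy hyU => ?_
      have hy' : φ y < ε := hy
      have : ψ y = 0 := by
        rw [hψ, cutoff, Real.smoothTransition.zero_of_nonpos (x := φ y / ε - 1), mul_zero]
        rw [sub_nonpos, div_le_one hε0]; exact hy'.le
      simp [this]
  have hkc : ∀ μ, ContDiffOn ℝ 1 (k μ) (strip t₀ t₁) := fun μ q hq => by
    refine ContDiffAt.contDiffWithinAt ?_
    by_cases hqU : q ∈ U
    · exact ((hψc q hqU).mul ((hJc μ).contDiffAt (hU.mem_nhds hqU))).congr_of_eventuallyEq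
        (hkU μ q hqU)
    · exact contDiffAt_const.congr_of_eventuallyEq (hk0 μ q hq hqU)
  have hkρ : ∀ μ, ∀ q ∈ strip t₀ t₁, max ρ ρY < ‖sp q‖ → k μ q = 0 := fun μ q _ h => by
    by_cases hqU : q ∈ U
    · rw [hk]; simp only
      rw [indicator_of_mem hqU]
      simp [hJ, hρ μ q hqU ((le_max_left _ _).trans_lt h),
        hρY q hqU ((le_max_right _ _).trans h.le) μ]
    · exact indicator_of_notMem hqU _
  obtain ⟨hint, hdiv⟩ := integral_divergence hkc hkρ hs hst ht
  have hslice : ∀ τ ∈ Icc s t, ∫ x, k 0 (pt τ x) = ∫ x in O τ, ψ (pt τ x) * j 0 (pt τ x) := by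
    intro τ hτ
    have hτ' : τ ∈ Ioo t₀ t₁ := ⟨hs.trans_le hτ.1, hτ.2.trans_lt ht⟩
    rw [← integral_indicator (D.isOpen_slice hτ').measurableSet]
    refine integral_congr_ae (Filter.Eventually.of_forall fun x => ?_)
    by_cases hx : x ∈ O τ
    · have : pt τ x ∈ U := ⟨hτ', hx⟩
      simp only [hk, indicator_of_mem this, indicator_of_mem hx, hJ, D.Y_zero, mul_zero, add_zero]
    · have : pt τ x ∉ U := fun h => hx h.2
      simp only [hk, indicator_of_notMem this, indicator_of_notMem hx]
  rw [hslice t ⟨hst, le_rfl⟩, hslice s ⟨le_rfl, hst⟩] at hdiv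
  rw [hdiv]
  refine add_le_add le_rfl ?_
  have hJd : ∀ μ, ∀ q ∈ U, DifferentiableAt ℝ (j μ) q ∧ DifferentiableAt ℝ (Y μ) q :=
    fun μ q hq => ⟨differentiableAt_of_contDiffOn hU (n := 1) (by exact_mod_cast hj μ)
      one_ne_zero hq, (D.Y_smooth μ).differentiable one_ne_zero q⟩
  have hdivJ : ∀ q ∈ U, ∑ μ, pd μ (J μ) q = ∑ μ, pd μ (j μ) q + κ * ∑ μ, pd μ (Y μ) q := by
    intro q hq
    rw [Finset.mul_sum, ← Finset.sum_add_distrib]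
    refine Finset.sum_congr rfl fun μ _ => ?_
    rw [hJ]
    simp only
    rw [pd_add (hJd μ q hq).1 ((hJd μ q hq).2.const_mul κ), pd_const_mul (hJd μ q hq).2]
  refine integral_mono_ae hint ?_ ?_
  · have hcont : ContinuousOn (fun q => ψ q *
        (∑ μ, pd μ (j μ) q + κ * ∑ μ, pd μ (Y μ) q)) U := by
      have h1 : ContinuousOn ψ U := fun q hq => (hψc q hq).continuousAt.continuousWithinAt
      have h2 : ∀ f : Spacetime → ℝ, ContDiffOn ℝ 1 f U → ∀ μ, ContinuousOn (pd μ f) U :=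
        fun f hf μ => (pd_contDiffOn hU (n := 0) (by exact_mod_cast hf) μ).continuousOn
      exact h1.mul ((continuousOn_finsetSum _ fun μ _ => h2 _ (hj μ) μ).add
        (continuousOn_const.mul (continuousOn_finsetSum _ fun μ _ =>
          h2 _ (D.Y_smooth μ).contDiffOn μ)))
    have hbd : ∀ q ∈ U, |ψ q * (∑ μ, pd μ (j μ) q + κ * ∑ μ, pd μ (Y μ) q)| ≤ C + CY := by
      intro q hq
      rw [abs_mul, abs_of_nonneg (cutoff_nonneg δ ε q)]
      have h1 := hC q hq
      have h2 := hCY q hq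
      have h3 : |∑ μ, pd μ (j μ) q + κ * ∑ μ, pd μ (Y μ) q| ≤ C + CY := by
        refine (abs_add_le _ _).trans (add_le_add h1 ?_)
        rw [abs_mul, abs_of_pos hκ]
        exact (mul_le_mul hκ1 h2 (abs_nonneg _) zero_le_one).trans (one_mul _).le
      exact (mul_le_mul (cutoff_le_one δ ε q) h3 (abs_nonneg _) zero_le_one).trans (one_mul _).le
    have hz : ∀ q ∈ U, max ρ ρY < ‖sp q‖ →
        ψ q * (∑ μ, pd μ (j μ) q + κ * ∑ μ, pd μ (Y μ) q) = 0 := by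
      intro q hq h
      have hO : IsOpen (U ∩ {q | max ρ ρY < ‖sp q‖}) :=
        hU.inter (isOpen_lt continuous_const continuous_sp.norm)
      rw [← hdivJ q hq]
      have : ∀ μ, pd μ (J μ) q = 0 := fun μ => by
        rw [pd_congr hO (g := fun _ => 0) (fun y hy => ?_) μ ⟨hq, h⟩]
        · exact pd_const 0 μ q
        · have hy2 : max ρ ρY < ‖sp y‖ := hy.2
          simp [hJ, hρ μ y hy.1 ((le_max_left _ _).trans_lt hy2),
            hρY y hy.1 ((le_max_right _ _).trans hy2.le) μ]
      simp [this]
    obtain ⟨m1, m2, m3⟩ := integrable_prod_region D hcont hbd hz s t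
    exact m3.mono' m1 (Filter.Eventually.of_forall m2)
  · have hae : ∀ᵐ p ∂(volume.restrict (Ioc s t)).prod (volume : Measure Space), p.1 ∈ Ioc s t := by
      have : ∀ᵐ p ∂(volume.prod (volume : Measure Space)).restrict (Ioc s t ×ˢ univ),
          p ∈ Ioc s t ×ˢ (univ : Set Space) :=
        ae_restrict_mem (measurableSet_Ioc.prod MeasurableSet.univ)
      rw [← Measure.prod_restrict, Measure.restrict_univ] at this
      exact this.mono fun p hp => hp.1
    filter_upwards [hae] with p hp
    have hps : pt p.1 p.2 ∈ strip t₀ t₁ := ⟨hs.trans hp.1, hp.2.trans_lt ht⟩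
    by_cases hq : pt p.1 p.2 ∈ U
    · set q := pt p.1 p.2 with hqdef
      rw [indicator_of_mem hq, ← hdivJ q hq]
      have hψd := (hψc q hq).differentiableAt one_ne_zero
      have e : ∀ μ, pd μ (k μ) q = pd μ ψ q * J μ q + ψ q * pd μ (J μ) q := fun μ => by
        rw [pd, (hkU μ q hq).fderiv_eq]
        exact pd_mul hψd ((hJd μ q hq).1.add ((hJd μ q hq).2.const_mul κ)) μ
      simp only [e, Finset.sum_add_distrib, ← Finset.mul_sum]
      have hneg : ∑ μ, pd μ ψ q * J μ q ≤ 0 := by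
        refine cutoff_flux_nonpos (D.contDiffAt (hUt q hq) (hU3 q hq)) hδ hε0 _ ?_ ?_
        · simp only [hJ, D.Y_three, mul_zero, add_zero]; exact hj3 q hq
        · intro hq3 hqφ
          -- The compactness argument covers only `1 / 2 ≤ q 3` and `‖sp q‖ ≤ ρ`. Elsewhere `j` is
          -- zero and the sign of the flux of `Y` is available throughout the region.
          by_cases hz : q 3 < 1 / 2 ∨ ρ < ‖sp q‖
          · have : ∀ μ, j μ q = 0 := fun μ => hz.elim (hlow μ q hq) (hρ μ q hq)
            have h2 : ∑ μ, pd μ φ q * J μ q = κ * ∑ μ, pd μ φ q * Y μ q := by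
              rw [Finset.mul_sum]
              exact Finset.sum_congr rfl fun μ _ => by simp only [hJ, this]; ring
            rw [h2]
            exact mul_nonpos_of_nonneg_of_nonpos hκ.le (D.Y_flux q hq)
          · push Not at hz
            have h := hflux q (subset_closure hq) ⟨hp.1.le, hp.2⟩ hz.1 hq3 hz.2
              (D.mem_region_iff.1 hq).2.2.le (hqφ.trans (by
                have := min_le_left ε' δ; linarith))
            refine le_of_eq_of_le (Finset.sum_congr rfl fun μ _ => ?_) h
            rw [hjeq μ hq]
      linarith
    · rw [indicator_of_notMem hq]
      refine le_of_eq (Finset.sum_eq_zero fun μ _ => ?_)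
      rw [pd, (hk0 μ _ hps hq).fderiv_eq]
      simp

theorem tendsto_cutoff (D : SliceDomain t₀ t₁ b O φ Y) {δ ε : ℕ → ℝ} (hδ : ∀ n, 0 < δ n)
    (hε : ∀ n, 0 < ε n) (hεδ : ∀ n, ε n ≤ δ n)
    (hlim : Filter.Tendsto δ Filter.atTop (nhds 0)) {q : Spacetime}
    (hq : q ∈ region (Ioo t₀ t₁) O) :
    ∀ᶠ n in Filter.atTop, cutoff b φ (δ n) (ε n) q = 1 := by
  obtain ⟨-, h3, hφ⟩ := D.mem_region_iff.1 hq
  have h3' : 0 < (b - q 3) / 2 := by linarith [h3.2]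
  filter_upwards [hlim.eventually (gt_mem_nhds h3'),
    hlim.eventually (gt_mem_nhds (by linarith : 0 < φ q / 2))] with n h1 h2
  rw [cutoff, Real.smoothTransition.one_of_one_le, Real.smoothTransition.one_of_one_le, one_mul]
  · rw [le_sub_iff_add_le, le_div_iff₀ (hε n)]
    have := hεδ n
    linarith
  · rw [le_sub_iff_add_le, le_div_iff₀ (hδ n)]
    linarith

/-- The divergence inequality: a current with outward flux through the boundary. -/
theorem SliceDomain.divergence_le (D : SliceDomain t₀ t₁ b O φ Y)
    {j je : Fin 4 → Spacetime → ℝ} (hj : ∀ μ, ContDiffOn ℝ 1 (j μ) (region (Ioo t₀ t₁) O))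
    (hje : ∀ μ, ContinuousOn (je μ) (closure (region (Ioo t₀ t₁) O)))
    (hjeq : ∀ μ, EqOn (je μ) (j μ) (region (Ioo t₀ t₁) O)) {ρ : ℝ}
    (hρ : ∀ μ, ∀ q ∈ region (Ioo t₀ t₁) O, ρ < ‖sp q‖ → j μ q = 0)
    (hlow : ∀ μ, ∀ q ∈ region (Ioo t₀ t₁) O, q 3 < 1 / 2 → j μ q = 0)
    (hj3 : ∀ q ∈ region (Ioo t₀ t₁) O, 0 ≤ j 3 q)
    (hlat : ∀ q ∈ closure (region (Ioo t₀ t₁) O), q 0 ∈ Ioo t₀ t₁ → q 3 ∈ Ioo 0 b → φ q = 0 →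
      ∑ μ, pd μ φ q * je μ q ≤ 0) {C : ℝ}
    (hC : ∀ q ∈ region (Ioo t₀ t₁) O, |∑ μ, pd μ (fun q => j μ q) q| ≤ C)
    {s t : ℝ} (hs : t₀ < s) (hst : s ≤ t) (ht : t < t₁) {β : ℝ → ℝ}
    (hβi : IntervalIntegrable β volume s t)
    (hβ : ∀ τ ∈ Ioc s t, ∫ x in O τ, ∑ μ, pd μ (j μ) (pt τ x) ≤ β τ) :
    ∫ x in O t, j 0 (pt t x) ≤ (∫ x in O s, j 0 (pt s x)) + ∫ τ in s..t, β τ := by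
  set U := region (Ioo t₀ t₁) O with hUdef
  have hU : IsOpen U := D.isOpen_region
  have hpdz : ∀ (f : Spacetime → ℝ) (ρ : ℝ), (∀ q ∈ U, ρ < ‖sp q‖ → f q = 0) →
      ∀ q ∈ U, ρ < ‖sp q‖ → ∀ μ, pd μ f q = 0 := fun f ρ hf q hq h μ => by
    have hO : IsOpen (U ∩ {q | ρ < ‖sp q‖}) :=
      hU.inter (isOpen_lt continuous_const continuous_sp.norm)
    rw [pd_congr hO (g := fun _ => 0) (fun y hy => hf y hy.1 hy.2) μ ⟨hq, h⟩]
    exact pd_const 0 μ q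
  have hpdc : ∀ f : Spacetime → ℝ, ContDiffOn ℝ 1 f U → ∀ μ, ContinuousOn (pd μ f) U :=
    fun f hf μ => (pd_contDiffOn hU (n := 0) (by exact_mod_cast hf) μ).continuousOn
  obtain ⟨ρY, hρY⟩ := D.Y_support
  obtain ⟨CY, -, hCY⟩ : ∃ C, 0 ≤ C ∧ ∀ q ∈ U, |∑ μ, pd μ (fun q => Y μ q) q| ≤ C := by
    refine exists_bound_of_ext (f := fun q => ∑ μ, pd μ (Y μ) q) (ρ := ρY)
      ⟨_, continuousOn_finsetSum _ fun μ _ => ?_, fun _ _ => rfl⟩ fun q hq h => ?_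
    · exact ((pd_contDiffOn isOpen_univ (n := 0)
        (by exact_mod_cast (D.Y_smooth μ).contDiffOn) μ).continuousOn).mono (subset_univ _)
    · exact Finset.sum_eq_zero fun μ _ =>
        hpdz (Y μ) ρY (fun q hq h => hρY q hq h.le μ) q hq h μ
  set δ : ℕ → ℝ := fun n => 1 / (n + 1 : ℝ) with hδdef
  have hδ : ∀ n, 0 < δ n := fun n => by positivity
  have hδ1 : ∀ n, δ n ≤ 1 := fun n => by
    rw [hδdef]; simp only; rw [div_le_one (by positivity)]; linarith [n.cast_nonneg (α := ℝ)]
  have hδ0 : Filter.Tendsto δ Filter.atTop (nhds 0) := tendsto_one_div_add_atTop_nhds_zero_nat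
  -- The same null sequence serves as the strength `κ` of the added field and as the width `δ`.
  -- Since `ε n ≤ δ n`, all cutoffs tend to one pointwise on the region, and dominated convergence
  -- removes both regularisations.
  choose ε hε hεδ hineq using fun n => D.cutoff_divergence_le hj hje hjeq hρ hlow hj3 hlat hC hCY
    hρY hs hst ht (hδ n) (hδ n) (hδ1 n)
  have hcut : ∀ q ∈ U, ∀ᶠ n in Filter.atTop, cutoff b φ (δ n) (ε n) q = 1 := fun q hq =>
    tendsto_cutoff D hδ hε hεδ hδ0 hq
  have hψc : ∀ n, ContinuousOn (cutoff b φ (δ n) (ε n)) U := fun n q hq =>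
    (contDiffAt_cutoff (D.contDiffAt hq.1.2 (D.mem_region_iff.1 hq).2.1.1) _
      _).continuousAt.continuousWithinAt
  obtain ⟨C0, -, hC0⟩ : ∃ C, 0 ≤ C ∧ ∀ q ∈ U, |j 0 q| ≤ C :=
    exists_bound_of_ext ⟨je 0, hje 0, hjeq 0⟩ (hρ 0)
  have hsl : ∀ τ ∈ Ioo t₀ t₁, Filter.Tendsto
      (fun n => ∫ x in O τ, cutoff b φ (δ n) (ε n) (pt τ x) * j 0 (pt τ x)) Filter.atTop
      (nhds (∫ x in O τ, j 0 (pt τ x))) := by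
    intro τ hτ
    have hm := (D.isOpen_slice hτ).measurableSet
    have hmem : ∀ x ∈ O τ, pt τ x ∈ U := fun x hx => ⟨hτ, hx⟩
    refine tendsto_integral_of_dominated_convergence (fun x => |j 0 (pt τ x)|) (fun n => ?_) ?_
      (fun n => ?_) ?_
    · exact (((hψc n).mul (hj 0).continuousOn).comp (continuous_pt_right τ).continuousOn
        hmem).aestronglyMeasurable hm
    · exact (integrableOn_slice D (hj 0).continuousOn hC0 (hρ 0) hτ).abs
    · refine Filter.Eventually.of_forall fun x => ?_
      rw [norm_mul, Real.norm_of_nonneg (cutoff_nonneg _ _ _)]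
      exact mul_le_of_le_one_left (abs_nonneg _) (cutoff_le_one _ _ _)
    · refine (ae_restrict_iff' hm).2 (Filter.Eventually.of_forall fun x hx => ?_)
      refine tendsto_const_nhds.congr' ?_
      filter_upwards [hcut _ (hmem x hx)] with n hn
      rw [hn, one_mul]
  set m := (volume.restrict (Ioc s t)).prod (volume : Measure Space) with hm
  have hdc : ContinuousOn (fun q => ∑ μ, pd μ (j μ) q) U :=
    continuousOn_finsetSum _ fun μ _ => hpdc _ (hj μ) μ
  have hYc : ContinuousOn (fun q => ∑ μ, pd μ (Y μ) q) U :=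
    continuousOn_finsetSum _ fun μ _ => hpdc _ (D.Y_smooth μ).contDiffOn μ
  have hdz : ∀ q ∈ U, ρ < ‖sp q‖ → ∑ μ, pd μ (j μ) q = 0 := fun q hq h =>
    Finset.sum_eq_zero fun μ _ => hpdz (j μ) ρ (hρ μ) q hq h μ
  have hYz : ∀ q ∈ U, ρY < ‖sp q‖ → ∑ μ, pd μ (Y μ) q = 0 := fun q hq h =>
    Finset.sum_eq_zero fun μ _ => hpdz (Y μ) ρY (fun q hq h => hρY q hq h.le μ) q hq h μ
  have hG : ∀ n, ContinuousOn (fun q => cutoff b φ (δ n) (ε n) q *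
      (∑ μ, pd μ (j μ) q + δ n * ∑ μ, pd μ (Y μ) q)) U := fun n =>
    (hψc n).mul (hdc.add (continuousOn_const.mul hYc))
  have hGb : ∀ n, ∀ q ∈ U, |cutoff b φ (δ n) (ε n) q *
      (∑ μ, pd μ (j μ) q + δ n * ∑ μ, pd μ (Y μ) q)| ≤ C + CY := fun n q hq => by
    rw [abs_mul, abs_of_nonneg (cutoff_nonneg _ _ q)]
    have h3 : |∑ μ, pd μ (j μ) q + δ n * ∑ μ, pd μ (Y μ) q| ≤ C + CY := by
      refine (abs_add_le _ _).trans (add_le_add (hC q hq) ?_)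
      rw [abs_mul, abs_of_pos (hδ n)]
      exact (mul_le_mul (hδ1 n) (hCY q hq) (abs_nonneg _) zero_le_one).trans (one_mul _).le
    exact (mul_le_mul (cutoff_le_one _ _ q) h3 (abs_nonneg _) zero_le_one).trans (one_mul _).le
  have hGz : ∀ n, ∀ q ∈ U, max ρ ρY < ‖sp q‖ → cutoff b φ (δ n) (ε n) q *
      (∑ μ, pd μ (j μ) q + δ n * ∑ μ, pd μ (Y μ) q) = 0 := fun n q hq h => by
    rw [hdz q hq ((le_max_left _ _).trans_lt h), hYz q hq ((le_max_right _ _).trans_lt h)]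
    ring
  have hlimG : Filter.Tendsto (fun n => ∫ p, U.indicator (fun q => cutoff b φ (δ n) (ε n) q *
      (∑ μ, pd μ (j μ) q + δ n * ∑ μ, pd μ (Y μ) q)) (pt p.1 p.2) ∂m) Filter.atTop
      (nhds (∫ p, U.indicator (fun q => ∑ μ, pd μ (j μ) q) (pt p.1 p.2) ∂m)) := by
    refine tendsto_integral_of_dominated_convergence _
      (fun n => (integrable_prod_region D (hG n) (hGb n) (hGz n) s t).1)
      (integrable_prod_region D (hG 0) (hGb 0) (hGz 0) s t).2.2
      (fun n => Filter.Eventually.of_forall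
        (integrable_prod_region D (hG n) (hGb n) (hGz n) s t).2.1)
      (Filter.Eventually.of_forall fun p => ?_)
    by_cases hq : pt p.1 p.2 ∈ U
    · simp only [indicator_of_mem hq]
      have h1 : Filter.Tendsto (fun n => ∑ μ, pd μ (j μ) (pt p.1 p.2) +
          δ n * ∑ μ, pd μ (Y μ) (pt p.1 p.2)) Filter.atTop
          (nhds (∑ μ, pd μ (j μ) (pt p.1 p.2) + 0 * ∑ μ, pd μ (Y μ) (pt p.1 p.2))) :=
        tendsto_const_nhds.add (hδ0.mul_const _)
      rw [zero_mul, add_zero] at h1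
      refine h1.congr' ?_
      filter_upwards [hcut _ hq] with n hn
      rw [hn, one_mul]
    · simp only [indicator_of_notMem hq]
      exact tendsto_const_nhds
  have hlim := le_of_tendsto_of_tendsto' (hsl t ⟨hs.trans_le hst, ht⟩)
    ((hsl s ⟨hs, hst.trans_lt ht⟩).add hlimG) hineq
  refine hlim.trans (add_le_add le_rfl ?_)
  obtain ⟨m1, m2, m3⟩ := integrable_prod_region D hdc hC hdz s t
  have hint := m3.mono' m1 (Filter.Eventually.of_forall m2)
  rw [integral_prod _ hint, intervalIntegral.integral_of_le hst]
  refine setIntegral_mono_on hint.integral_prod_left hβi.1 measurableSet_Ioc fun τ hτ => ?_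
  have hτ' : τ ∈ Ioo t₀ t₁ := ⟨hs.trans hτ.1, hτ.2.trans_lt ht⟩
  refine le_trans (le_of_eq ?_) (hβ τ hτ)
  rw [← integral_indicator (D.isOpen_slice hτ').measurableSet]
  refine integral_congr_ae (Filter.Eventually.of_forall fun x => ?_)
  by_cases hx : x ∈ O τ
  · have : pt τ x ∈ U := ⟨hτ', hx⟩
    exact (indicator_of_mem this _).trans
      (indicator_of_mem hx fun x => ∑ μ, pd μ (j μ) (pt τ x)).symm
  · have : pt τ x ∉ U := fun h => hx h.2
    exact (indicator_of_notMem this _).trans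
      (indicator_of_notMem hx fun x => ∑ μ, pd μ (j μ) (pt τ x)).symm

end
section

variable {t₀ t₁ b : ℝ} {O : ℝ → Set Space} {φ : Spacetime → ℝ} {Y : Fin 4 → Spacetime → ℝ}

/-! ### Product estimates -/

theorem wsq_wd {κ : Type} [Fintype κ] (A L : List (Fin 4)) (f : Spacetime → κ → ℝ)
    (q : Spacetime) : wsq L (fun q i => wd A (fun q => f q i) q) q = wsq (L ++ A) f q := by
  simp only [wsq, wd_append]

theorem lintegral_wsq_le_energy (D : SliceDomain t₀ t₁ b O φ Y) {κ : Type} [Fintype κ]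
    {f : Spacetime → κ → ℝ} {R : ℕ}
    (hf : ∀ i, ContDiffOn ℝ R (fun q => f q i) (region (Ioo t₀ t₁) O)) {τ : ℝ}
    (hτ : τ ∈ Ioo t₀ t₁) {L : List (Fin 4)} (hL : L.length ≤ R) :
    ∫⁻ x in O τ, ENNReal.ofReal (wsq L f (pt τ x)) ≤
      energy (region (Ioo t₀ t₁) O) (O τ) R f τ := by
  refine le_trans (le_of_eq ?_) (Finset.single_le_sum (f := fun α => ∫⁻ x in O τ,
    ENNReal.ofReal (derivNormSq (region (Ioo t₀ t₁) O) f α (pt τ x))) (fun _ _ => zero_le)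
    (windex_mem hL))
  refine setLIntegral_congr_fun (D.isOpen_slice hτ).measurableSet fun x hx => ?_
  rw [derivNormSq_windex D.isOpen_region hf hL ⟨hτ, hx⟩]

theorem sqrt_wsq_le_supNorm (D : SliceDomain t₀ t₁ b O φ Y) {κ : Type} [Fintype κ]
    {f : Spacetime → κ → ℝ} {k : ℕ}
    (hf : ∀ i, ContDiffOn ℝ k (fun q => f q i) (region (Ioo t₀ t₁) O)) {τ : ℝ}
    (hτ : τ ∈ Ioo t₀ t₁) {L : List (Fin 4)} (hL : L.length ≤ k) {x : Space} (hx : x ∈ O τ) :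
    ENNReal.ofReal √(wsq L f (pt τ x)) ≤ supNorm (region (Ioo t₀ t₁) O) (O τ) k f τ := by
  rw [← derivNormSq_windex D.isOpen_region hf hL ⟨hτ, hx⟩]
  exact le_iSup₂_of_le (windex L) (windex_mem hL) (le_iSup₂_of_le x hx le_rfl)

theorem wsq_le_energy (D : SliceDomain t₀ t₁ b O φ Y) {κ : Type} [Fintype κ]
    {f : Spacetime → κ → ℝ} {R : ℕ}
    (hf : ∀ i, ContDiffOn ℝ R (fun q => f q i) (region (Ioo t₀ t₁) O)) {τ : ℝ}
    (hτ : τ ∈ Ioo t₀ t₁) {A : List (Fin 4)} (hA : A.length + 2 ≤ R) {x : Space} (hx : x ∈ O τ) :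
    ENNReal.ofReal (wsq A f (pt τ x)) ≤
      ENNReal.ofReal 16000000 * energy (region (Ioo t₀ t₁) O) (O τ) R f τ := by
  obtain ⟨B, hBX, hB, hvol, hd⟩ := D.exists_box τ hτ.2.le x hx
  have h := sobolev_slice D.isOpen_region (f := fun q i => wd A (fun q => f q i) q)
    (fun i => by
      have := wd_contDiffOn D.isOpen_region A (n := 2) ((hf i).of_le (by
        norm_cast; omega))
      exact_mod_cast this) τ (D.isOpen_slice hτ) (D.convex τ hτ.2.le) (fun y hy => ⟨hτ, hy⟩) hx hB
    hBX hvol hd (T := energy (region (Ioo t₀ t₁) O) (O τ) R f τ) fun L hL => by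
      simp only [wsq_wd]
      exact lintegral_wsq_le_energy D hf hτ (by simp; omega)
  rwa [wsq_wd] at h

/-- Smallness of a coefficient at a fixed time, by its energy or by its supremum norm. -/
def CoeffBound (U : Set Spacetime) (X : Set Space) (R k : ℕ) {κ : Type} [Fintype κ]
    (f : Spacetime → κ → ℝ) (τ c : ℝ) : Prop :=
  (4 ≤ R ∧ energy U X R f τ ≤ ENNReal.ofReal (c ^ 2)) ∨ supNorm U X k f τ ≤ ENNReal.ofReal c

theorem wsq_le_of_supNorm (D : SliceDomain t₀ t₁ b O φ Y) {κ : Type} [Fintype κ]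
    {f : Spacetime → κ → ℝ} {k : ℕ}
    (hf : ∀ i, ContDiffOn ℝ k (fun q => f q i) (region (Ioo t₀ t₁) O)) {τ c : ℝ}
    (hτ : τ ∈ Ioo t₀ t₁) (hc : 0 ≤ c)
    (h : supNorm (region (Ioo t₀ t₁) O) (O τ) k f τ ≤ ENNReal.ofReal c)
    {L : List (Fin 4)} (hL : L.length ≤ k) {x : Space} (hx : x ∈ O τ) :
    wsq L f (pt τ x) ≤ c ^ 2 := by
  have h1 := (sqrt_wsq_le_supNorm D hf hτ hL hx).trans h
  rw [ENNReal.ofReal_le_ofReal_iff hc] at h1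
  exact (Real.sqrt_le_left hc).1 h1

/-- With an energy bound this is the Sobolev inequality, which costs two derivatives; with a
supremum bound it is immediate. The condition `hL'` is conditional on `4 ≤ R` because only the
energy alternative needs it, and that alternative comes with `4 ≤ R`. -/
theorem CoeffBound.wsq_le (D : SliceDomain t₀ t₁ b O φ Y) {κ : Type} [Fintype κ]
    {f : Spacetime → κ → ℝ} {R k : ℕ} (hRk : R ≤ k)
    (hf : ∀ i, ContDiffOn ℝ k (fun q => f q i) (region (Ioo t₀ t₁) O)) {τ c : ℝ}
    (hτ : τ ∈ Ioo t₀ t₁) (hc : 0 ≤ c) (h : CoeffBound (region (Ioo t₀ t₁) O) (O τ) R k f τ c)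
    {L : List (Fin 4)} (hL : L.length ≤ k) (hL' : 4 ≤ R → L.length + 2 ≤ R) {x : Space}
    (hx : x ∈ O τ) : wsq L f (pt τ x) ≤ 16000000 * c ^ 2 := by
  rcases h with ⟨h4, h⟩ | h
  · have h1 := wsq_le_energy D (fun i => (hf i).of_le (by exact_mod_cast hRk)) hτ (hL' h4) hx
    have h2 := h1.trans (mul_le_mul_right h _)
    rw [← ENNReal.ofReal_mul (by norm_num), ENNReal.ofReal_le_ofReal_iff (by positivity)] at h2
    exact h2
  · have := wsq_le_of_supNorm D hf hτ hc h hL hx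
    nlinarith [sq_nonneg c]

theorem sum_sq_mulVec_le {ι κ : Type} [Fintype ι] [Fintype κ] (F : ι × κ → ℝ) (g : κ → ℝ) :
    ∑ i, (∑ j, F (i, j) * g j) ^ 2 ≤ (∑ p, F p ^ 2) * ∑ j, g j ^ 2 := by
  rw [Fintype.sum_prod_type, Finset.sum_mul]
  exact Finset.sum_le_sum fun i _ => Finset.sum_mul_sq_le_sq_mul_sq _ _ _

/-- One factor is bounded pointwise and the other in `L²`. The coefficient is taken pointwise unless
it is controlled only in energy and carries more than `R - 2` derivatives; then the field carries at
most two, and the roles are exchanged. The total `R + 1` is what arises when `M^μ ∂_μ` is commuted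
with `R` derivatives. -/
theorem product_estimate (D : SliceDomain t₀ t₁ b O φ Y) {ι κ : Type} [Fintype ι] [Fintype κ]
    {f : Spacetime → ι × κ → ℝ} {g : Spacetime → κ → ℝ} {R k : ℕ} (hRk : R ≤ k)
    (hf : ∀ i, ContDiffOn ℝ k (fun q => f q i) (region (Ioo t₀ t₁) O))
    (hg : ∀ i, ContDiffOn ℝ R (fun q => g q i) (region (Ioo t₀ t₁) O)) {τ c : ℝ}
    (hτ : τ ∈ Ioo t₀ t₁) (hc : 0 ≤ c) (h : CoeffBound (region (Ioo t₀ t₁) O) (O τ) R k f τ c)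
    {A B : List (Fin 4)} (hA : A.length ≤ R) (hB : B.length ≤ R)
    (hAB : A.length + B.length ≤ R + 1) :
    ∫⁻ x in O τ, ENNReal.ofReal (∑ i, (∑ j, wd A (fun q => f q (i, j)) (pt τ x) *
      wd B (fun q => g q j) (pt τ x)) ^ 2) ≤
      ENNReal.ofReal (16000000 * c ^ 2) * energy (region (Ioo t₀ t₁) O) (O τ) R g τ := by
  have hm := (D.isOpen_slice hτ).measurableSet
  have hpt : ∀ x, ∑ i, (∑ j, wd A (fun q => f q (i, j)) (pt τ x) *
      wd B (fun q => g q j) (pt τ x)) ^ 2 ≤ wsq A f (pt τ x) * wsq B g (pt τ x) := fun x =>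
    sum_sq_mulVec_le (fun p => wd A (fun q => f q p) (pt τ x)) _
  have h1 : ∀ x, ENNReal.ofReal (∑ i, (∑ j, wd A (fun q => f q (i, j)) (pt τ x) *
      wd B (fun q => g q j) (pt τ x)) ^ 2) ≤
      ENNReal.ofReal (wsq A f (pt τ x)) * ENNReal.ofReal (wsq B g (pt τ x)) := fun x => by
    rw [← ENNReal.ofReal_mul (wsq_nonneg _ _ _)]
    exact ENNReal.ofReal_le_ofReal (hpt x)
  by_cases hcase : 4 ≤ R → A.length + 2 ≤ R
  · calc _ ≤ ∫⁻ x in O τ, ENNReal.ofReal (16000000 * c ^ 2) *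
          ENNReal.ofReal (wsq B g (pt τ x)) := by
          refine setLIntegral_mono' hm fun x hx => (h1 x).trans ?_
          gcongr
          exact h.wsq_le D hRk hf hτ hc (hA.trans hRk) hcase hx
      _ = _ := lintegral_const_mul' _ _ ENNReal.ofReal_ne_top
      _ ≤ _ := by
          gcongr
          exact lintegral_wsq_le_energy D hg hτ hB
  · push Not at hcase
    obtain ⟨h4, hA2⟩ := hcase
    rcases h with ⟨-, h⟩ | h
    · have hB2 : B.length + 2 ≤ R := by omega
      by_cases htop : energy (region (Ioo t₀ t₁) O) (O τ) R g τ = ∞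
      -- For infinite field energy the right-hand side is `0 * ∞ = 0` when `c = 0`; then the
      -- derivative of the coefficient vanishes almost everywhere and so does the left-hand side.
      · rcases hc.eq_or_lt with rfl | hc
        · rw [htop]
          have h0 : ∫⁻ x in O τ, ENNReal.ofReal (wsq A f (pt τ x)) = 0 :=
            le_antisymm ((lintegral_wsq_le_energy D
              (fun i => (hf i).of_le (by exact_mod_cast hRk)) hτ hA).trans (h.trans (by simp)))
              zero_le
          have hmeas : AEMeasurable (fun x => ENNReal.ofReal (wsq A f (pt τ x)))
              (volume.restrict (O τ)) :=
            (((continuousOn_wsq D.isOpen_region A fun i => (hf i).of_le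
              (by exact_mod_cast hA.trans hRk)).comp (continuous_pt_right τ).continuousOn
              fun y hy => ⟨hτ, hy⟩).aemeasurable hm).ennreal_ofReal
          rw [lintegral_eq_zero_iff' hmeas] at h0
          refine le_trans (le_of_eq ?_) zero_le
          refine (lintegral_congr_ae ?_).trans lintegral_zero
          filter_upwards [h0] with x hx
          refine le_antisymm ((h1 x).trans ?_) zero_le
          have hx' : ENNReal.ofReal (wsq A f (pt τ x)) = 0 := hx
          rw [hx', zero_mul]
        · rw [htop, ENNReal.mul_top (by simpa using by positivity)]
          exact le_top
      calc _ ≤ ∫⁻ x in O τ, ENNReal.ofReal (wsq A f (pt τ x)) *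
            (ENNReal.ofReal 16000000 * energy (region (Ioo t₀ t₁) O) (O τ) R g τ) := by
            refine setLIntegral_mono' hm fun x hx => (h1 x).trans ?_
            gcongr
            exact wsq_le_energy D hg hτ hB2 hx
        _ = (∫⁻ x in O τ, ENNReal.ofReal (wsq A f (pt τ x))) *
            (ENNReal.ofReal 16000000 * energy (region (Ioo t₀ t₁) O) (O τ) R g τ) :=
            lintegral_mul_const' _ _ (ENNReal.mul_ne_top ENNReal.ofReal_ne_top htop)
        _ ≤ ENNReal.ofReal (c ^ 2) *
            (ENNReal.ofReal 16000000 * energy (region (Ioo t₀ t₁) O) (O τ) R g τ) := by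
            gcongr
            exact (lintegral_wsq_le_energy D
              (fun i => (hf i).of_le (by exact_mod_cast hRk)) hτ hA).trans h
        _ = _ := by
            rw [← mul_assoc, ← ENNReal.ofReal_mul (by positivity), mul_comm (c ^ 2)]
    · calc _ ≤ ∫⁻ x in O τ, ENNReal.ofReal (16000000 * c ^ 2) *
            ENNReal.ofReal (wsq B g (pt τ x)) := by
            refine setLIntegral_mono' hm fun x hx => (h1 x).trans ?_
            gcongr
            have := wsq_le_of_supNorm D hf hτ hc h (hA.trans hRk) hx
            nlinarith [sq_nonneg c]
        _ = _ := lintegral_const_mul' _ _ ENNReal.ofReal_ne_top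
        _ ≤ _ := by
            gcongr
            exact lintegral_wsq_le_energy D hg hτ hB

/-! ### Square integral bounds -/

/-- A continuous vector valued function on `U` whose square integral over the slice `X` at time `τ`
is at most `C`. -/
def SqBd (U : Set Spacetime) (X : Set Space) (τ : ℝ) {ι : Type} [Fintype ι]
    (T : Spacetime → ι → ℝ) (C : ℝ≥0∞) : Prop :=
  (∀ i, ContinuousOn (fun q => T q i) U) ∧
    ∫⁻ x in X, ENNReal.ofReal (∑ i, T (pt τ x) i ^ 2) ≤ C

variable {U : Set Spacetime} {X : Set Space} {τ : ℝ} {ι : Type} [Fintype ι]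

theorem SqBd.mono {T : Spacetime → ι → ℝ} {C C' : ℝ≥0∞} (h : SqBd U X τ T C) (hC : C ≤ C') :
    SqBd U X τ T C' := ⟨h.1, h.2.trans hC⟩

theorem SqBd.zero : SqBd U X τ (fun _ (_ : ι) => 0) 0 := ⟨fun _ => continuousOn_const, by simp⟩

theorem SqBd.neg {T : Spacetime → ι → ℝ} {C : ℝ≥0∞} (h : SqBd U X τ T C) :
    SqBd U X τ (fun q i => -T q i) C := ⟨fun i => (h.1 i).neg, by simpa using h.2⟩

theorem SqBd.add (hX : MeasurableSet X) (hXU : ∀ x ∈ X, pt τ x ∈ U) {T T' : Spacetime → ι → ℝ}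
    {C C' : ℝ≥0∞} (h : SqBd U X τ T C) (h' : SqBd U X τ T' C') :
    SqBd U X τ (fun q i => T q i + T' q i) (2 * (C + C')) := by
  refine ⟨fun i => (h.1 i).add (h'.1 i), ?_⟩
  have hm : AEMeasurable (fun x => ENNReal.ofReal (∑ i, T (pt τ x) i ^ 2)) (volume.restrict X) :=
    (((continuousOn_finsetSum _ fun i _ => (h.1 i).pow 2).comp (continuous_pt_right τ).continuousOn
      hXU).aemeasurable hX).ennreal_ofReal
  calc _ ≤ ∫⁻ x in X, 2 * (ENNReal.ofReal (∑ i, T (pt τ x) i ^ 2) +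
        ENNReal.ofReal (∑ i, T' (pt τ x) i ^ 2)) := by
        refine lintegral_mono fun x => ?_
        have e2 : (2 : ℝ≥0∞) = ENNReal.ofReal 2 := by simp
        rw [e2, ← ENNReal.ofReal_add (Finset.sum_nonneg fun _ _ => sq_nonneg _)
          (Finset.sum_nonneg fun _ _ => sq_nonneg _), ← ENNReal.ofReal_mul (by norm_num)]
        refine ENNReal.ofReal_le_ofReal ?_
        rw [← Finset.sum_add_distrib, Finset.mul_sum]
        exact Finset.sum_le_sum fun i _ => add_sq_le
    _ = 2 * ((∫⁻ x in X, ENNReal.ofReal (∑ i, T (pt τ x) i ^ 2)) +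
        ∫⁻ x in X, ENNReal.ofReal (∑ i, T' (pt τ x) i ^ 2)) := by
        rw [lintegral_const_mul' _ _ (by simp), lintegral_add_left' hm]
    _ ≤ _ := by
        gcongr
        · exact h.2
        · exact h'.2

/-- Induction step for sums: applying `(a + b)² ≤ 2 (a² + b²)` term by term costs at most a factor
`4` per term. The number of terms depends only on `R`, so this crude constant suffices. -/
theorem two_mul_add_le (n : ℕ) (C : ℝ≥0∞) : 2 * (C + 4 ^ n * C) ≤ 4 ^ (n + 1) * C := by
  calc 2 * (C + 4 ^ n * C) ≤ 2 * (4 ^ n * C + 4 ^ n * C) := by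
        gcongr
        exact le_mul_of_one_le_left zero_le (one_le_pow₀ (by norm_num))
    _ = 4 ^ (n + 1) * C := by rw [pow_succ, ← two_mul, ← mul_assoc, mul_assoc, mul_left_comm,
                                ← mul_assoc, mul_comm]; ring

theorem SqBd.list_sum (hX : MeasurableSet X) (hXU : ∀ x ∈ X, pt τ x ∈ U) {β : Type*} (l : List β)
    {T : β → Spacetime → ι → ℝ} {C : ℝ≥0∞} (h : ∀ y ∈ l, SqBd U X τ (T y) C) :
    SqBd U X τ (fun q i => (l.map fun y => T y q i).sum) (4 ^ l.length * C) := by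
  induction l with
  | nil => simpa using SqBd.zero.mono zero_le
  | cons y l ih =>
    simp only [List.map_cons, List.sum_cons, List.length_cons]
    exact ((h y List.mem_cons_self).add hX hXU
      (ih fun z hz => h z (List.mem_cons_of_mem y hz))).mono (two_mul_add_le _ _)

theorem SqBd.finset_sum (hX : MeasurableSet X) (hXU : ∀ x ∈ X, pt τ x ∈ U) {β : Type*}
    (s : Finset β) {T : β → Spacetime → ι → ℝ} {C : ℝ≥0∞} (h : ∀ y ∈ s, SqBd U X τ (T y) C) :
    SqBd U X τ (fun q i => ∑ y ∈ s, T y q i) (4 ^ s.card * C) := by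
  classical
  induction s using Finset.induction_on with
  | empty => simpa using SqBd.zero.mono zero_le
  | insert y s hy ih =>
    simp only [Finset.sum_insert hy, Finset.card_insert_of_notMem hy]
    exact ((h y (Finset.mem_insert_self y s)).add hX hXU
      (ih fun z hz => h z (Finset.mem_insert_of_mem hz))).mono (two_mul_add_le _ _)

end
section

variable {P : Fin 3 → ℕ} {t₀ t₁ b : ℝ} {O : ℝ → Set Space} {φ : Spacetime → ℝ}
  {Y : Fin 4 → Spacetime → ℝ} {S : SystemData P} {R : ℕ}

/-! ### The commuted system -/

theorem matNorm_sq {ι κ : Type} [Fintype ι] [Fintype κ] (A : Matrix ι κ ℝ) :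
    matNorm A ^ 2 = ∑ p : ι × κ, A p.1 p.2 ^ 2 := by
  have : (Aᵀ * A).trace = ∑ p : ι × κ, A p.1 p.2 ^ 2 := by
    simp only [Matrix.trace, Matrix.diag, Matrix.mul_apply, Matrix.transpose_apply]
    rw [Fintype.sum_prod_type, Finset.sum_comm]
    simp only [sq]
  rw [matNorm, this, Real.sq_sqrt (Finset.sum_nonneg fun _ _ => sq_nonneg _)]

theorem SystemData.Hₐ_zero (t : ℝ) (i : Fin (P 0)) (a : Idx P) : S.Hₐ t ⟨0, i⟩ a = 0 := by
  obtain ⟨n, j⟩ := a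
  fin_cases n <;> rfl

theorem SystemData.Hₐ_one_zero (t : ℝ) (i : Fin (P 1)) (j : Fin (P 0)) :
    S.Hₐ t ⟨1, i⟩ ⟨0, j⟩ = S.H₁ i j := rfl

theorem SystemData.Hₐ_one_one (t : ℝ) (i : Fin (P 1)) (j : Fin (P 1)) :
    S.Hₐ t ⟨1, i⟩ ⟨1, j⟩ = 0 := rfl

theorem SystemData.Hₐ_one_two (t : ℝ) (i : Fin (P 1)) (j : Fin (P 2)) :
    S.Hₐ t ⟨1, i⟩ ⟨2, j⟩ = 0 := rfl

theorem SystemData.Hₐ_two_zero (t : ℝ) (i : Fin (P 2)) (j : Fin (P 0)) :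
    S.Hₐ t ⟨2, i⟩ ⟨0, j⟩ = 0 := rfl

theorem SystemData.Hₐ_two_one (t : ℝ) (i : Fin (P 2)) (j : Fin (P 1)) :
    S.Hₐ t ⟨2, i⟩ ⟨1, j⟩ = |t|⁻¹ * S.H₂ i j := rfl

theorem SystemData.Hₐ_two_two (t : ℝ) (i : Fin (P 2)) (j : Fin (P 2)) :
    S.Hₐ t ⟨2, i⟩ ⟨2, j⟩ = |t|⁻¹ * S.H₃ i j := rfl

theorem isOpen_negTime : IsOpen {q : Spacetime | q 0 < 0} :=
  isOpen_lt (continuous_apply 0) continuous_const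

theorem contDiffOn_inv_abs_time (n : ℕ) :
    ContDiffOn ℝ n (fun q : Spacetime => |q 0|⁻¹) {q : Spacetime | q 0 < 0} := by
  have h : ContDiffOn ℝ n (fun q : Spacetime => (-q 0)⁻¹) {q : Spacetime | q 0 < 0} :=
    (contDiff_apply ℝ ℝ (0 : Fin 4)).neg.contDiffOn.inv fun q hq => by
      have : q 0 < 0 := hq
      linarith
  refine h.congr fun q hq => ?_
  have : q 0 < 0 := hq
  rw [abs_of_neg this]

/-- Each time derivative of `|t|⁻¹` gains a power of `|t|⁻¹`, and every space derivative kills it.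
This gain is what makes the commutator with `|t|⁻¹ H₃` small. -/
theorem wd_inv_abs_time (A : List (Fin 4)) :
    ∃ c : ℝ, |c| ≤ A.length.factorial ∧
      EqOn (wd A fun q : Spacetime => |q 0|⁻¹) (fun q => c * ((-q 0)⁻¹) ^ (A.length + 1))
        {q : Spacetime | q 0 < 0} := by
  induction A with
  | nil => exact ⟨1, by simp, fun q hq => by
      have : q 0 < 0 := hq
      simp [abs_of_neg this]⟩
  | cons i A ih =>
    obtain ⟨c, hc, h⟩ := ih
    refine ⟨if i = 0 then c * (A.length + 1) else 0, ?_, fun q hq => ?_⟩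
    · split_ifs
      · rw [abs_mul, List.length_cons, Nat.factorial_succ, mul_comm]
        push_cast
        rw [abs_of_nonneg (by positivity : (0 : ℝ) ≤ A.length + 1)]
        gcongr
      · simp only [abs_zero]; positivity
    · have hq0 : q 0 < 0 := hq
      rw [wd_cons, pd_congr isOpen_negTime h i hq]
      have hne : -q 0 ≠ 0 := by linarith
      have hη : HasDerivAt (fun x : ℝ => c * ((-x)⁻¹) ^ (A.length + 1))
          (c * (A.length + 1) * ((-q 0)⁻¹) ^ (A.length + 2)) (q 0) := by
        have h1 := ((hasDerivAt_neg (q 0)).fun_inv hne).fun_pow (A.length + 1)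
        refine (h1.const_mul c).congr_deriv ?_
        push_cast
        rw [neg_neg, pow_add _ A.length 2, inv_pow _ 2, one_div]
        ring
      have h2 := pd_comp (g := fun q : Spacetime => q 0) hη.differentiableAt
        (by fun_prop : DifferentiableAt ℝ (fun q : Spacetime => q 0) q) i
      rw [h2, hη.deriv, pd_coord]
      split_ifs <;> simp

theorem SystemData.contDiffOn_Hₐ (S : SystemData P) (a a' : Idx P) (n : ℕ) :
    ContDiffOn ℝ n (fun q : Spacetime => S.Hₐ (q 0) a a') {q : Spacetime | q 0 < 0} := by
  obtain ⟨m, i⟩ := a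
  obtain ⟨m', j⟩ := a'
  have h := contDiffOn_inv_abs_time n
  fin_cases m
  · exact contDiffOn_const.congr fun q _ => S.Hₐ_zero (q 0) i ⟨m', j⟩
  · fin_cases m'
    · exact contDiffOn_const
    · exact contDiffOn_const
    · exact contDiffOn_const
  · fin_cases m'
    · exact contDiffOn_const
    · exact h.mul contDiffOn_const
    · exact h.mul contDiffOn_const

theorem SliceDomain.region_subset_negTime (D : SliceDomain t₀ t₁ b O φ Y) :
    region (Ioo t₀ t₁) O ⊆ {q : Spacetime | q 0 < 0} := fun q hq => by
  have h1 : q 0 < t₁ := hq.1.2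
  have h2 := D.le_neg_one
  exact (by linarith : q 0 < 0)

/-- The terms of the commuted system which are treated as errors. -/
def SystemData.remainder (S : SystemData P) (L : List (Fin 4)) (m : Fin 3) (q : Spacetime)
    (i : Fin (P m)) : ℝ :=
  wd L (fun q => S.Src q ⟨m, i⟩) q +
    (∑ n, ((splits L).map fun p => ∑ j, wd p.1 (fun q => S.δH m n q (i, j)) q *
        wd p.2 (fun q => vecBlock n S.Θ q j) q).sum +
      -∑ μ, ((splits' L).map fun p => ∑ a, wd p.1 (fun q => S.δM μ q (⟨m, i⟩, a)) q *
        wd (p.2 ++ [μ]) (fun q => S.Θ q a) q).sum)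

theorem SystemData.IsAdmissible.contDiffOn_δM (hS : S.IsAdmissible R t₀ t₁ O) (μ : Fin 4)
    (p : Idx P × Idx P) :
    ContDiffOn ℝ (R + 1 : ℕ) (fun q => S.δM μ q p) (region (Ioo t₀ t₁) O) :=
  (hS.M_regular μ p).1.sub contDiffOn_const

theorem SystemData.IsAdmissible.contDiffOn_δH (hS : S.IsAdmissible R t₀ t₁ O)
    (D : SliceDomain t₀ t₁ b O φ Y) (m n : Fin 3) (p : Fin (P m) × Fin (P n)) :
    ContDiffOn ℝ R (fun q => S.δH m n q p) (region (Ioo t₀ t₁) O) :=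
  (hS.H_regular (⟨m, p.1⟩, ⟨n, p.2⟩)).1.sub
    ((S.contDiffOn_Hₐ _ _ R).mono D.region_subset_negTime)

theorem list_sum_finset_sum_comm {β ι : Type*} (l : List β) (s : Finset ι) (F : β → ι → ℝ) :
    ∑ i ∈ s, (l.map fun p => F p i).sum = (l.map fun p => ∑ i ∈ s, F p i).sum := by
  induction l with
  | nil => simp
  | cons y l ih => simp [Finset.sum_add_distrib, ih]

/-- Leibniz rule applied to each component of the system after splitting `H` into `H_∞` and the
difference. The term with no derivative on `M^μ` stays on the left, the `H_∞` terms are kept apart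
because their structure matters, and all other terms form the remainder. -/
theorem SystemData.IsAdmissible.commuted (hS : S.IsAdmissible R t₀ t₁ O)
    (D : SliceDomain t₀ t₁ b O φ Y) {L : List (Fin 4)} (hL : L.length ≤ R) {q : Spacetime}
    (hq : q ∈ region (Ioo t₀ t₁) O) (m : Fin 3) (i : Fin (P m)) :
    ∑ μ, ∑ a, S.M μ q ⟨m, i⟩ a * pd μ (wd L fun q => S.Θ q a) q =
      ∑ a, wd L (fun q => S.Hₐ (q 0) ⟨m, i⟩ a * S.Θ q a) q + S.remainder L m q i := by
  set U := region (Ioo t₀ t₁) O with hUdef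
  have hU : IsOpen U := D.isOpen_region
  have hLR : ((L.length : ℕ) : WithTop ℕ∞) ≤ (R : ℕ) := by exact_mod_cast hL
  have hLR' : ((L.length : ℕ) : WithTop ℕ∞) ≤ (R + 1 : ℕ) := by norm_cast; omega
  have hLR2 : ((L.length + 1 : ℕ) : WithTop ℕ∞) ≤ (R + 1 : ℕ) := by norm_cast; omega
  have hΘ := fun a => (hS.Θ_regular a).1
  have hΘL := fun a => (hΘ a).of_le hLR'
  have hdΘL : ∀ μ a, ContDiffOn ℝ L.length (pd μ fun q => S.Θ q a) U := fun μ a =>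
    pd_contDiffOn hU ((hΘ a).of_le hLR2) μ
  have hML : ∀ μ a a', ContDiffOn ℝ L.length (fun q => S.M μ q a a') U := fun μ a a' =>
    ((hS.M_regular μ) (a, a')).1.of_le hLR'
  have hHaL : ∀ a a', ContDiffOn ℝ L.length (fun q => S.Hₐ (q 0) a a') U := fun a a' =>
    (S.contDiffOn_Hₐ a a' _).mono D.region_subset_negTime
  have hδHL : ∀ n j, ContDiffOn ℝ L.length (fun q => S.δH m n q (i, j)) U := fun n j =>
    (hS.contDiffOn_δH D m n (i, j)).of_le hLR
  have hSrcL : ContDiffOn ℝ L.length (fun q => S.Src q ⟨m, i⟩) U :=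
    (hS.Src_regular ⟨m, i⟩).1.of_le hLR
  have heq : EqOn (fun q => ∑ μ, ∑ a, S.M μ q ⟨m, i⟩ a * pd μ (fun q => S.Θ q a) q)
      (fun q => (∑ a, S.Hₐ (q 0) ⟨m, i⟩ a * S.Θ q a +
        ∑ n, ∑ j, S.δH m n q (i, j) * vecBlock n S.Θ q j) + S.Src q ⟨m, i⟩) U := by
    intro q hq
    have h := congrFun (hS.equation q hq) ⟨m, i⟩
    simp only [Finset.sum_apply, Pi.add_apply, Matrix.mulVec, dotProduct] at h
    simp only [h]
    congr 1
    have e : ∑ n, ∑ j, S.δH m n q (i, j) * vecBlock n S.Θ q j =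
        ∑ a, (S.H q ⟨m, i⟩ a - S.Hₐ (q 0) ⟨m, i⟩ a) * S.Θ q a := by
      rw [Fintype.sum_sigma]; rfl
    rw [e, ← Finset.sum_add_distrib]
    exact Finset.sum_congr rfl fun a _ => by ring
  have h1 := wd_congr hU heq L hq
  have hl : wd L (fun q => ∑ μ, ∑ a, S.M μ q ⟨m, i⟩ a * pd μ (fun q => S.Θ q a) q) q =
      ∑ μ, ∑ a, S.M μ q ⟨m, i⟩ a * pd μ (wd L fun q => S.Θ q a) q +
      ∑ μ, ((splits' L).map fun p => ∑ a, wd p.1 (fun q => S.δM μ q (⟨m, i⟩, a)) q *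
        wd (p.2 ++ [μ]) (fun q => S.Θ q a) q).sum := by
    rw [wd_sum hU L Finset.univ (f := fun μ q => ∑ a, S.M μ q ⟨m, i⟩ a *
      pd μ (fun q => S.Θ q a) q) (fun μ _ => ContDiffOn.sum fun a _ => (hML _ _ _).mul (hdΘL _ _))
      hq]
    simp only
    rw [← Finset.sum_add_distrib]
    refine Finset.sum_congr rfl fun μ _ => ?_
    rw [wd_sum hU L Finset.univ (f := fun a q => S.M μ q ⟨m, i⟩ a *
      pd μ (fun q => S.Θ q a) q) (fun a _ => (hML _ _ _).mul (hdΘL _ _)) hq,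
      ← list_sum_finset_sum_comm]
    simp only
    rw [← Finset.sum_add_distrib]
    refine Finset.sum_congr rfl fun a _ => ?_
    rw [wd_mul' hU L (hML μ ⟨m, i⟩ a) (hdΘL μ a) hq]
    simp only
    rw [wd_pd hU L μ ((hΘ a).of_le hLR2) hq]
    congr 2
    refine List.map_congr_left fun p hp => ?_
    obtain ⟨hp1, hp2⟩ := length_of_mem_splits' hp
    rw [wd_append]
    congr 1
    obtain ⟨ν, A, hA⟩ := List.exists_cons_of_ne_nil hp2
    rw [hA]
    -- The first word is nonempty, so subtracting the constant `Mₐ` does not change the derivative.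
    refine (wd_sub_const hU ν A (S.Mₐ μ ⟨m, i⟩ a) ((hML μ ⟨m, i⟩ a).of_le ?_) hq).symm
    rw [← hA]; norm_cast; omega
  have hr : wd L (fun q => (∑ a, S.Hₐ (q 0) ⟨m, i⟩ a * S.Θ q a +
        ∑ n, ∑ j, S.δH m n q (i, j) * vecBlock n S.Θ q j) + S.Src q ⟨m, i⟩) q =
      (∑ a, wd L (fun q => S.Hₐ (q 0) ⟨m, i⟩ a * S.Θ q a) q +
        ∑ n, ((splits L).map fun p => ∑ j, wd p.1 (fun q => S.δH m n q (i, j)) q *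
        wd p.2 (fun q => vecBlock n S.Θ q j) q).sum) + wd L (fun q => S.Src q ⟨m, i⟩) q := by
    have c1 : ∀ a, ContDiffOn ℝ L.length (fun q => S.Hₐ (q 0) ⟨m, i⟩ a * S.Θ q a) U := fun a =>
      (hHaL _ _).mul (hΘL a)
    have c2 : ∀ n j, ContDiffOn ℝ L.length
        (fun q => S.δH m n q (i, j) * vecBlock n S.Θ q j) U := fun n j =>
      (hδHL n j).mul (hΘL ⟨n, j⟩)
    have c3 : ∀ n, ContDiffOn ℝ L.length
        (fun q => ∑ j, S.δH m n q (i, j) * vecBlock n S.Θ q j) U := fun n =>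
      ContDiffOn.sum fun j _ => c2 n j
    rw [wd_add hU L ((ContDiffOn.sum fun a _ => c1 a).add (ContDiffOn.sum fun n _ => c3 n))
      hSrcL hq]
    simp only
    rw [wd_add hU L (ContDiffOn.sum fun a _ => c1 a) (ContDiffOn.sum fun n _ => c3 n) hq]
    simp only
    rw [wd_sum hU L Finset.univ (fun a _ => c1 a) hq, wd_sum hU L Finset.univ (fun n _ => c3 n) hq]
    simp only
    congr 2
    refine Finset.sum_congr rfl fun n _ => ?_
    rw [wd_sum hU L Finset.univ (fun j _ => c2 n j) hq, ← list_sum_finset_sum_comm]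
    exact Finset.sum_congr rfl fun j _ => wd_mul hU L (hδHL n j) (hΘL ⟨n, j⟩) hq
  rw [hl, hr] at h1
  rw [SystemData.remainder]
  linarith

theorem energy_vecBlock_le (U : Set Spacetime) (X : Set Space) (R : ℕ)
    (f : Spacetime → Idx P → ℝ) (m : Fin 3) (τ : ℝ) :
    energy U X R (vecBlock m f) τ ≤ energy U X R f τ := by
  refine Finset.sum_le_sum fun α _ => lintegral_mono fun x => ENNReal.ofReal_le_ofReal ?_
  rw [derivNormSq, derivNormSq, Fintype.sum_sigma]
  exact Finset.single_le_sum (f := fun m => ∑ i : Fin (P m), closedDeriv U α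
    (fun q => f q ⟨m, i⟩) (pt τ x) ^ 2) (fun m _ => Finset.sum_nonneg fun i _ => sq_nonneg _)
    (Finset.mem_univ m)

/-- The constant in the estimate of the remainder. -/
def remainderConst (R : ℕ) : ℝ := 4 ^ 5 * 4 ^ 2 ^ R * 16000000

/-- All Leibniz terms are instances of `product_estimate`, whose constant does not depend on the
number of components. The constant counts terms only: three column blocks, four directions `μ`, and
at most `2 ^ R` splittings of the word. -/
theorem SystemData.IsAdmissible.sqBd_remainder (hS : S.IsAdmissible R t₀ t₁ O)
    (D : SliceDomain t₀ t₁ b O φ Y) {L : List (Fin 4)} (hL : L.length ≤ R) {τ : ℝ}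
    (hτ : τ ∈ Ioo t₀ t₁) (m : Fin 3) {cM cH : ℝ} (hcM : 0 ≤ cM) (hcH : 0 ≤ cH)
    (hM : ∀ μ, CoeffBound (region (Ioo t₀ t₁) O) (O τ) R (max 1 R) (S.δM μ) τ cM)
    (hH : ∀ n, CoeffBound (region (Ioo t₀ t₁) O) (O τ) R R (S.δH m n) τ cH) :
    SqBd (region (Ioo t₀ t₁) O) (O τ) τ (S.remainder L m) (ENNReal.ofReal (remainderConst R) *
      (energy (region (Ioo t₀ t₁) O) (O τ) R (vecBlock m S.Src) τ +
        ENNReal.ofReal (cM ^ 2 + cH ^ 2) * energy (region (Ioo t₀ t₁) O) (O τ) R S.Θ τ)) := by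
  set U := region (Ioo t₀ t₁) O with hUdef
  have hU : IsOpen U := D.isOpen_region
  have hX := (D.isOpen_slice hτ).measurableSet
  have hXU : ∀ x ∈ O τ, pt τ x ∈ U := fun x hx => ⟨hτ, hx⟩
  set E := energy U (O τ) R S.Θ τ with hE
  have hRM : max 1 R ≤ R + 1 := by omega
  have hδM : ∀ μ p, ContDiffOn ℝ (max 1 R : ℕ) (fun q => S.δM μ q p) U := fun μ p =>
    (hS.contDiffOn_δM μ p).of_le (by exact_mod_cast hRM)
  have hδH := fun n p => hS.contDiffOn_δH D m n p
  have hΘ : ∀ a, ContDiffOn ℝ R (fun q => S.Θ q a) U := fun a =>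
    (hS.Θ_regular a).1.of_le (by norm_cast; omega)
  have hwdc : ∀ (f : Spacetime → ℝ) (A : List (Fin 4)) (n : ℕ), ContDiffOn ℝ n f U →
      A.length ≤ n → ContinuousOn (wd A f) U := fun f A n hf hA =>
    (wd_contDiffOn hU A (n := 0) (hf.of_le (by norm_cast; omega))).continuousOn
  have hSrc : SqBd U (O τ) τ (fun q i => wd L (fun q => S.Src q ⟨m, i⟩) q)
      (energy U (O τ) R (vecBlock m S.Src) τ) :=
    ⟨fun i => hwdc _ L R (hS.Src_regular ⟨m, i⟩).1 hL,
      lintegral_wsq_le_energy D (f := vecBlock m S.Src)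
        (fun i => (hS.Src_regular ⟨m, i⟩).1) hτ hL⟩
  have hlen : ∀ A : List (Fin 4), A.length ≤ R → 2 ^ A.length ≤ 2 ^ R := fun A hA =>
    Nat.pow_le_pow_right (by norm_num) hA
  have hT2 : SqBd U (O τ) τ (fun q i => ∑ n, ((splits L).map fun p =>
      ∑ j, wd p.1 (fun q => S.δH m n q (i, j)) q *
        wd p.2 (fun q => vecBlock n S.Θ q j) q).sum)
      (4 ^ 3 * (4 ^ 2 ^ R * (ENNReal.ofReal (16000000 * cH ^ 2) * E))) := by
    refine (SqBd.finset_sum hX hXU Finset.univ (T := fun n q i => ((splits L).map fun p =>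
      ∑ j, wd p.1 (fun q => S.δH m n q (i, j)) q *
        wd p.2 (fun q => vecBlock n S.Θ q j) q).sum)
      (C := 4 ^ 2 ^ R * (ENNReal.ofReal (16000000 * cH ^ 2) * E)) fun n _ => ?_).mono
      (by rw [Finset.card_univ, Fintype.card_fin])
    refine (SqBd.list_sum hX hXU (splits L) (T := fun p q i =>
      ∑ j, wd p.1 (fun q => S.δH m n q (i, j)) q * wd p.2 (fun q => vecBlock n S.Θ q j) q)
      (C := ENNReal.ofReal (16000000 * cH ^ 2) * E) fun p hp => ?_).mono ?_
    · have hp' := length_of_mem_splits hp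
      refine ⟨fun i => continuousOn_finsetSum _ fun j _ =>
        (hwdc _ _ R (hδH n (i, j)) (by omega)).mul (hwdc _ _ R (hΘ ⟨n, j⟩) (by omega)), ?_⟩
      refine (product_estimate D le_rfl (hδH n) (g := vecBlock n S.Θ) (fun j => hΘ ⟨n, j⟩) hτ hcH
        (hH n) (by omega) (by omega) (by omega)).trans ?_
      gcongr
      exact energy_vecBlock_le _ _ _ _ _ _
    · rw [length_splits]
      exact mul_le_mul_left (pow_le_pow_right₀ (by norm_num) (hlen L hL)) _
  have hT3 : SqBd U (O τ) τ (fun q (i : Fin (P m)) => ∑ μ, ((splits' L).map fun p =>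
      ∑ a, wd p.1 (fun q => S.δM μ q (⟨m, i⟩, a)) q *
        wd (p.2 ++ [μ]) (fun q => S.Θ q a) q).sum)
      (4 ^ 4 * (4 ^ 2 ^ R * (ENNReal.ofReal (16000000 * cM ^ 2) * E))) := by
    refine (SqBd.finset_sum hX hXU Finset.univ (T := fun μ q (i : Fin (P m)) =>
      ((splits' L).map fun p =>
      ∑ a, wd p.1 (fun q => S.δM μ q (⟨m, i⟩, a)) q *
        wd (p.2 ++ [μ]) (fun q => S.Θ q a) q).sum)
      (C := 4 ^ 2 ^ R * (ENNReal.ofReal (16000000 * cM ^ 2) * E)) fun μ _ => ?_).mono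
      (by rw [Finset.card_univ, Fintype.card_fin])
    refine (SqBd.list_sum hX hXU (splits' L) (T := fun p q (i : Fin (P m)) =>
      ∑ a, wd p.1 (fun q => S.δM μ q (⟨m, i⟩, a)) q * wd (p.2 ++ [μ]) (fun q => S.Θ q a) q)
      (C := ENNReal.ofReal (16000000 * cM ^ 2) * E) fun p hp => ?_).mono ?_
    · obtain ⟨hp', hp2⟩ := length_of_mem_splits' hp
      have hp3 := List.length_pos_iff.2 hp2
      -- The extra derivative `∂_μ` is paid for by the letter that `p.1` necessarily takes, so the
      -- field never carries more than `R` derivatives.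
      have hB : (p.2 ++ [μ]).length = p.2.length + 1 := by simp
      refine ⟨fun i => continuousOn_finsetSum _ fun a _ =>
        (hwdc _ _ (max 1 R) (hδM μ (⟨m, i⟩, a)) (by omega)).mul
          (hwdc _ _ R (hΘ a) (by omega)), ?_⟩
      refine le_trans (lintegral_mono fun x => ENNReal.ofReal_le_ofReal ?_)
        (product_estimate D (le_max_right 1 R) (hδM μ) hΘ hτ hcM (hM μ) (A := p.1)
          (B := p.2 ++ [μ]) (by omega) (by omega) (by omega))
      rw [Fintype.sum_sigma]
      exact Finset.single_le_sum (f := fun m' => ∑ i : Fin (P m'),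
        (∑ a, wd p.1 (fun q => S.δM μ q (⟨m', i⟩, a)) (pt τ x) *
          wd (p.2 ++ [μ]) (fun q => S.Θ q a) (pt τ x)) ^ 2)
        (fun m _ => Finset.sum_nonneg fun i _ => sq_nonneg _) (Finset.mem_univ m)
    · have h1 := length_splits' L
      have h2 := hlen L hL
      exact mul_le_mul_left (pow_le_pow_right₀ (by norm_num) (by omega)) _
  refine (hSrc.add hX hXU (hT2.add hX hXU hT3.neg)).mono ?_
  have e1 : ENNReal.ofReal (remainderConst R) = 4 ^ 5 * 4 ^ 2 ^ R * ENNReal.ofReal 16000000 := by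
    rw [remainderConst, ENNReal.ofReal_mul (by positivity), ENNReal.ofReal_mul (by positivity),
      ENNReal.ofReal_pow (by norm_num), ENNReal.ofReal_pow (by norm_num)]
    norm_num
  have one_le : (1 : ℝ≥0∞) ≤ 4 ^ 2 ^ R := one_le_pow₀ (by norm_num)
  have one_le' : (1 : ℝ≥0∞) ≤ ENNReal.ofReal 16000000 := by
    rw [← ENNReal.ofReal_one]; exact ENNReal.ofReal_le_ofReal (by norm_num)
  rw [e1, ENNReal.ofReal_mul (by norm_num), ENNReal.ofReal_mul (by norm_num),
    ENNReal.ofReal_add (by positivity) (by positivity)]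
  set Z := (4 : ℝ≥0∞) ^ 2 ^ R
  set W := ENNReal.ofReal 16000000
  set x := ENNReal.ofReal (cH ^ 2)
  set y := ENNReal.ofReal (cM ^ 2)
  set F := energy U (O τ) R (vecBlock m S.Src) τ
  have hF : F ≤ Z * W * F := le_mul_of_one_le_left zero_le (one_le_mul one_le one_le')
  have h34 : (4 : ℝ≥0∞) ^ 3 ≤ 4 ^ 4 := pow_le_pow_right₀ (by norm_num) (by norm_num)
  have h25 : (2 : ℝ≥0∞) ≤ 4 ^ 5 := by norm_num
  calc 2 * (F + 2 * (4 ^ 3 * (Z * (W * x * E)) + 4 ^ 4 * (Z * (W * y * E))))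
      ≤ 2 * (Z * W * F + 2 * (4 ^ 4 * (Z * (W * x * E)) + 4 ^ 4 * (Z * (W * y * E)))) :=
        mul_le_mul_right (add_le_add hF (mul_le_mul_right
          (add_le_add (mul_le_mul_left h34 _) le_rfl) _)) _
    _ = 2 * (Z * W * F) + 4 ^ 5 * (Z * W * ((y + x) * E)) := by ring
    _ ≤ 4 ^ 5 * (Z * W * F) + 4 ^ 5 * (Z * W * ((y + x) * E)) :=
        add_le_add (mul_le_mul_left h25 _) le_rfl
    _ = 4 ^ 5 * Z * W * (F + (y + x) * E) := by ring

end
-- The forcing terms of the three blocks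
section

variable {P : Fin 3 → ℕ} {t₀ t₁ b : ℝ} {O : ℝ → Set Space} {φ : Spacetime → ℝ}
  {Y : Fin 4 → Spacetime → ℝ} {S : SystemData P} {R : ℕ}

theorem wd_const_mul {U : Set Spacetime} (hU : IsOpen U) (L : List (Fin 4)) {f : Spacetime → ℝ}
    (hf : ContDiffOn ℝ L.length f U) (c : ℝ) :
    EqOn (wd L fun q => c * f q) (fun q => c * wd L f q) U := by
  induction L with
  | nil => exact fun _ _ => rfl
  | cons i L ih =>
    intro q hq
    rw [wd_cons, pd_congr hU (ih (hf.of_le (by simp))) i hq]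
    exact pd_const_mul (differentiableAt_of_contDiffOn hU (n := 1) (wd_contDiffOn hU L
      (hf.of_le (by simp [add_comm]))) one_ne_zero hq) c i

/-- The commuted system for the block `m` holds with a forcing term which is square integrable on
the slices, up to a term with a good sign. -/
def SystemData.Forced (S : SystemData P) (t₀ t₁ : ℝ) (O : ℝ → Set Space) (L : List (Fin 4))
    (m : Fin 3) (B : ℝ → ℝ≥0∞) : Prop :=
  ∃ G : Spacetime → Fin (P m) → ℝ,
    (∀ q ∈ region (Ioo t₀ t₁) O,
      ∑ i, wd L (fun q => S.Θ q ⟨m, i⟩) q *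
        (∑ μ, ∑ a, S.M μ q ⟨m, i⟩ a * pd μ (wd L fun q => S.Θ q a) q) ≤
      ∑ i, wd L (fun q => S.Θ q ⟨m, i⟩) q * G q i) ∧
    ∀ τ ∈ Ioo t₀ t₁, SqBd (region (Ioo t₀ t₁) O) (O τ) τ G (B τ)

theorem sqBd_matrix (D : SliceDomain t₀ t₁ b O φ Y) {ι κ : Type} [Fintype ι] [Fintype κ]
    {r : Spacetime → ℝ} (hr : ContinuousOn r (region (Ioo t₀ t₁) O)) {τ c : ℝ}
    (hτ : τ ∈ Ioo t₀ t₁) (hc : ∀ x ∈ O τ, |r (pt τ x)| ≤ c) (A : Matrix ι κ ℝ)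
    {g : Spacetime → κ → ℝ} (hg : ∀ j, ContDiffOn ℝ R (fun q => g q j) (region (Ioo t₀ t₁) O))
    {B : List (Fin 4)} (hB : B.length ≤ R) :
    SqBd (region (Ioo t₀ t₁) O) (O τ) τ
      (fun q i => r q * ∑ j, A i j * wd B (fun q => g q j) q)
      (ENNReal.ofReal (c ^ 2 * matNorm A ^ 2) * energy (region (Ioo t₀ t₁) O) (O τ) R g τ) := by
  refine ⟨fun i => hr.mul (continuousOn_finsetSum _ fun j _ => continuousOn_const.mul
    (wd_contDiffOn D.isOpen_region B (n := 0) ((hg j).of_le (by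
      norm_cast; omega))).continuousOn), ?_⟩
  calc _ ≤ ∫⁻ x in O τ, ENNReal.ofReal (c ^ 2 * matNorm A ^ 2) *
        ENNReal.ofReal (wsq B g (pt τ x)) := by
        refine setLIntegral_mono' (D.isOpen_slice hτ).measurableSet fun x hx => ?_
        rw [← ENNReal.ofReal_mul (by positivity)]
        refine ENNReal.ofReal_le_ofReal ?_
        simp only [mul_pow, ← Finset.mul_sum]
        rw [mul_assoc]
        have h1 : r (pt τ x) ^ 2 ≤ c ^ 2 := sq_le_sq.2 ((hc x hx).trans (le_abs_self c))
        have h2 := sum_sq_mulVec_le (fun p : ι × κ => A p.1 p.2)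
          fun j => wd B (fun q => g q j) (pt τ x)
        rw [← matNorm_sq] at h2
        exact mul_le_mul h1 h2 (Finset.sum_nonneg fun _ _ => sq_nonneg _) (sq_nonneg c)
    _ = _ := lintegral_const_mul' _ _ ENNReal.ofReal_ne_top
    _ ≤ _ := by
        gcongr
        exact lintegral_wsq_le_energy D hg hτ hB

/-- Smallness of the coefficients at the time `τ`. -/
def SystemData.CoeffSmall (S : SystemData P) (R : ℕ) (t₀ t₁ : ℝ) (O : ℝ → Set Space) (m : Fin 3)
    (τ cM cH : ℝ) : Prop :=
  (∀ μ, CoeffBound (region (Ioo t₀ t₁) O) (O τ) R (max 1 R) (S.δM μ) τ cM) ∧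
  ∀ n, CoeffBound (region (Ioo t₀ t₁) O) (O τ) R R (S.δH m n) τ cH

theorem SystemData.IsAdmissible.forced_zero (hS : S.IsAdmissible R t₀ t₁ O)
    (D : SliceDomain t₀ t₁ b O φ Y) {L : List (Fin 4)} (hL : L.length ≤ R) {cM cH : ℝ → ℝ}
    (hcM : ∀ τ, 0 ≤ cM τ) (hcH : ∀ τ, 0 ≤ cH τ)
    (hsmall : ∀ τ ∈ Ioo t₀ t₁, S.CoeffSmall R t₀ t₁ O 0 τ (cM τ) (cH τ)) :
    S.Forced t₀ t₁ O L 0 fun τ => ENNReal.ofReal (remainderConst R) *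
      (energy (region (Ioo t₀ t₁) O) (O τ) R (vecBlock 0 S.Src) τ +
        ENNReal.ofReal (cM τ ^ 2 + cH τ ^ 2) *
          energy (region (Ioo t₀ t₁) O) (O τ) R S.Θ τ) := by
  refine ⟨S.remainder L 0, fun q hq => le_of_eq (Finset.sum_congr rfl fun i _ => ?_),
    fun τ hτ => hS.sqBd_remainder D hL hτ 0 (hcM τ) (hcH τ) (hsmall τ hτ).1 (hsmall τ hτ).2⟩
  rw [hS.commuted D hL hq]
  simp only [SystemData.Hₐ_zero, zero_mul, wd_zero, Finset.sum_const_zero, zero_add]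

/-- The constant matrix `H₁` commutes with derivatives and couples to the first block without any
decay, so only the energy of that block enters with a constant that is not small. -/
theorem SystemData.IsAdmissible.forced_one (hS : S.IsAdmissible R t₀ t₁ O)
    (D : SliceDomain t₀ t₁ b O φ Y) {L : List (Fin 4)} (hL : L.length ≤ R) {cM cH : ℝ → ℝ}
    (hcM : ∀ τ, 0 ≤ cM τ) (hcH : ∀ τ, 0 ≤ cH τ)
    (hsmall : ∀ τ ∈ Ioo t₀ t₁, S.CoeffSmall R t₀ t₁ O 1 τ (cM τ) (cH τ)) :
    S.Forced t₀ t₁ O L 1 fun τ => 2 * (ENNReal.ofReal (1 ^ 2 * matNorm S.H₁ ^ 2) *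
        energy (region (Ioo t₀ t₁) O) (O τ) R (vecBlock 0 S.Θ) τ +
      ENNReal.ofReal (remainderConst R) *
      (energy (region (Ioo t₀ t₁) O) (O τ) R (vecBlock 1 S.Src) τ +
        ENNReal.ofReal (cM τ ^ 2 + cH τ ^ 2) *
          energy (region (Ioo t₀ t₁) O) (O τ) R S.Θ τ)) := by
  have hU := D.isOpen_region
  have hΘ : ∀ a, ContDiffOn ℝ R (fun q => S.Θ q a) (region (Ioo t₀ t₁) O) := fun a =>
    (hS.Θ_regular a).1.of_le (by norm_cast; omega)
  refine ⟨fun q i => 1 * ∑ j, S.H₁ i j * wd L (fun q => vecBlock 0 S.Θ q j) q +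
    S.remainder L 1 q i, fun q hq => le_of_eq (Finset.sum_congr rfl fun i _ => ?_), fun τ hτ => ?_⟩
  · rw [hS.commuted D hL hq, Fintype.sum_sigma, Fin.sum_univ_three]
    simp only [SystemData.Hₐ_one_zero, SystemData.Hₐ_one_one, SystemData.Hₐ_one_two, zero_mul,
      wd_zero, Finset.sum_const_zero, add_zero, one_mul]
    congr 2
    exact Finset.sum_congr rfl fun j _ =>
      wd_const_mul hU L ((hΘ ⟨0, j⟩).of_le (by exact_mod_cast hL)) (S.H₁ i j) hq
  · refine SqBd.add (D.isOpen_slice hτ).measurableSet (fun x hx => mem_region.2 ⟨hτ, hx⟩) ?_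
      (hS.sqBd_remainder D hL hτ 1 (hcM τ) (hcH τ) (hsmall τ hτ).1 (hsmall τ hτ).2)
    exact sqBd_matrix D continuousOn_const hτ (fun x _ => by simp) S.H₁ (g := vecBlock 0 S.Θ)
      (fun j => hΘ ⟨0, j⟩) hL

theorem abs_wd_inv_abs_time_le (A : List (Fin 4)) {R : ℕ} (hA : A.length ≤ R) {q : Spacetime}
    (hq : q 0 ≤ -1) (k : ℕ) (hk : k ≤ A.length + 1) :
    |wd A (fun q : Spacetime => |q 0|⁻¹) q| ≤ R.factorial * |q 0|⁻¹ ^ k := by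
  obtain ⟨c, hc, h⟩ := wd_inv_abs_time A
  have hq0 : q 0 < 0 := by linarith
  have h1 : |q 0| = -q 0 := abs_of_neg hq0
  have h2 : 0 ≤ (-q 0)⁻¹ := inv_nonneg.2 (by linarith)
  have h3 : (-q 0)⁻¹ ≤ 1 := inv_le_one_of_one_le₀ (by linarith)
  rw [h hq0, abs_mul, abs_of_nonneg (pow_nonneg h2 _), h1]
  refine mul_le_mul (hc.trans (by exact_mod_cast Nat.factorial_le hA))
    (pow_le_pow_of_le_one h2 h3 hk) (pow_nonneg h2 _) (by positivity)

/-- The top term `|t|⁻¹ H₃ v` pairs with `v` to something nonpositive and is discarded, which is why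
`Forced` is an inequality. What remains of `H₃` has a derivative on `|t|⁻¹` and decays like `|t|⁻²`,
whereas the coupling to the second block through `H₂` decays like `|t|⁻¹`. -/
theorem SystemData.IsAdmissible.forced_two (hS : S.IsAdmissible R t₀ t₁ O)
    (D : SliceDomain t₀ t₁ b O φ Y) {L : List (Fin 4)} (hL : L.length ≤ R) {cM cH : ℝ → ℝ}
    (hcM : ∀ τ, 0 ≤ cM τ) (hcH : ∀ τ, 0 ≤ cH τ)
    (hsmall : ∀ τ ∈ Ioo t₀ t₁, S.CoeffSmall R t₀ t₁ O 2 τ (cM τ) (cH τ)) :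
    S.Forced t₀ t₁ O L 2 fun τ =>
      2 * (2 * (4 ^ 2 ^ R * (ENNReal.ofReal ((R.factorial * |τ|⁻¹ ^ 1) ^ 2 * matNorm S.H₂ ^ 2) *
          energy (region (Ioo t₀ t₁) O) (O τ) R (vecBlock 1 S.Θ) τ) +
        4 ^ 2 ^ R * (ENNReal.ofReal ((R.factorial * |τ|⁻¹ ^ 2) ^ 2 * matNorm S.H₃ ^ 2) *
          energy (region (Ioo t₀ t₁) O) (O τ) R (vecBlock 2 S.Θ) τ)) +
      ENNReal.ofReal (remainderConst R) *
      (energy (region (Ioo t₀ t₁) O) (O τ) R (vecBlock 2 S.Src) τ +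
        ENNReal.ofReal (cM τ ^ 2 + cH τ ^ 2) *
          energy (region (Ioo t₀ t₁) O) (O τ) R S.Θ τ)) := by
  have hU := D.isOpen_region
  have hLR : ((L.length : ℕ) : WithTop ℕ∞) ≤ (R : ℕ) := by exact_mod_cast hL
  have hΘ : ∀ a, ContDiffOn ℝ R (fun q => S.Θ q a) (region (Ioo t₀ t₁) O) := fun a =>
    (hS.Θ_regular a).1.of_le (by norm_cast; omega)
  have hinv : ∀ n : ℕ, ContDiffOn ℝ n (fun q : Spacetime => |q 0|⁻¹) (region (Ioo t₀ t₁) O) :=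
    fun n => (contDiffOn_inv_abs_time n).mono D.region_subset_negTime
  have hinvc : ∀ A : List (Fin 4), ContinuousOn (wd A fun q : Spacetime => |q 0|⁻¹)
      (region (Ioo t₀ t₁) O) := fun A =>
    (wd_contDiffOn hU A (n := 0) (hinv _)).continuousOn
  set r : List (Fin 4) → Spacetime → ℝ := fun A => wd A fun q : Spacetime => |q 0|⁻¹ with hr
  set T2 : Spacetime → Fin (P 2) → ℝ := fun q i => ((splits L).map fun p => r p.1 q *
    ∑ j, S.H₂ i j * wd p.2 (fun q => vecBlock 1 S.Θ q j) q).sum with hT2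
  set T3 : Spacetime → Fin (P 2) → ℝ := fun q i => ((splits' L).map fun p => r p.1 q *
    ∑ j, S.H₃ i j * wd p.2 (fun q => vecBlock 2 S.Θ q j) q).sum with hT3
  refine ⟨fun q i => (T2 q i + T3 q i) + S.remainder L 2 q i, fun q hq => ?_, fun τ hτ => ?_⟩
  · set v : Fin (P 2) → ℝ := fun i => wd L (fun q => S.Θ q ⟨2, i⟩) q with hv
    have e : ∀ i, ∑ μ, ∑ a, S.M μ q ⟨2, i⟩ a * pd μ (wd L fun q => S.Θ q a) q =
        |q 0|⁻¹ * (S.H₃ *ᵥ v) i + ((T2 q i + T3 q i) + S.remainder L 2 q i) := by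
      intro i
      rw [hS.commuted D hL hq, Fintype.sum_sigma, Fin.sum_univ_three]
      simp only [SystemData.Hₐ_two_zero, SystemData.Hₐ_two_one, SystemData.Hₐ_two_two, zero_mul,
        wd_zero, Finset.sum_const_zero, zero_add]
      have a1 : ∀ j, wd L (fun q => |q 0|⁻¹ * S.H₂ i j * S.Θ q ⟨1, j⟩) q =
          ((splits L).map fun p => r p.1 q * (S.H₂ i j *
            wd p.2 (fun q => vecBlock 1 S.Θ q j) q)).sum := fun j => by
        simp only [mul_assoc]
        rw [wd_mul hU L (hinv _) (contDiffOn_const.mul ((hΘ ⟨1, j⟩).of_le hLR)) hq]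
        refine congrArg List.sum (List.map_congr_left fun p hp => ?_)
        have := length_of_mem_splits hp
        rw [wd_const_mul hU p.2 ((hΘ ⟨1, j⟩).of_le (by norm_cast; omega)) _ hq]
        rfl
      have a2 : ∀ j, wd L (fun q => |q 0|⁻¹ * S.H₃ i j * S.Θ q ⟨2, j⟩) q =
          |q 0|⁻¹ * (S.H₃ i j * v j) + ((splits' L).map fun p => r p.1 q * (S.H₃ i j *
            wd p.2 (fun q => vecBlock 2 S.Θ q j) q)).sum := fun j => by
        simp only [mul_assoc]
        rw [wd_mul' hU L (hinv _) (contDiffOn_const.mul ((hΘ ⟨2, j⟩).of_le hLR)) hq]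
        simp only
        rw [wd_const_mul hU L ((hΘ ⟨2, j⟩).of_le hLR) _ hq]
        congr 2
        refine List.map_congr_left fun p hp => ?_
        have := (length_of_mem_splits' hp).1
        rw [wd_const_mul hU p.2 ((hΘ ⟨2, j⟩).of_le (by norm_cast; omega)) _ hq]
        rfl
      simp only [a1, a2, Finset.sum_add_distrib, list_sum_finset_sum_comm, ← Finset.mul_sum]
      rw [Matrix.mulVec, dotProduct]
      ring
    have hneg := hS.H₃_nonpos v
    rw [Matrix.zero_mulVec, dotProduct_zero, dotProduct] at hneg
    have h0 : 0 ≤ |q 0|⁻¹ := by positivity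
    have e2 : ∑ i, v i * (∑ μ, ∑ a, S.M μ q ⟨2, i⟩ a * pd μ (wd L fun q => S.Θ q a) q) =
        |q 0|⁻¹ * ∑ i, v i * (S.H₃ *ᵥ v) i +
          ∑ i, v i * ((T2 q i + T3 q i) + S.remainder L 2 q i) := by
      rw [Finset.mul_sum, ← Finset.sum_add_distrib]
      refine Finset.sum_congr rfl fun i _ => ?_
      rw [e]; ring
    have h1 := mul_nonpos_of_nonneg_of_nonpos h0 hneg
    change ∑ i, v i * _ ≤ ∑ i, v i * _
    rw [e2]
    linarith
  · have hX := (D.isOpen_slice hτ).measurableSet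
    have hXU : ∀ x ∈ O τ, pt τ x ∈ region (Ioo t₀ t₁) O := fun x hx => ⟨hτ, hx⟩
    have hτ1 : τ ≤ -1 := hτ.2.le.trans D.le_neg_one
    have h4 : (1 : ℝ≥0∞) ≤ 4 := by norm_num
    have hpow : 2 ^ L.length ≤ 2 ^ R := Nat.pow_le_pow_right (by norm_num) hL
    refine ((SqBd.add hX hXU ?_ ?_).add hX hXU
      (hS.sqBd_remainder D hL hτ 2 (hcM τ) (hcH τ) (hsmall τ hτ).1 (hsmall τ hτ).2))
    · refine (SqBd.list_sum hX hXU (splits L) (T := fun p q i => r p.1 q *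
        ∑ j, S.H₂ i j * wd p.2 (fun q => vecBlock 1 S.Θ q j) q) fun p hp => ?_).mono
        (mul_le_mul_left (pow_le_pow_right₀ h4 ((length_splits L).trans_le hpow)) _)
      have hp' := length_of_mem_splits hp
      exact sqBd_matrix D (hinvc _) hτ (fun x hx => abs_wd_inv_abs_time_le p.1 (by omega) hτ1 1
        (by omega)) S.H₂ (g := vecBlock 1 S.Θ) (fun j => hΘ ⟨1, j⟩) (by omega)
    · have hlen := length_splits' L
      refine (SqBd.list_sum hX hXU (splits' L) (T := fun p q i => r p.1 q *
        ∑ j, S.H₃ i j * wd p.2 (fun q => vecBlock 2 S.Θ q j) q) fun p hp => ?_).mono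
        (mul_le_mul_left (pow_le_pow_right₀ h4 (by omega)) _)
      obtain ⟨hp', hp2⟩ := length_of_mem_splits' hp
      have := List.length_pos_iff.2 hp2
      exact sqBd_matrix D (hinvc _) hτ (fun x hx => abs_wd_inv_abs_time_le p.1 (by omega) hτ1 2
        (by omega)) S.H₃ (g := vecBlock 2 S.Θ) (fun j => hΘ ⟨2, j⟩) (by omega)

end

/-! ### The energy current -/

section

variable {n : ℕ}

/-- The Euclidean matrix norm dominates the quadratic form, by Cauchy–Schwarz over pairs of indices.
-/
theorem abs_quadratic_le {X : Fin n → Fin n → ℝ} {K : ℝ} (hK : 0 ≤ K)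
    (hX : ∑ i, ∑ k, X i k ^ 2 ≤ K ^ 2) (v : Fin n → ℝ) :
    |∑ i, ∑ k, v i * X i k * v k| ≤ K * ∑ i, v i ^ 2 := by
  have h0 : 0 ≤ ∑ i, v i ^ 2 := Finset.sum_nonneg fun _ _ => sq_nonneg _
  refine abs_le_of_sq_le_sq ?_ (mul_nonneg hK h0)
  have h1 := Finset.sum_mul_sq_le_sq_mul_sq (Finset.univ : Finset (Fin n × Fin n))
    (fun p => v p.1 * v p.2) fun p => X p.1 p.2
  simp only [Fintype.sum_prod_type, mul_pow] at h1
  have h2 : ∑ i, ∑ k, v i ^ 2 * v k ^ 2 = (∑ i, v i ^ 2) ^ 2 := by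
    rw [sq, Finset.sum_mul_sum]
  have h3 : ∑ i, ∑ k, v i * X i k * v k = ∑ i, ∑ k, v i * v k * X i k :=
    Finset.sum_congr rfl fun i _ => Finset.sum_congr rfl fun k _ => by ring
  rw [h3, mul_pow, mul_comm (K ^ 2)]
  rw [h2] at h1
  exact h1.trans (by gcongr)

/-- Symmetry of `N` lets the derivatives of the two factors `v` combine into a single term `2 v·N
∂v`, to which the equation applies after summation over `μ`. -/
theorem pd_current {w : Spacetime → ℝ} {v : Fin n → Spacetime → ℝ}
    {N : Fin n → Fin n → Spacetime → ℝ} {q : Spacetime} (hw : DifferentiableAt ℝ w q)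
    (hv : ∀ i, DifferentiableAt ℝ (v i) q) (hN : ∀ i k, DifferentiableAt ℝ (N i k) q)
    (hsymm : ∀ i k, N i k q = N k i q) (μ : Fin 4) :
    pd μ (fun q => w q * ∑ i, ∑ k, v i q * N i k q * v k q) q =
      pd μ w q * (∑ i, ∑ k, v i q * N i k q * v k q) +
        w q * (∑ i, ∑ k, v i q * pd μ (N i k) q * v k q +
          2 * ∑ i, v i q * ∑ k, N i k q * pd μ (v k) q) := by
  have hd : ∀ i k, DifferentiableAt ℝ (fun q => v i q * N i k q * v k q) q := fun i k =>
    ((hv i).mul (hN i k)).mul (hv k)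
  rw [pd_mul hw (DifferentiableAt.fun_sum fun i _ => DifferentiableAt.fun_sum fun k _ => hd i k),
    pd_sum _ fun i _ => DifferentiableAt.fun_sum fun k _ => hd i k]
  congr 2
  have e : ∀ i, pd μ (fun q => ∑ k, v i q * N i k q * v k q) q =
      ∑ k, (v i q * pd μ (N i k) q * v k q + v k q * (N k i q * pd μ (v i) q) +
        v i q * (N i k q * pd μ (v k) q)) := fun i => by
    rw [pd_sum _ fun k _ => hd i k]
    refine Finset.sum_congr rfl fun k _ => ?_
    rw [pd_mul ((hv i).fun_mul (hN i k)) (hv k), pd_mul (hv i) (hN i k), hsymm k i]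
    ring
  simp only [e, Finset.sum_add_distrib, two_mul, Finset.mul_sum]
  rw [Finset.sum_comm (f := fun i k => v k q * (N k i q * pd μ (v i) q))]
  ring

end

/-! ### Quadratic forms of the diagonal blocks -/

section

variable {P : Fin 3 → ℕ}

/-- The vector with block `m` equal to `v` and vanishing other blocks. -/
def blockVec (m : Fin 3) (v : Fin (P m) → ℝ) : Idx P → ℝ := fun a => ∑ i, if a = ⟨m, i⟩ then v i else 0

theorem blockVec_sum (m : Fin 3) (v : Fin (P m) → ℝ) (f : Idx P → ℝ) :
    ∑ a, blockVec m v a * f a = ∑ i, v i * f ⟨m, i⟩ := by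
  simp only [blockVec, Finset.sum_mul]
  rw [Finset.sum_comm]
  simp [ite_mul]

theorem blockVec_quadratic (m : Fin 3) (v : Fin (P m) → ℝ) (A : Matrix (Idx P) (Idx P) ℝ) :
    blockVec m v ⬝ᵥ (A *ᵥ blockVec m v) = ∑ i, ∑ k, v i * A ⟨m, i⟩ ⟨m, k⟩ * v k := by
  rw [dotProduct, blockVec_sum]
  refine Finset.sum_congr rfl fun i _ => ?_
  rw [Matrix.mulVec, dotProduct, Finset.mul_sum]
  have := blockVec_sum m v fun a => v i * A ⟨m, i⟩ a
  simp only [mul_comm (blockVec m v _)] at this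
  simp only [← mul_assoc]
  rw [this]
  exact Finset.sum_congr rfl fun k _ => by ring

theorem blockVec_normSq (m : Fin 3) (v : Fin (P m) → ℝ) :
    blockVec m v ⬝ᵥ blockVec m v = ∑ i, v i ^ 2 := by
  have h := blockVec_quadratic m v (1 : Matrix (Idx P) (Idx P) ℝ)
  rw [Matrix.one_mulVec] at h
  rw [h]
  refine Finset.sum_congr rfl fun i _ => ?_
  rw [Finset.sum_eq_single i]
  · simp [sq]
  · intro k _ hk
    rw [Matrix.one_apply_ne (by simpa using hk.symm)]; ring
  · simp

variable {t₀ t₁ b : ℝ} {O : ℝ → Set Space} {φ : Spacetime → ℝ}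
  {Y : Fin 4 → Spacetime → ℝ} {S : SystemData P} {R : ℕ}

/-- The quadratic form of the diagonal block `m` of `M^μ` in the derivatives `wd L` of `Θ`. -/
def SystemData.form (S : SystemData P) (L : List (Fin 4)) (m : Fin 3) (μ : Fin 4)
    (q : Spacetime) : ℝ :=
  ∑ i, ∑ k, wd L (fun q => S.Θ q ⟨m, i⟩) q * S.M μ q ⟨m, i⟩ ⟨m, k⟩ * wd L (fun q => S.Θ q ⟨m, k⟩) q

theorem SystemData.form_eq (S : SystemData P) (L : List (Fin 4)) (m : Fin 3) (μ : Fin 4)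
    (q : Spacetime) : S.form L m μ q = blockVec m (fun i => wd L (fun q => S.Θ q ⟨m, i⟩) q) ⬝ᵥ
      (S.M μ q *ᵥ blockVec m fun i => wd L (fun q => S.Θ q ⟨m, i⟩) q) :=
  (blockVec_quadratic m _ _).symm

theorem wsq_vecBlock (S : SystemData P) (L : List (Fin 4)) (m : Fin 3) (q : Spacetime) :
    wsq L (vecBlock m S.Θ) q = ∑ i, wd L (fun q => S.Θ q ⟨m, i⟩) q ^ 2 := rfl

theorem SystemData.IsAdmissible.form_zero_ge (hS : S.IsAdmissible R t₀ t₁ O) (L : List (Fin 4))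
    (m : Fin 3) {q : Spacetime} (hq : q ∈ region (Ioo t₀ t₁) O) :
    1 / 2 * wsq L (vecBlock m S.Θ) q ≤ S.form L m 0 q := by
  have h := hS.M_zero_lower q hq (blockVec m fun i => wd L (fun q => S.Θ q ⟨m, i⟩) q)
  rw [Matrix.smul_mulVec, Matrix.one_mulVec, dotProduct_smul, blockVec_normSq] at h
  rwa [S.form_eq, wsq_vecBlock]

theorem SystemData.IsAdmissible.form_zero_le (hS : S.IsAdmissible R t₀ t₁ O) (L : List (Fin 4))
    (m : Fin 3) {q : Spacetime} (hq : q ∈ region (Ioo t₀ t₁) O) :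
    S.form L m 0 q ≤ 2 * wsq L (vecBlock m S.Θ) q := by
  have h := hS.M_zero_upper q hq (blockVec m fun i => wd L (fun q => S.Θ q ⟨m, i⟩) q)
  rw [Matrix.smul_mulVec, Matrix.one_mulVec, dotProduct_smul, blockVec_normSq] at h
  rwa [S.form_eq, wsq_vecBlock]

theorem SystemData.IsAdmissible.form_three_nonneg (hS : S.IsAdmissible R t₀ t₁ O)
    (L : List (Fin 4)) (m : Fin 3) {q : Spacetime} (hq : q ∈ region (Ioo t₀ t₁) O) :
    0 ≤ S.form L m 3 q := by
  have h := hS.M_three_nonneg q hq (blockVec m fun i => wd L (fun q => S.Θ q ⟨m, i⟩) q)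
  rw [Matrix.zero_mulVec, dotProduct_zero] at h
  rwa [S.form_eq]

/-- One derivative of `M^μ` is needed pointwise even for `R = 0`, which is the reason for `max 1 R`
in the supremum hypothesis. The factor `4000` is the square root of the Sobolev constant. -/
theorem SystemData.IsAdmissible.abs_form_pd_le (hS : S.IsAdmissible R t₀ t₁ O)
    (D : SliceDomain t₀ t₁ b O φ Y) (m : Fin 3) {τ c : ℝ} (hτ : τ ∈ Ioo t₀ t₁) (hc : 0 ≤ c)
    {μ : Fin 4} (h : CoeffBound (region (Ioo t₀ t₁) O) (O τ) R (max 1 R) (S.δM μ) τ c)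
    {x : Space} (hx : x ∈ O τ) (v : Fin (P m) → ℝ) :
    |∑ i, ∑ k, v i * pd μ (fun q => S.M μ q ⟨m, i⟩ ⟨m, k⟩) (pt τ x) * v k| ≤
      4000 * c * ∑ i, v i ^ 2 := by
  have hq : pt τ x ∈ region (Ioo t₀ t₁) O := pt_mem_region.2 ⟨hτ, hx⟩
  refine abs_quadratic_le (by positivity) ?_ v
  have h1 := h.wsq_le D (le_max_right 1 R) (fun p => ((hS.contDiffOn_δM μ p).of_le (by
    norm_cast; omega))) hτ hc (L := [μ]) (by simp) (by simp; omega) hx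
  refine le_trans ?_ (h1.trans_eq (by ring))
  rw [wsq, Fintype.sum_prod_type, Fintype.sum_sigma]
  have e : ∀ a a', wd [μ] (fun q => S.δM μ q (a, a')) (pt τ x) =
      pd μ (fun q => S.M μ q a a') (pt τ x) := fun a a' => by
    have hd : DifferentiableAt ℝ (fun q => S.M μ q a a') (pt τ x) :=
      differentiableAt_of_contDiffOn D.isOpen_region (hS.M_regular μ (a, a')).1 (by simp) hq
    simp only [wd_cons, wd_nil, SystemData.δM, entries, Matrix.sub_apply, pd]
    rw [fderiv_sub_const]
  simp only [e]
  refine le_trans ?_ (Finset.single_le_sum (f := fun m' => ∑ i, ∑ a',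
    pd μ (fun q => S.M μ q ⟨m', i⟩ a') (pt τ x) ^ 2) (fun m' _ => Finset.sum_nonneg fun _ _ =>
      Finset.sum_nonneg fun _ _ => sq_nonneg _) (Finset.mem_univ m))
  refine Finset.sum_le_sum fun i _ => ?_
  rw [Fintype.sum_sigma]
  exact Finset.single_le_sum (f := fun m' => ∑ k, pd μ (fun q => S.M μ q ⟨m, i⟩ ⟨m', k⟩)
    (pt τ x) ^ 2) (fun m' _ => Finset.sum_nonneg fun _ _ => sq_nonneg _) (Finset.mem_univ m)

/-- The energy identity at a point: the weight contributes with a favourable sign, the four terms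
`v·(∂_μ M^μ) v` cost `4 * 4000 c`, and the pairing with the forcing is split by Young's inequality
with parameter `l`. -/
theorem SystemData.IsAdmissible.divergence_current_le (hS : S.IsAdmissible R t₀ t₁ O)
    (D : SliceDomain t₀ t₁ b O φ Y) {L : List (Fin 4)} (hL : L.length ≤ R) (m : Fin 3)
    {w : Spacetime → ℝ} {τ c l : ℝ} (hτ : τ ∈ Ioo t₀ t₁) (hc : 0 ≤ c) (hl : 0 < l)
    (h : ∀ μ, CoeffBound (region (Ioo t₀ t₁) O) (O τ) R (max 1 R) (S.δM μ) τ c)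
    {x : Space} (hx : x ∈ O τ) (hw : DifferentiableAt ℝ w (pt τ x)) (hw0 : 0 ≤ w (pt τ x))
    (hwM : ∑ μ, pd μ w (pt τ x) * S.form L m μ (pt τ x) ≤ 0) {g : Fin (P m) → ℝ}
    (hg : ∑ i, wd L (fun q => S.Θ q ⟨m, i⟩) (pt τ x) *
        (∑ μ, ∑ a, S.M μ (pt τ x) ⟨m, i⟩ a * pd μ (wd L fun q => S.Θ q a) (pt τ x)) ≤
      ∑ i, wd L (fun q => S.Θ q ⟨m, i⟩) (pt τ x) * g i) :
    ∑ μ, pd μ (fun q => w q * S.form L m μ q) (pt τ x) ≤ w (pt τ x) *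
      ((16000 * c + l) * wsq L (vecBlock m S.Θ) (pt τ x) + l⁻¹ * ∑ i, g i ^ 2) := by
  set q := pt τ x with hqdef
  have hq : q ∈ region (Ioo t₀ t₁) O := pt_mem_region.2 ⟨hτ, hx⟩
  set v : Fin (P m) → Spacetime → ℝ := fun i => wd L fun q => S.Θ q ⟨m, i⟩ with hvdef
  have hv : ∀ i, DifferentiableAt ℝ (v i) q := fun i =>
    differentiableAt_of_contDiffOn D.isOpen_region (n := 1) (wd_contDiffOn D.isOpen_region L
      ((hS.Θ_regular ⟨m, i⟩).1.of_le (by norm_cast; omega))) one_ne_zero hq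
  have hM : ∀ μ i k, DifferentiableAt ℝ (fun q => S.M μ q ⟨m, i⟩ ⟨m, k⟩) q := fun μ i k =>
    differentiableAt_of_contDiffOn D.isOpen_region (hS.M_regular μ (⟨m, i⟩, ⟨m, k⟩)).1
      (by simp) hq
  have e1 : ∀ μ, pd μ (fun q => w q * S.form L m μ q) q = pd μ w q * S.form L m μ q +
      w q * (∑ i, ∑ k, v i q * pd μ (fun q => S.M μ q ⟨m, i⟩ ⟨m, k⟩) q * v k q +
        2 * ∑ i, v i q * ∑ k, S.M μ q ⟨m, i⟩ ⟨m, k⟩ * pd μ (v k) q) := fun μ =>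
    pd_current (v := v) (N := fun i k q => S.M μ q ⟨m, i⟩ ⟨m, k⟩) hw hv (hM μ)
      (fun i k => ((hS.M_symm μ q hq).apply _ _)) μ
  -- Block diagonality: the principal part of block `m` involves only that block, so each block has
  -- its own energy current.
  have e2 : ∀ i μ, ∑ a, S.M μ q ⟨m, i⟩ a * pd μ (wd L fun q => S.Θ q a) q =
      ∑ k, S.M μ q ⟨m, i⟩ ⟨m, k⟩ * pd μ (v k) q := fun i μ => by
    rw [Fintype.sum_sigma, Finset.sum_eq_single m]
    · intro m' _ hm'
      refine Finset.sum_eq_zero fun k _ => ?_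
      have h0 := congrFun (congrFun (hS.M_blockDiag μ q hq m m' hm'.symm) i) k
      rw [matBlock, Matrix.of_apply, Matrix.zero_apply] at h0
      rw [h0, zero_mul]
    · simp
  simp only [e2, Finset.mul_sum (s := (Finset.univ : Finset (Fin 4)))] at hg
  rw [Finset.sum_comm] at hg
  have h1 : ∀ μ, ∑ i, ∑ k, v i q * pd μ (fun q => S.M μ q ⟨m, i⟩ ⟨m, k⟩) q * v k q ≤
      4000 * c * ∑ i, v i q ^ 2 := fun μ =>
    (le_abs_self _).trans (hS.abs_form_pd_le D m hτ hc (h μ) hx fun i => v i q)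
  have h2 : 2 * ∑ i, v i q * g i ≤ l * ∑ i, v i q ^ 2 + l⁻¹ * ∑ i, g i ^ 2 := by
    rw [Finset.mul_sum, Finset.mul_sum, Finset.mul_sum, ← Finset.sum_add_distrib]
    refine Finset.sum_le_sum fun i _ => ?_
    have h3 : 0 ≤ l⁻¹ * (l * v i q - g i) ^ 2 := by positivity
    have h4 : l⁻¹ * (l * v i q - g i) ^ 2 = l * v i q ^ 2 + l⁻¹ * g i ^ 2 - 2 * (v i q * g i) := by
      field_simp; ring
    linarith
  calc ∑ μ, pd μ (fun q => w q * S.form L m μ q) q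
      = ∑ μ, pd μ w q * S.form L m μ q + w q *
        (∑ μ, ∑ i, ∑ k, v i q * pd μ (fun q => S.M μ q ⟨m, i⟩ ⟨m, k⟩) q * v k q +
          2 * ∑ μ, ∑ i, v i q * ∑ k, S.M μ q ⟨m, i⟩ ⟨m, k⟩ * pd μ (v k) q) := by
        simp only [e1]
        rw [Finset.sum_add_distrib, ← Finset.mul_sum, Finset.sum_add_distrib, ← Finset.mul_sum]
    _ ≤ 0 + w q * (∑ _μ : Fin 4, 4000 * c * ∑ i, v i q ^ 2 + 2 * ∑ i, v i q * g i) := by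
        refine add_le_add hwM (mul_le_mul_of_nonneg_left (add_le_add
          (Finset.sum_le_sum fun μ _ => h1 μ) ?_) hw0)
        exact mul_le_mul_of_nonneg_left hg zero_le_two
    _ ≤ _ := by
        rw [zero_add]
        refine mul_le_mul_of_nonneg_left ?_ hw0
        rw [wsq_vecBlock, Finset.sum_const, Finset.card_univ, Fintype.card_fin, nsmul_eq_mul]
        push_cast
        change _ ≤ (16000 * c + l) * ∑ i, v i q ^ 2 + _
        linarith

end

/-! ### The energy inequality for one derivative of one block -/

section

variable {P : Fin 3 → ℕ} {t₀ t₁ b : ℝ} {O : ℝ → Set Space} {φ : Spacetime → ℝ}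
  {Y : Fin 4 → Spacetime → ℝ} {S : SystemData P} {R : ℕ}

theorem wd_eq_zero_of_isOpen {V : Set Spacetime} (hV : IsOpen V) {f : Spacetime → ℝ}
    (hf : ∀ q ∈ V, f q = 0) (L : List (Fin 4)) {q : Spacetime} (hq : q ∈ V) : wd L f q = 0 := by
  rw [wd_congr hV (g := fun _ => 0) hf L hq, wd_zero]

theorem SystemData.IsAdmissible.exists_wd_far (hS : S.IsAdmissible R t₀ t₁ O)
    (D : SliceDomain t₀ t₁ b O φ Y) : ∃ ρ : ℝ, ∀ (L : List (Fin 4)) (a : Idx P),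
      ∀ q ∈ region (Ioo t₀ t₁) O, ρ < ‖sp q‖ → wd L (fun q => S.Θ q a) q = 0 := by
  obtain ⟨ρ, hρ⟩ := hS.support_ball
  refine ⟨ρ, fun L a q hq h => wd_eq_zero_of_isOpen (D.isOpen_region.inter
    (isOpen_lt continuous_const continuous_sp.norm : IsOpen {q | ρ < ‖sp q‖}))
    (fun y hy => ?_) L ⟨hq, h⟩⟩
  have h1 := (hρ (y 0) hy.1.1 (sp y) hy.1.2 (le_of_lt hy.2)).1
  rw [pt_sp] at h1
  exact congrFun h1 a

theorem SystemData.IsAdmissible.wd_low (hS : S.IsAdmissible R t₀ t₁ O)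
    (D : SliceDomain t₀ t₁ b O φ Y) (L : List (Fin 4)) (a : Idx P) {q : Spacetime}
    (hq : q ∈ region (Ioo t₀ t₁) O) (h : q 3 < 1 / 2) : wd L (fun q => S.Θ q a) q = 0 :=
  wd_eq_zero_of_isOpen (D.isOpen_region.inter
    (isOpen_lt (continuous_apply 3) continuous_const : IsOpen {q : Spacetime | q 3 < 1 / 2}))
    (fun y hy => congrFun (hS.support_lower y hy.1 hy.2).1 a) L ⟨hq, h⟩

/-- The energy of the derivative `wd L` of the block `m` of the field. -/
def SystemData.wordEnergy (S : SystemData P) (O : ℝ → Set Space) (L : List (Fin 4)) (m : Fin 3)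
    (τ : ℝ) : ℝ := ∫ x in O τ, wsq L (vecBlock m S.Θ) (pt τ x)

theorem SystemData.IsAdmissible.contDiffOn_vecBlock (hS : S.IsAdmissible R t₀ t₁ O) (m : Fin 3)
    (i : Fin (P m)) : ContDiffOn ℝ (R + 1 : ℕ) (fun q => vecBlock m S.Θ q i)
      (region (Ioo t₀ t₁) O) := (hS.Θ_regular ⟨m, i⟩).1

theorem SystemData.IsAdmissible.integrableOn_wsq (hS : S.IsAdmissible R t₀ t₁ O)
    (D : SliceDomain t₀ t₁ b O φ Y) {L : List (Fin 4)} (hL : L.length ≤ R) (m : Fin 3) {τ : ℝ}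
    (hτ : τ ∈ Ioo t₀ t₁) : IntegrableOn (fun x => wsq L (vecBlock m S.Θ) (pt τ x)) (O τ) := by
  obtain ⟨ρ, hρ⟩ := hS.exists_wd_far D
  have hz : ∀ q ∈ region (Ioo t₀ t₁) O, ρ < ‖sp q‖ → wsq L (vecBlock m S.Θ) q = 0 :=
    fun q hq h => Finset.sum_eq_zero fun i _ => by
      rw [show wd L (fun q => vecBlock m S.Θ q i) q = 0 from hρ L ⟨m, i⟩ q hq h]; norm_num
  have hE : Ext (region (Ioo t₀ t₁) O) (wsq L (vecBlock m S.Θ)) := by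
    refine Ext.sum _ fun i _ => ?_
    simp only [sq]
    have := hS.Θ_regular.ext_wd D.isOpen_region ⟨m, i⟩ (L := L) (by omega)
    exact this.mul this
  obtain ⟨C, -, hC⟩ := exists_bound_of_ext hE hz
  exact integrableOn_slice D (continuousOn_wsq D.isOpen_region L fun i =>
    (hS.contDiffOn_vecBlock m i).of_le (by norm_cast; omega)) hC hz hτ

theorem SliceDomain.closure_region_subset_negTime (D : SliceDomain t₀ t₁ b O φ Y) :
    closure (region (Ioo t₀ t₁) O) ⊆ {q : Spacetime | q 0 < 0} := by
  have h1 : closure (region (Ioo t₀ t₁) O) ⊆ {q : Spacetime | q 0 ≤ t₁} :=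
    closure_minimal (fun q hq => le_of_lt hq.1.2)
      (isClosed_le (continuous_apply 0) continuous_const)
  intro q hq
  have h2 : q 0 ≤ t₁ := h1 hq
  have h3 := D.le_neg_one
  exact (by linarith : q 0 < 0)

/-- The components of the boundary conormal have a sign on the quadratic forms `M^μ`. -/
def SystemData.LateralSign (S : SystemData P) (t₀ t₁ b : ℝ) (O : ℝ → Set Space)
    (φ : Spacetime → ℝ) : Prop :=
  ∀ q ∈ closure (region (Ioo t₀ t₁) O), q 0 ∈ Ioo t₀ t₁ → q 3 ∈ Ioo 0 b → φ q = 0 →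
    ∀ v : Idx P → ℝ, ∑ μ, pd μ φ q * (v ⬝ᵥ ((Matrix.of fun a a' =>
      extendFrom (region (Ioo t₀ t₁) O) (fun q' => S.M μ q' a a') q) *ᵥ v)) ≤ 0

/-- The divergence inequality for the current `w v·M^μ v`. The weight may depend on space, but it is
compared on each slice with a function `W` of time, losing the factor `ε`; the bounds `1/2 ≤ M⁰ ≤ 2`
compare the current with the energy. -/
theorem SystemData.IsAdmissible.energy_inequality (hS : S.IsAdmissible R t₀ t₁ O)
    (D : SliceDomain t₀ t₁ b O φ Y) (hlat : S.LateralSign t₀ t₁ b O φ) {L : List (Fin 4)}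
    (hL : L.length ≤ R) (m : Fin 3) {w : Spacetime → ℝ} {W : ℝ → ℝ} {ε : ℝ}
    (hw : ContDiffOn ℝ 1 w {q : Spacetime | q 0 < 0}) (hw0 : ∀ q, q 0 < 0 → 0 ≤ w q)
    (hW : ∀ τ, 0 ≤ W τ)
    (hwM : ∀ q ∈ region (Ioo t₀ t₁) O, ∑ μ, pd μ w q * S.form L m μ q ≤ 0)
    (hwl : ∀ q ∈ region (Ioo t₀ t₁) O, ε * W (q 0) ≤ w q)
    (hwu : ∀ q ∈ region (Ioo t₀ t₁) O, w q ≤ W (q 0)) {B : ℝ → ℝ≥0∞} {cM l : ℝ → ℝ}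
    (hcM : ∀ τ, 0 ≤ cM τ) (hl : ∀ τ ∈ Ioo t₀ t₁, 0 < l τ)
    (hsmall : ∀ τ ∈ Ioo t₀ t₁, ∀ μ,
      CoeffBound (region (Ioo t₀ t₁) O) (O τ) R (max 1 R) (S.δM μ) τ (cM τ))
    (hF : S.Forced t₀ t₁ O L m B) (hB : ∀ τ ∈ Ioo t₀ t₁, B τ ≠ ∞) {s t : ℝ} (hs : t₀ < s)
    (hst : s ≤ t) (ht : t < t₁) {β : ℝ → ℝ} (hβi : IntervalIntegrable β volume s t)
    (hβ : ∀ τ ∈ Ioc s t, W τ * ((16000 * cM τ + l τ) * S.wordEnergy O L m τ +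
      (l τ)⁻¹ * (B τ).toReal) ≤ β τ) :
    ε * W t * (1 / 2 * S.wordEnergy O L m t) ≤
      W s * (2 * S.wordEnergy O L m s) + ∫ τ in s..t, β τ := by
  set U := region (Ioo t₀ t₁) O with hUdef
  have hU : IsOpen U := D.isOpen_region
  have hneg := D.region_subset_negTime
  have hcneg := D.closure_region_subset_negTime
  obtain ⟨ρ, hρ⟩ := hS.exists_wd_far D
  set v : Fin (P m) → Spacetime → ℝ := fun i => wd L fun q => S.Θ q ⟨m, i⟩ with hvdef
  have hv1 : ∀ i, ContDiffOn ℝ 1 (v i) U := fun i => wd_contDiffOn hU L (n := 1)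
    ((hS.Θ_regular ⟨m, i⟩).1.of_le (by norm_cast; omega))
  have hvE : ∀ i, Ext U (v i) := fun i =>
    hS.Θ_regular.ext_wd hU ⟨m, i⟩ (L := L) (by omega)
  have hdvE : ∀ μ i, Ext U (pd μ (v i)) := fun μ i =>
    hS.Θ_regular.ext_wd hU ⟨m, i⟩ (L := μ :: L) (by simpa using hL)
  have hM1 : ∀ μ i k, ContDiffOn ℝ 1 (fun q => S.M μ q ⟨m, i⟩ ⟨m, k⟩) U := fun μ i k =>
    (hS.M_regular μ (⟨m, i⟩, ⟨m, k⟩)).1.of_le (by norm_cast; omega)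
  have hME : ∀ μ i k, Ext U (fun q => S.M μ q ⟨m, i⟩ ⟨m, k⟩) := fun μ i k =>
    (hS.M_regular μ).ext_wd hU (⟨m, i⟩, ⟨m, k⟩) (L := []) (by simp)
  have hdME : ∀ μ i k, Ext U (pd μ (fun q => S.M μ q ⟨m, i⟩ ⟨m, k⟩)) := fun μ i k =>
    (hS.M_regular μ).ext_wd hU (⟨m, i⟩, ⟨m, k⟩) (L := [μ]) (by simp)
  have hwE : Ext U w := ⟨w, hw.continuousOn.mono hcneg, fun _ _ => rfl⟩
  have hdwE : ∀ μ, Ext U (pd μ w) := fun μ =>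
    ⟨pd μ w, ((pd_contDiffOn isOpen_negTime (n := 0) (by exact_mod_cast hw) μ).continuousOn).mono
      hcneg, fun _ _ => rfl⟩
  have hwd : ∀ q ∈ U, DifferentiableAt ℝ w q := fun q hq =>
    differentiableAt_of_contDiffOn isOpen_negTime (n := 1) hw one_ne_zero (hneg hq)
  set j : Fin 4 → Spacetime → ℝ := fun μ q => w q * S.form L m μ q with hjdef
  have hj1 : ∀ μ, ContDiffOn ℝ 1 (j μ) U := fun μ => (hw.mono hneg).mul
    (ContDiffOn.sum fun i _ => ContDiffOn.sum fun k _ => ((hv1 i).mul (hM1 μ i k)).mul (hv1 k))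
  set je : Fin 4 → Spacetime → ℝ := fun μ q => w q * ∑ i, ∑ k, extendFrom U (v i) q *
    extendFrom U (fun q => S.M μ q ⟨m, i⟩ ⟨m, k⟩) q * extendFrom U (v k) q with hjedef
  have hje : ∀ μ, ContinuousOn (je μ) (closure U) := fun μ =>
    (hw.continuousOn.mono hcneg).mul (continuousOn_finsetSum _ fun i _ =>
      continuousOn_finsetSum _ fun k _ => ((hvE i).extendFrom.1.mul
        (hME μ i k).extendFrom.1).mul (hvE k).extendFrom.1)
  have hjeq : ∀ μ, EqOn (je μ) (j μ) U := fun μ q hq => by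
    simp only [hjedef, hjdef, SystemData.form]
    congr 1
    refine Finset.sum_congr rfl fun i _ => Finset.sum_congr rfl fun k _ => ?_
    rw [(hvE i).extendFrom.2 hq, (hvE k).extendFrom.2 hq, (hME μ i k).extendFrom.2 hq]
  have hform0 : ∀ q, (∀ i, v i q = 0) → ∀ μ, j μ q = 0 := fun q h μ => by
    simp only [hjdef, SystemData.form]
    rw [Finset.sum_eq_zero fun i _ => Finset.sum_eq_zero fun k _ => ?_, mul_zero]
    rw [show wd L (fun q => S.Θ q ⟨m, i⟩) q = 0 from h i]; ring
  have hjρ : ∀ μ, ∀ q ∈ U, ρ < ‖sp q‖ → j μ q = 0 := fun μ q hq h =>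
    hform0 q (fun i => hρ L ⟨m, i⟩ q hq h) μ
  have hpdj : ∀ μ, ∀ q ∈ U, pd μ (j μ) q = pd μ w q * (∑ i, ∑ k, v i q *
      S.M μ q ⟨m, i⟩ ⟨m, k⟩ * v k q) + w q * (∑ i, ∑ k, v i q *
        pd μ (fun q => S.M μ q ⟨m, i⟩ ⟨m, k⟩) q * v k q + 2 * ∑ i, v i q *
          ∑ k, S.M μ q ⟨m, i⟩ ⟨m, k⟩ * pd μ (v k) q) := fun μ q hq =>
    pd_current (v := v) (N := fun i k q => S.M μ q ⟨m, i⟩ ⟨m, k⟩) (hwd q hq)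
      (fun i => differentiableAt_of_contDiffOn hU (n := 1) (hv1 i) one_ne_zero hq)
      (fun i k => differentiableAt_of_contDiffOn hU (n := 1) (hM1 μ i k) one_ne_zero hq)
      (fun i k => (hS.M_symm μ q hq).apply _ _) μ
  -- Boundedness of the divergence needs derivatives of the field of order `R + 1` up to the
  -- closure; this is only qualitative, and no bound on them enters the estimate.
  have hdivE : Ext U fun q => ∑ μ, pd μ (j μ) q := by
    refine Ext.sum _ fun μ _ => Ext.congr ?_ fun q hq => (hpdj μ q hq).symm
    exact ((hdwE μ).mul (Ext.sum _ fun i _ => Ext.sum _ fun k _ =>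
      ((hvE i).mul (hME μ i k)).mul (hvE k))).add (hwE.mul ((Ext.sum _ fun i _ =>
        Ext.sum _ fun k _ => ((hvE i).mul (hdME μ i k)).mul (hvE k)).add ((Ext.const 2).mul
          (Ext.sum _ fun i _ => (hvE i).mul (Ext.sum _ fun k _ => (hME μ i k).mul (hdvE μ k))))))
  have hdivρ : ∀ q ∈ U, ρ < ‖sp q‖ → ∑ μ, pd μ (j μ) q = 0 := fun q hq h =>
    Finset.sum_eq_zero fun μ _ => wd_eq_zero_of_isOpen (hU.inter
      (isOpen_lt continuous_const continuous_sp.norm : IsOpen {q | ρ < ‖sp q‖}))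
      (fun y hy => hjρ μ y hy.1 hy.2) [μ] ⟨hq, h⟩
  have hdivc : ContinuousOn (fun q => ∑ μ, pd μ (j μ) q) U := continuousOn_finsetSum _ fun μ _ =>
    (pd_contDiffOn hU (n := 0) (by exact_mod_cast hj1 μ) μ).continuousOn
  obtain ⟨C, -, hC⟩ := exists_bound_of_ext hdivE hdivρ
  obtain ⟨G, hG, hGB⟩ := hF
  have key := D.divergence_le hj1 hje hjeq hjρ
    (fun μ q hq h => hform0 q (fun i => hS.wd_low D L _ hq h) μ)
    (fun q hq => mul_nonneg (hw0 q (hneg hq)) (hS.form_three_nonneg L m hq))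
    -- The boundary condition concerns the whole matrix; testing it with a vector supported in block
    -- `m` gives the sign for the block current.
    (fun q hq h0 h3 hφ => by
      have h := hlat q hq h0 h3 hφ (blockVec m fun i => extendFrom U (v i) q)
      simp only [blockVec_quadratic, Matrix.of_apply] at h
      simp only [hjedef, mul_left_comm (pd _ φ q), ← Finset.mul_sum (a := w q)]
      exact mul_nonpos_of_nonneg_of_nonpos (hw0 q (hcneg hq)) h) hC hs hst ht hβi
    (fun τ hτst => by
      have hτ : τ ∈ Ioo t₀ t₁ := ⟨hs.trans hτst.1, hτst.2.trans_lt ht⟩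
      have hm := (D.isOpen_slice hτ).measurableSet
      have hmem : ∀ x ∈ O τ, pt τ x ∈ U := fun x hx => ⟨hτ, hx⟩
      refine le_trans ?_ (hβ τ hτst)
      have hGc : AEStronglyMeasurable (fun x => ∑ i, G (pt τ x) i ^ 2) (volume.restrict (O τ)) :=
        ((continuousOn_finsetSum _ fun i _ => ((hGB τ hτ).1 i).pow 2).comp
          (continuous_pt_right τ).continuousOn hmem).aestronglyMeasurable hm
      have hG0 : ∀ x, 0 ≤ ∑ i, G (pt τ x) i ^ 2 := fun x => Finset.sum_nonneg fun _ _ => sq_nonneg _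
      have hGfin : ∫⁻ x in O τ, ENNReal.ofReal (∑ i, G (pt τ x) i ^ 2) ≠ ∞ :=
        ne_top_of_le_ne_top (hB τ hτ) (hGB τ hτ).2
      have hGi : IntegrableOn (fun x => ∑ i, G (pt τ x) i ^ 2) (O τ) :=
        ⟨hGc, (hasFiniteIntegral_iff_ofReal (Filter.Eventually.of_forall hG0)).2 hGfin.lt_top⟩
      have hGint : ∫ x in O τ, ∑ i, G (pt τ x) i ^ 2 ≤ (B τ).toReal := by
        rw [integral_eq_lintegral_of_nonneg_ae (Filter.Eventually.of_forall hG0) hGc]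
        exact ENNReal.toReal_mono (hB τ hτ) (hGB τ hτ).2
      have hvi := hS.integrableOn_wsq D hL m hτ
      calc _ ≤ ∫ x in O τ, W τ * ((16000 * cM τ + l τ) * wsq L (vecBlock m S.Θ) (pt τ x) +
            (l τ)⁻¹ * ∑ i, G (pt τ x) i ^ 2) := by
            refine setIntegral_mono_on (integrableOn_slice D hdivc hC hdivρ hτ)
              (((hvi.const_mul _).add (hGi.const_mul _)).const_mul _) hm fun x hx => ?_
            refine (hS.divergence_current_le D hL m hτ (hcM τ) (hl τ hτ) (hsmall τ hτ) hx
              (hwd _ (hmem x hx)) (hw0 _ (hneg (hmem x hx))) (hwM _ (hmem x hx))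
              (hG _ (hmem x hx))).trans ?_
            refine mul_le_mul_of_nonneg_right (hwu _ (hmem x hx)) ?_
            have := hl τ hτ
            have := hcM τ
            have := wsq_nonneg L (vecBlock m S.Θ) (pt τ x)
            have := hG0 x
            positivity
        _ = W τ * ((16000 * cM τ + l τ) * S.wordEnergy O L m τ +
            (l τ)⁻¹ * ∫ x in O τ, ∑ i, G (pt τ x) i ^ 2) := by
            rw [integral_const_mul, integral_add (hvi.const_mul _) (hGi.const_mul _),
              integral_const_mul, integral_const_mul]
            rfl
        _ ≤ _ := by
            have h1 : 0 ≤ (l τ)⁻¹ := inv_nonneg.2 (hl τ hτ).le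
            exact mul_le_mul_of_nonneg_left (add_le_add le_rfl
              (mul_le_mul_of_nonneg_left hGint h1)) (hW τ))
  obtain ⟨C0, -, hC0⟩ := exists_bound_of_ext ⟨je 0, hje 0, hjeq 0⟩ (hjρ 0)
  have hji : ∀ τ ∈ Ioo t₀ t₁, IntegrableOn (fun x => j 0 (pt τ x)) (O τ) := fun τ hτ =>
    integrableOn_slice D (hj1 0).continuousOn hC0 (hjρ 0) hτ
  have hsm : s ∈ Ioo t₀ t₁ := ⟨hs, hst.trans_lt ht⟩
  have htm : t ∈ Ioo t₀ t₁ := ⟨hs.trans_le hst, ht⟩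
  have hlow : ε * W t * (1 / 2 * S.wordEnergy O L m t) ≤ ∫ x in O t, j 0 (pt t x) := by
    rw [SystemData.wordEnergy, ← integral_const_mul, ← integral_const_mul]
    refine setIntegral_mono_on (((hS.integrableOn_wsq D hL m htm).const_mul _).const_mul _)
      (hji t htm) (D.isOpen_slice htm).measurableSet fun x hx => ?_
    have hq : pt t x ∈ U := ⟨htm, hx⟩
    exact mul_le_mul (hwl _ hq) (hS.form_zero_ge L m hq)
      (mul_nonneg (by norm_num) (wsq_nonneg _ _ _)) (hw0 _ (hneg hq))
  have hup : ∫ x in O s, j 0 (pt s x) ≤ W s * (2 * S.wordEnergy O L m s) := by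
    rw [SystemData.wordEnergy, ← integral_const_mul, ← integral_const_mul]
    refine setIntegral_mono_on (hji s hsm)
      (((hS.integrableOn_wsq D hL m hsm).const_mul _).const_mul _)
      (D.isOpen_slice hsm).measurableSet fun x hx => ?_
    have hq : pt s x ∈ U := ⟨hsm, hx⟩
    exact mul_le_mul (hwu _ hq) (hS.form_zero_le L m hq)
      (le_trans (mul_nonneg (by norm_num) (wsq_nonneg _ _ _)) (hS.form_zero_ge L m hq)) (hW s)
  linarith

end

/-! ### Finiteness and continuity of the energy -/

section

variable {P : Fin 3 → ℕ} {t₀ t₁ b : ℝ} {O : ℝ → Set Space} {φ : Spacetime → ℝ}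
  {Y : Fin 4 → Spacetime → ℝ} {S : SystemData P} {R : ℕ}

/-- The energy of the block `m` of the field as a real number. -/
def SystemData.blockEnergy (S : SystemData P) (R : ℕ) (O : ℝ → Set Space) (m : Fin 3)
    (τ : ℝ) : ℝ := ∑ α ∈ multiIndices R, S.wordEnergy O (word α) m τ

theorem SystemData.wordEnergy_nonneg (S : SystemData P) (O : ℝ → Set Space) (L : List (Fin 4))
    (m : Fin 3) (τ : ℝ) : 0 ≤ S.wordEnergy O L m τ :=
  integral_nonneg fun _ => wsq_nonneg _ _ _

theorem SystemData.blockEnergy_nonneg (S : SystemData P) (R : ℕ) (O : ℝ → Set Space) (m : Fin 3)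
    (τ : ℝ) : 0 ≤ S.blockEnergy R O m τ := Finset.sum_nonneg fun _ _ => S.wordEnergy_nonneg _ _ _ _

theorem SystemData.wordEnergy_le_blockEnergy (S : SystemData P) (O : ℝ → Set Space)
    {α : Fin 4 → ℕ} (hα : α ∈ multiIndices R) (m : Fin 3) (τ : ℝ) :
    S.wordEnergy O (word α) m τ ≤ S.blockEnergy R O m τ :=
  Finset.single_le_sum (f := fun α => S.wordEnergy O (word α) m τ)
    (fun _ _ => S.wordEnergy_nonneg _ _ _ _) hα

theorem length_word_le {α : Fin 4 → ℕ} (hα : α ∈ multiIndices R) : (word α).length ≤ R := by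
  rw [length_word]; exact sum_le_of_mem_multiIndices hα

theorem SystemData.IsAdmissible.energy_vecBlock_eq (hS : S.IsAdmissible R t₀ t₁ O)
    (D : SliceDomain t₀ t₁ b O φ Y) (m : Fin 3) {τ : ℝ} (hτ : τ ∈ Ioo t₀ t₁) :
    energy (region (Ioo t₀ t₁) O) (O τ) R (vecBlock m S.Θ) τ =
      ENNReal.ofReal (S.blockEnergy R O m τ) := by
  rw [energy, SystemData.blockEnergy,
    ENNReal.ofReal_sum_of_nonneg fun _ _ => S.wordEnergy_nonneg _ _ _ _]
  refine Finset.sum_congr rfl fun α hα => ?_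
  rw [SystemData.wordEnergy, ofReal_integral_eq_lintegral_ofReal
    (hS.integrableOn_wsq D (length_word_le hα) m hτ)
    (Filter.Eventually.of_forall fun _ => wsq_nonneg _ _ _)]
  refine setLIntegral_congr_fun (D.isOpen_slice hτ).measurableSet fun x hx => ?_
  rw [derivNormSq_eq D.isOpen_region (fun i => (hS.contDiffOn_vecBlock m i).of_le (by
    norm_cast; omega)) hα ⟨hτ, hx⟩]
  rfl

theorem SystemData.IsAdmissible.fieldEnergy_eq (hS : S.IsAdmissible R t₀ t₁ O)
    (D : SliceDomain t₀ t₁ b O φ Y) {τ : ℝ} (hτ : τ ∈ Ioo t₀ t₁) :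
    S.fieldEnergy R t₀ t₁ O τ = ENNReal.ofReal (∑ m, S.blockEnergy R O m τ) := by
  simp only [SystemData.fieldEnergy, energy, SystemData.blockEnergy]
  rw [Finset.sum_comm, ENNReal.ofReal_sum_of_nonneg fun _ _ => Finset.sum_nonneg fun _ _ =>
    S.wordEnergy_nonneg _ _ _ _]
  refine Finset.sum_congr rfl fun α hα => ?_
  have hi := fun m => hS.integrableOn_wsq D (length_word_le hα) m hτ
  simp only [SystemData.wordEnergy]
  rw [← integral_finsetSum _ fun m _ => hi m, ofReal_integral_eq_lintegral_ofReal
    (integrable_finsetSum _ fun m _ => hi m) (Filter.Eventually.of_forall fun _ =>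
      Finset.sum_nonneg fun _ _ => wsq_nonneg _ _ _)]
  refine setLIntegral_congr_fun (D.isOpen_slice hτ).measurableSet fun x hx => ?_
  rw [derivNormSq_eq D.isOpen_region (fun a => ((hS.Θ_regular a).1).of_le (by
    norm_cast; omega)) hα ⟨hτ, hx⟩, Fintype.sum_sigma]
  rfl

theorem SystemData.IsAdmissible.continuousOn_derivNormSq (hS : S.IsAdmissible R t₀ t₁ O)
    {α : Fin 4 → ℕ} (hα : α ∈ multiIndices R) :
    ContinuousOn (derivNormSq (region (Ioo t₀ t₁) O) S.Θ α) (closure (region (Ioo t₀ t₁) O)) :=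
  continuousOn_finsetSum _ fun a _ =>
    (Ext.extendFrom ((hS.Θ_regular.mono (Nat.le_succ R) a).2 α hα)).1.pow 2

theorem SystemData.IsAdmissible.exists_derivNormSq_bound (hS : S.IsAdmissible R t₀ t₁ O)
    (D : SliceDomain t₀ t₁ b O φ Y) {α : Fin 4 → ℕ} (hα : α ∈ multiIndices R) :
    ∃ C ρ : ℝ, ∀ t ∈ Ioo t₀ t₁, ∀ x, (O t).indicator (fun x =>
      ENNReal.ofReal (derivNormSq (region (Ioo t₀ t₁) O) S.Θ α (pt t x))) x ≤
        (Metric.closedBall (0 : Space) ρ).indicator (fun _ => ENNReal.ofReal C) x := by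
  obtain ⟨ρ, hρ⟩ := hS.exists_wd_far D
  have hz : ∀ q ∈ region (Ioo t₀ t₁) O, ρ < ‖sp q‖ →
      derivNormSq (region (Ioo t₀ t₁) O) S.Θ α q = 0 := fun q hq h => by
    rw [derivNormSq_eq D.isOpen_region (fun a => ((hS.Θ_regular a).1).of_le (by
      norm_cast; omega)) hα hq]
    exact Finset.sum_eq_zero fun a _ => by rw [hρ (word α) a q hq h]; norm_num
  obtain ⟨C, -, hC⟩ := exists_bound_of_ext
    ⟨_, hS.continuousOn_derivNormSq hα, fun _ _ => rfl⟩ hz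
  refine ⟨C, ρ, fun t ht x => ?_⟩
  by_cases hx : x ∈ O t
  · have hq : pt t x ∈ region (Ioo t₀ t₁) O := ⟨ht, hx⟩
    rw [indicator_of_mem hx]
    by_cases h : x ∈ Metric.closedBall (0 : Space) ρ
    · rw [indicator_of_mem h]
      exact ENNReal.ofReal_le_ofReal ((le_abs_self _).trans (hC _ hq))
    · rw [hz _ hq (by rw [sp_pt]; simpa using h)]
      simp
  · rw [indicator_of_notMem hx]
    exact zero_le

theorem SystemData.IsAdmissible.exists_fieldEnergy_le (hS : S.IsAdmissible R t₀ t₁ O)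
    (D : SliceDomain t₀ t₁ b O φ Y) :
    ∃ C : ℝ≥0∞, C < ∞ ∧ ∀ t ∈ Ioo t₀ t₁, S.fieldEnergy R t₀ t₁ O t ≤ C := by
  choose! C ρ h using fun (α : Fin 4 → ℕ) (hα : α ∈ multiIndices R) =>
    hS.exists_derivNormSq_bound D hα
  refine ⟨∑ α ∈ multiIndices R, ENNReal.ofReal (C α) * volume (Metric.closedBall (0 : Space) (ρ α)),
    ENNReal.sum_lt_top.2 fun α _ => ENNReal.mul_lt_top ENNReal.ofReal_lt_top
      measure_closedBall_lt_top, fun t ht => Finset.sum_le_sum fun α hα => ?_⟩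
  rw [← lintegral_indicator (D.isOpen_slice ht).measurableSet,
    ← lintegral_indicator_const measurableSet_closedBall]
  exact lintegral_mono fun x => h α hα t ht x

theorem SliceDomain.mem_slice_eventually (D : SliceDomain t₀ t₁ b O φ Y) {x : Space}
    (hx : x ∈ O t₀) : ∀ᶠ s in nhdsWithin t₀ (Ioo t₀ t₁), x ∈ O s := by
  obtain ⟨h1, h2⟩ := (D.mem_iff t₀ D.lt.le x).1 hx
  have hc : ContinuousAt (fun s => φ (pt s x)) t₀ :=
    (D.contDiffAt (q := pt t₀ x) D.lt h1.1).continuousAt.comp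
      (f := fun s => pt s x) (continuous_pt.comp (Continuous.prodMk_left x)).continuousAt
  have h3 : ∀ᶠ s in nhds t₀, 0 < φ (pt s x) := hc.eventually (lt_mem_nhds h2)
  filter_upwards [h3.filter_mono nhdsWithin_le_nhds, self_mem_nhdsWithin] with s hs hst
  exact (D.mem_iff s hst.2.le x).2 ⟨h1, hs⟩

theorem SliceDomain.isOpen_initial_slice (D : SliceDomain t₀ t₁ b O φ Y) : IsOpen (O t₀) := by
  have hV : IsOpen {x : Space | x 2 ∈ Ioo 0 b} := isOpen_Ioo.preimage (continuous_apply 2)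
  have hc : ContinuousOn (fun x => φ (pt t₀ x)) {x : Space | x 2 ∈ Ioo 0 b} := fun x hx =>
    ((D.contDiffAt (q := pt t₀ x) D.lt hx.1).continuousAt.comp
      (f := fun x => pt t₀ x) (continuous_pt_right t₀).continuousAt).continuousWithinAt
  convert hc.isOpen_inter_preimage hV isOpen_Ioi (t := Ioi 0) using 1
  ext x
  exact D.mem_iff t₀ D.lt.le x

/-- The slices increase towards the initial time and exhaust the initial slice, so dominated
convergence on the initial slice applies, with the extended derivatives as limits. This transfers
estimates from interior times `s > t₀` to the initial data. -/
theorem SystemData.IsAdmissible.tendsto_fieldEnergy (hS : S.IsAdmissible R t₀ t₁ O)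
    (D : SliceDomain t₀ t₁ b O φ Y) :
    Filter.Tendsto (S.fieldEnergy R t₀ t₁ O) (nhdsWithin t₀ (Ioo t₀ t₁))
      (nhds (S.fieldEnergy R t₀ t₁ O t₀)) := by
  refine tendsto_finsetSum _ fun α hα => ?_
  set U := region (Ioo t₀ t₁) O with hUdef
  obtain ⟨C, ρ, h⟩ := hS.exists_derivNormSq_bound D hα
  have hc := hS.continuousOn_derivNormSq hα
  set F : ℝ → Space → ℝ≥0∞ := fun s => (O s).indicator fun x =>
    ENNReal.ofReal (derivNormSq U S.Θ α (pt s x)) with hF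
  have key : Filter.Tendsto (fun s => ∫⁻ x in O t₀, F s x) (nhdsWithin t₀ (Ioo t₀ t₁))
      (nhds (∫⁻ x in O t₀, ENNReal.ofReal (derivNormSq U S.Θ α (pt t₀ x)))) := by
    refine tendsto_lintegral_filter_of_dominated_convergence
      ((Metric.closedBall (0 : Space) ρ).indicator fun _ => ENNReal.ofReal C) ?_ ?_ ?_ ?_
    · filter_upwards [self_mem_nhdsWithin] with s hs
      classical
      rw [hF]
      simp only
      rw [← piecewise_eq_indicator]
      refine ContinuousOn.measurable_piecewise ?_ continuousOn_const (D.isOpen_slice hs).measurableSet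
      exact ENNReal.continuous_ofReal.comp_continuousOn (hc.comp (continuous_pt_right s).continuousOn
        fun x hx => subset_closure ⟨hs, hx⟩)
    · filter_upwards [self_mem_nhdsWithin] with s hs
      exact Filter.Eventually.of_forall (h s hs)
    · refine ne_of_lt ((setLIntegral_le_lintegral _ _).trans_lt ?_)
      rw [lintegral_indicator_const measurableSet_closedBall]
      exact ENNReal.mul_lt_top ENNReal.ofReal_lt_top measure_closedBall_lt_top
    · refine ae_restrict_of_forall_mem D.isOpen_initial_slice.measurableSet fun x hx => ?_
      have hU : ∀ᶠ s in nhdsWithin t₀ (Ioo t₀ t₁), pt s x ∈ U := by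
        filter_upwards [D.mem_slice_eventually hx, self_mem_nhdsWithin] with s hs hst
        exact ⟨hst, hs⟩
      have hpt : Filter.Tendsto (fun s => pt s x) (nhdsWithin t₀ (Ioo t₀ t₁)) (nhds (pt t₀ x)) :=
        (continuous_pt.comp (Continuous.prodMk_left x)).continuousAt.mono_left nhdsWithin_le_nhds
      have : (nhdsWithin t₀ (Ioo t₀ t₁)).NeBot := by
        rw [nhdsWithin_Ioo_eq_nhdsGT D.lt]; infer_instance
      have hcl : pt t₀ x ∈ closure U := mem_closure_of_tendsto hpt hU
      have h1 : Filter.Tendsto (fun s => derivNormSq U S.Θ α (pt s x))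
          (nhdsWithin t₀ (Ioo t₀ t₁)) (nhds (derivNormSq U S.Θ α (pt t₀ x))) :=
        (hc _ hcl).tendsto.comp (tendsto_nhdsWithin_iff.2
          ⟨hpt, hU.mono fun s hs => subset_closure hs⟩)
      refine ((ENNReal.continuous_ofReal.tendsto _).comp h1).congr' ?_
      filter_upwards [D.mem_slice_eventually hx] with s hs
      rw [hF]
      simp only [Function.comp]
      rw [indicator_of_mem hs]
  refine key.congr' ?_
  filter_upwards [self_mem_nhdsWithin] with s hs
  rw [hF]
  simp only
  -- Monotonicity of the slices: integrating over `O s` is the same as integrating the indicator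
  -- over `O t₀`.
  rw [setLIntegral_indicator (D.isOpen_slice hs).measurableSet,
    inter_eq_left.2 (D.anti t₀ s hs.1.le hs.2.le)]

theorem SystemData.IsAdmissible.fieldEnergy_initial_lt_top (hS : S.IsAdmissible R t₀ t₁ O)
    (D : SliceDomain t₀ t₁ b O φ Y) : S.fieldEnergy R t₀ t₁ O t₀ < ∞ := by
  obtain ⟨C, hC, h⟩ := hS.exists_fieldEnergy_le D
  have : (nhdsWithin t₀ (Ioo t₀ t₁)).NeBot := by
    rw [nhdsWithin_Ioo_eq_nhdsGT D.lt]; infer_instance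
  refine (le_of_tendsto (hS.tendsto_fieldEnergy D) ?_).trans_lt hC
  filter_upwards [self_mem_nhdsWithin] with s hs using h s hs

theorem SystemData.IsAdmissible.exists_blockEnergy_le (hS : S.IsAdmissible R t₀ t₁ O)
    (D : SliceDomain t₀ t₁ b O φ Y) :
    ∃ C : ℝ, ∀ m, ∀ t ∈ Ioo t₀ t₁, S.blockEnergy R O m t ≤ C := by
  obtain ⟨C, hC, h⟩ := hS.exists_fieldEnergy_le D
  refine ⟨C.toReal, fun m t ht => ?_⟩
  have h1 := ENNReal.toReal_mono hC.ne (h t ht)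
  rw [hS.fieldEnergy_eq D ht, ENNReal.toReal_ofReal
    (Finset.sum_nonneg fun _ _ => S.blockEnergy_nonneg _ _ _ _)] at h1
  exact (Finset.single_le_sum (f := fun m => S.blockEnergy R O m t)
    (fun _ _ => S.blockEnergy_nonneg _ _ _ _) (Finset.mem_univ m)).trans h1

/-- A bound in terms of the energy at all early times extends to the initial time. -/
theorem SystemData.IsAdmissible.le_of_forall_early (hS : S.IsAdmissible R t₀ t₁ O)
    (D : SliceDomain t₀ t₁ b O φ Y) {t p y K : ℝ} (ht : t ∈ Ioo t₀ t₁) (m : Fin 3)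
    (h : ∀ s ∈ Ioc t₀ t, y ≤ 2 * (|s| ^ p * S.blockEnergy R O m s) + K) :
    y ≤ 2 * (|t₀| ^ p * (S.fieldEnergy R t₀ t₁ O t₀).toReal) + K := by
  have : (nhdsWithin t₀ (Ioo t₀ t₁)).NeBot := by
    rw [nhdsWithin_Ioo_eq_nhdsGT D.lt]; infer_instance
  have h1 := (ENNReal.tendsto_toReal (hS.fieldEnergy_initial_lt_top D).ne).comp
    (hS.tendsto_fieldEnergy D)
  have ht0 : t₀ ≠ 0 := by have := D.lt; have := D.le_neg_one; linarith
  have h2 : Filter.Tendsto (fun s : ℝ => |s| ^ p) (nhdsWithin t₀ (Ioo t₀ t₁)) (nhds (|t₀| ^ p)) :=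
    (continuous_abs.continuousAt.rpow_const (Or.inl (abs_ne_zero.2 ht0))).mono_left
      nhdsWithin_le_nhds
  refine ge_of_tendsto (((h2.mul h1).const_mul 2).add_const K) ?_
  have h3 : ∀ᶠ s in nhdsWithin t₀ (Ioo t₀ t₁), s ≤ t :=
    (Iic_mem_nhds ht.1 : Iic t ∈ nhds t₀) |> fun h => mem_nhdsWithin_of_mem_nhds h
  filter_upwards [self_mem_nhdsWithin, h3] with s hs hst
  refine (h s ⟨hs.1, hst⟩).trans ?_
  simp only [Function.comp]
  rw [hS.fieldEnergy_eq D hs, ENNReal.toReal_ofReal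
    (Finset.sum_nonneg fun _ _ => S.blockEnergy_nonneg _ _ _ _)]
  gcongr
  exact Finset.single_le_sum (f := fun m => S.blockEnergy R O m s)
    (fun _ _ => S.blockEnergy_nonneg _ _ _ _) (Finset.mem_univ m)

end

/-! ### The weighted energy inequalities -/

section

variable {P : Fin 3 → ℕ} {t₀ t₁ b : ℝ} {O : ℝ → Set Space} {φ : Spacetime → ℝ}
  {Y : Fin 4 → Spacetime → ℝ} {S : SystemData P} {R : ℕ}

theorem integral_rpow_neg_le {p K s t : ℝ} (hp : 0 < p) (hK : 0 ≤ K) (hst : s ≤ t) (ht : t < 0) :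
    IntervalIntegrable (fun τ => K * (|τ| ^ (-p) * |τ|⁻¹)) volume s t ∧
      ∫ τ in s..t, K * (|τ| ^ (-p) * |τ|⁻¹) ≤ K / p * |t| ^ (-p) := by
  have hne : ∀ τ ∈ uIcc s t, τ < 0 := fun τ hτ => by
    rw [uIcc_of_le hst] at hτ; linarith [hτ.2]
  have hc : ContinuousOn (fun τ : ℝ => K * (|τ| ^ (-p) * |τ|⁻¹)) (uIcc s t) := fun τ hτ => by
    have h0 : |τ| ≠ 0 := abs_ne_zero.2 (hne τ hτ).ne
    exact (continuousAt_const.mul ((continuous_abs.continuousAt.rpow_const (Or.inl h0)).mul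
      (continuous_abs.continuousAt.inv₀ h0))).continuousWithinAt
  have hi : IntervalIntegrable _ volume s t := hc.intervalIntegrable
  refine ⟨hi, ?_⟩
  have hd : ∀ τ ∈ uIcc s t, HasDerivAt (fun τ => K / p * (-τ) ^ (-p))
      (K * (|τ| ^ (-p) * |τ|⁻¹)) τ := fun τ hτ => by
    have h0 := hne τ hτ
    have h1 := ((hasDerivAt_neg τ).rpow_const (p := -p) (Or.inl (by linarith))).const_mul (K / p)
    refine h1.congr_deriv ?_
    rw [abs_of_neg h0, Real.rpow_sub_one (by linarith)]
    have h2 : -τ ≠ 0 := by linarith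
    field_simp
  rw [intervalIntegral.integral_eq_sub_of_hasDerivAt hd hi, abs_of_neg ht]
  have : 0 ≤ K / p * (-s) ^ (-p) := mul_nonneg (div_nonneg hK hp.le)
    (Real.rpow_nonneg (by linarith) _)
  linarith

/-- For blocks whose errors carry a factor `|τ|⁻¹` in amplitude. Young's parameter is `l |τ|⁻¹`, so
a squared forcing of size `|τ|⁻²` also contributes only `|τ|⁻¹`. The energy on the right is replaced
by its bound `A |τ|^(-2J)`, which leaves a constant multiple of `A` to be absorbed later. -/
theorem SystemData.IsAdmissible.word_decay (hS : S.IsAdmissible R t₀ t₁ O)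
    (D : SliceDomain t₀ t₁ b O φ Y) (hlat : S.LateralSign t₀ t₁ b O φ) {L : List (Fin 4)}
    (hL : L.length ≤ R) (m : Fin 3) {J₀ J c l A K : ℝ} (hJ₀ : 0 < J₀) (hJ : J₀ ≤ J) (hc : 0 ≤ c)
    (hl : 0 < l) (hK : 0 ≤ K) (hsmall : ∀ τ ∈ Ioo t₀ t₁, ∀ μ,
      CoeffBound (region (Ioo t₀ t₁) O) (O τ) R (max 1 R) (S.δM μ) τ (c * |τ|⁻¹)) {B : ℝ → ℝ≥0∞}
    (hF : S.Forced t₀ t₁ O L m B)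
    (hB : ∀ τ ∈ Ioo t₀ t₁, B τ ≤ ENNReal.ofReal (K * ((|τ| ^ (2 * J))⁻¹ * |τ|⁻¹ ^ 2)))
    (hA : ∀ τ ∈ Ioo t₀ t₁, |τ| ^ (2 * J) * S.wordEnergy O L m τ ≤ A) {s t : ℝ} (hs : t₀ < s)
    (hst : s ≤ t) (ht : t < t₁) :
    Real.exp (-2) / 2 * (|t| ^ (2 * J) * S.wordEnergy O L m t) ≤
      2 * (|s| ^ (2 * J) * S.wordEnergy O L m s) + ((16000 * c + l) * A + l⁻¹ * K) / J₀ := by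
  have hneg : ∀ τ, τ < t₁ → τ < 0 := fun τ h => by have := D.le_neg_one; linarith
  have ht0 := hneg t ht
  have hs0 : s < 0 := by linarith
  have hA0 : 0 ≤ A := (mul_nonneg (by positivity) (S.wordEnergy_nonneg O L m s)).trans
    (hA s ⟨hs, by linarith⟩)
  -- With exponent `2J` the errors would be `|τ|⁻¹` and integrate to a logarithm. Giving up `J₀`
  -- makes them `|τ|^(-1 - J₀)`, with integral at most a constant times `|t|^(-J₀) / J₀`;
  -- multiplication by `|t|^J₀` at the end restores the weight. Moreover `p ≥ J₀ > 0`, so the weight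
  -- decreases in time.
  set p := 2 * J - J₀ with hp
  have hsplit : ∀ τ : ℝ, τ < 0 → |τ| ^ p = |τ| ^ (2 * J) * |τ| ^ (-J₀) := fun τ hτ => by
    rw [hp, sub_eq_add_neg, Real.rpow_add (abs_pos.2 hτ.ne)]
  have hwd : ∀ q : Spacetime, q 0 < 0 → HasDerivAt (fun x : ℝ => (-x) ^ p)
      (-(p * (-q 0) ^ (p - 1))) (q 0) := fun q hq =>
    ((hasDerivAt_neg (q 0)).rpow_const (p := p) (Or.inl (by linarith))).congr_deriv (by ring)
  have hcoord : ∀ q : Spacetime, DifferentiableAt ℝ (fun q : Spacetime => q 0) q := fun q =>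
    differentiableAt_apply 0 q
  set K' := (16000 * c + l) * A + l⁻¹ * K with hK'
  have hK'0 : 0 ≤ K' := by positivity
  obtain ⟨hβi, hβ⟩ := integral_rpow_neg_le hJ₀ hK'0 hst ht0
  have key := hS.energy_inequality D hlat hL m (w := fun q => (-q 0) ^ p) (W := fun τ => |τ| ^ p)
    -- Here `ε = 1` would do; `exp (-2)` is used so that all three blocks have the same constant.
    (ε := Real.exp (-2)) (cM := fun τ => c * |τ|⁻¹) (l := fun τ => l * |τ|⁻¹)
    (fun q hq => ((contDiff_apply ℝ ℝ (0 : Fin 4)).neg.contDiffAt.rpow_const_of_ne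
      (by have : q 0 < 0 := hq; linarith)).contDiffWithinAt)
    (fun q hq => Real.rpow_nonneg (by linarith) _) (fun τ => Real.rpow_nonneg (abs_nonneg τ) _)
    (fun q hq => by
      have hq0 := hneg _ hq.1.2
      have e : ∀ μ, pd μ (fun q : Spacetime => (-q 0) ^ p) q =
          -(p * (-q 0) ^ (p - 1)) * (if μ = 0 then 1 else 0) := fun μ => by
        rw [pd_comp (η := fun x : ℝ => (-x) ^ p) (g := fun q => q 0) (hwd q hq0).differentiableAt
          (hcoord q), (hwd q hq0).deriv, pd_coord]
      rw [Finset.sum_eq_single 0]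
      · rw [e, if_pos rfl, mul_one]
        have h1 : 0 ≤ S.form L m 0 q :=
          le_trans (mul_nonneg (by norm_num) (wsq_nonneg _ _ _)) (hS.form_zero_ge L m hq)
        have h2 : 0 ≤ p * (-q 0) ^ (p - 1) :=
          mul_nonneg (by linarith) (Real.rpow_nonneg (by linarith) _)
        exact mul_nonpos_of_nonpos_of_nonneg (by linarith) h1
      · intro μ _ hμ
        rw [e, if_neg hμ]; ring
      · simp)
    (fun q hq => by
      rw [abs_of_neg (hneg _ hq.1.2)]
      exact mul_le_of_le_one_left (Real.rpow_nonneg (by have := hneg _ hq.1.2; linarith) _)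
        (Real.exp_le_one_iff.2 (by norm_num)))
    (fun q hq => by rw [abs_of_neg (hneg _ hq.1.2)])
    (fun τ => by positivity)
    (fun τ hτ => mul_pos hl (inv_pos.2 (abs_pos.2 (hneg τ hτ.2).ne)))
    hsmall hF (fun τ hτ => ne_top_of_le_ne_top ENNReal.ofReal_ne_top (hB τ hτ)) hs hst ht hβi
    (fun τ hτst => by
      have hτ : τ ∈ Ioo t₀ t₁ := ⟨hs.trans hτst.1, hτst.2.trans_lt ht⟩
      have hT : 0 < |τ| := abs_pos.2 (hneg τ hτ.2).ne
      have ha : 0 < |τ| ^ (2 * J) := Real.rpow_pos_of_pos hT _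
      have hd : 0 < |τ| ^ (-J₀) := Real.rpow_pos_of_pos hT _
      have h1 := ENNReal.toReal_mono ENNReal.ofReal_ne_top (hB τ hτ)
      rw [ENNReal.toReal_ofReal (by positivity)] at h1
      have h2 := hA τ hτ
      rw [hsplit τ (hneg τ hτ.2)]
      set E := S.wordEnergy O L m τ
      set a := |τ| ^ (2 * J)
      set d := |τ| ^ (-J₀)
      have h3 : a * |τ| ^ 2 * (B τ).toReal ≤ K := by
        calc _ ≤ a * |τ| ^ 2 * (K * (a⁻¹ * |τ|⁻¹ ^ 2)) := by gcongr
          _ = K := by field_simp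
      calc a * d * ((16000 * (c * |τ|⁻¹) + l * |τ|⁻¹) * E + (l * |τ|⁻¹)⁻¹ * (B τ).toReal)
          = d * |τ|⁻¹ * ((16000 * c + l) * (a * E) + l⁻¹ * (a * |τ| ^ 2 * (B τ).toReal)) := by
            field_simp
        _ ≤ d * |τ|⁻¹ * ((16000 * c + l) * A + l⁻¹ * K) := by gcongr
        _ = _ := by rw [hK']; ring)
  simp only [hsplit t ht0, hsplit s hs0] at key
  have h1 : |t| ^ (-J₀) * |t| ^ J₀ = 1 := by
    rw [← Real.rpow_add (abs_pos.2 ht0.ne), neg_add_cancel, Real.rpow_zero]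
  have h2 : |s| ^ (-J₀) * |t| ^ J₀ ≤ 1 := by
    rw [Real.rpow_neg (abs_nonneg s), inv_mul_le_one₀ (Real.rpow_pos_of_pos (abs_pos.2 hs0.ne) _)]
    refine Real.rpow_le_rpow (abs_nonneg t) ?_ hJ₀.le
    rw [abs_of_neg ht0, abs_of_neg hs0]; linarith
  have h3 := mul_le_mul_of_nonneg_right (key.trans (add_le_add le_rfl hβ))
    (Real.rpow_nonneg (abs_nonneg t) J₀)
  have hEs : 0 ≤ |s| ^ (2 * J) * S.wordEnergy O L m s :=
    mul_nonneg (by positivity) (S.wordEnergy_nonneg _ _ _ _)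
  calc Real.exp (-2) / 2 * (|t| ^ (2 * J) * S.wordEnergy O L m t)
      = Real.exp (-2) / 2 * (|t| ^ (2 * J) * S.wordEnergy O L m t) *
        (|t| ^ (-J₀) * |t| ^ J₀) := by rw [h1, mul_one]
    _ = Real.exp (-2) * (|t| ^ (2 * J) * |t| ^ (-J₀)) * (1 / 2 * S.wordEnergy O L m t) *
        |t| ^ J₀ := by ring
    _ ≤ _ := h3
    _ = 2 * (|s| ^ (2 * J) * S.wordEnergy O L m s) * (|s| ^ (-J₀) * |t| ^ J₀) +
        K' / J₀ * (|t| ^ (-J₀) * |t| ^ J₀) := by ring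
    _ ≤ _ := by
        rw [h1, mul_one]
        exact add_le_add (mul_le_of_le_one_right (by positivity) h2) le_rfl

theorem SystemData.IsAdmissible.form_one_eq (hS : S.IsAdmissible R t₀ t₁ O) (L : List (Fin 4))
    {q : Spacetime} (hq : q ∈ region (Ioo t₀ t₁) O) : S.form L 1 0 q = S.form L 1 3 q := by
  obtain ⟨c, hc⟩ := hS.M_second
  obtain ⟨h0, -, -, h3⟩ := hc q hq
  refine Finset.sum_congr rfl fun i _ => Finset.sum_congr rfl fun k _ => ?_
  have h := congrFun (congrFun (h0.trans h3.symm) i) k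
  simp only [matBlock, Matrix.of_apply] at h
  rw [h]

/-- For the second block, whose errors have no decay relative to the energy. Since `M⁰ = M³` and `M¹
= M² = 0` there, the weight `exp (q 0 - q 3)` is annihilated by the operator. It lies between `exp
(-2) exp τ` and `exp τ` because `0 < q 3 < b ≤ 2`, and the growth of `exp τ` makes the accumulated
errors comparable to their size at the final time. -/
theorem SystemData.IsAdmissible.word_transport (hS : S.IsAdmissible R t₀ t₁ O)
    (D : SliceDomain t₀ t₁ b O φ Y) (hlat : S.LateralSign t₀ t₁ b O φ) {L : List (Fin 4)}
    (hL : L.length ≤ R) {J c l A K : ℝ} (hJ : 0 ≤ J) (hc : 0 ≤ c) (hl : 0 < l) (hK : 0 ≤ K)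
    (hsmall : ∀ τ ∈ Ioo t₀ t₁, ∀ μ,
      CoeffBound (region (Ioo t₀ t₁) O) (O τ) R (max 1 R) (S.δM μ) τ (c * |τ|⁻¹)) {B : ℝ → ℝ≥0∞}
    (hF : S.Forced t₀ t₁ O L 1 B)
    (hB : ∀ τ ∈ Ioo t₀ t₁, B τ ≤ ENNReal.ofReal (K * (|τ| ^ (2 * J))⁻¹))
    (hA : ∀ τ ∈ Ioo t₀ t₁, |τ| ^ (2 * J) * S.wordEnergy O L 1 τ ≤ A) {s t : ℝ} (hs : t₀ < s)
    (hst : s ≤ t) (ht : t < t₁) :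
    Real.exp (-2) / 2 * (|t| ^ (2 * J) * S.wordEnergy O L 1 t) ≤
      2 * (|s| ^ (2 * J) * S.wordEnergy O L 1 s) + ((16000 * c + l) * A + l⁻¹ * K) := by
  have hneg : ∀ τ, τ < t₁ → τ < 0 := fun τ h => by have := D.le_neg_one; linarith
  have ht0 := hneg t ht
  have hs0 : s < 0 := by linarith
  have hA0 : 0 ≤ A := (mul_nonneg (by positivity) (S.wordEnergy_nonneg O L 1 s)).trans
    (hA s ⟨hs, by linarith⟩)
  set K' := (16000 * c + l) * A + l⁻¹ * K with hK'
  have hK'0 : 0 ≤ K' := by positivity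
  have hta : 0 < |t| ^ (2 * J) := Real.rpow_pos_of_pos (abs_pos.2 ht0.ne) _
  have hg : ∀ q : Spacetime, DifferentiableAt ℝ (fun q : Spacetime => q 0 - q 3) q := fun q =>
    (differentiableAt_apply 0 q).sub (differentiableAt_apply 3 q)
  have hpdw : ∀ μ q, pd μ (fun q : Spacetime => Real.exp (q 0 - q 3)) q =
      Real.exp (q 0 - q 3) * ((if μ = 0 then 1 else 0) - (if μ = 3 then 1 else 0)) := fun μ q => by
    rw [pd_comp (η := Real.exp) (g := fun q => q 0 - q 3) Real.differentiableAt_exp (hg q),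
      Real.deriv_exp, ← pd_coord 0 μ q, ← pd_coord 3 μ q]
    congr 1
    simp only [pd]
    rw [fderiv_fun_sub (differentiableAt_apply 0 q) (differentiableAt_apply 3 q)]
    rfl
  have key := hS.energy_inequality D hlat hL 1 (w := fun q => Real.exp (q 0 - q 3)) (W := Real.exp)
    (ε := Real.exp (-2)) (cM := fun τ => c * |τ|⁻¹) (l := fun _ => l)
    (β := fun τ => K' * (|t| ^ (2 * J))⁻¹ * Real.exp τ)
    (Real.contDiff_exp.comp ((contDiff_apply ℝ ℝ (0 : Fin 4)).sub
      (contDiff_apply ℝ ℝ (3 : Fin 4)))).contDiffOn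
    (fun q _ => (Real.exp_pos _).le) (fun τ => (Real.exp_pos _).le)
    (fun q hq => by
      simp only [hpdw, Fin.sum_univ_four, hS.form_one_eq L hq]
      simp)
    (fun q hq => by
      rw [← Real.exp_add]
      refine Real.exp_le_exp.2 ?_
      have := (D.mem_region_iff.1 hq).2.1.2
      have := D.b_le
      linarith)
    (fun q hq => Real.exp_le_exp.2 (by have := (D.mem_region_iff.1 hq).2.1.1; linarith))
    (fun τ => by positivity) (fun _ _ => hl) hsmall hF
    (fun τ hτ => ne_top_of_le_ne_top ENNReal.ofReal_ne_top (hB τ hτ)) hs hst ht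
    (Continuous.intervalIntegrable (by fun_prop) _ _)
    (fun τ hτst => by
      have hτ : τ ∈ Ioo t₀ t₁ := ⟨hs.trans hτst.1, hτst.2.trans_lt ht⟩
      have hτ0 := hneg τ hτ.2
      have hT : 0 < |τ| := abs_pos.2 hτ0.ne
      have ha : 0 < |τ| ^ (2 * J) := Real.rpow_pos_of_pos hT _
      have h1 := ENNReal.toReal_mono ENNReal.ofReal_ne_top (hB τ hτ)
      rw [ENNReal.toReal_ofReal (by positivity)] at h1
      have h2 : S.wordEnergy O L 1 τ ≤ A * (|τ| ^ (2 * J))⁻¹ := by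
        rw [← div_eq_mul_inv, le_div_iff₀ ha, mul_comm]; exact hA τ hτ
      have h3 : |τ|⁻¹ ≤ 1 := by
        refine inv_le_one_of_one_le₀ ?_
        rw [abs_of_neg hτ0]; have := D.le_neg_one; linarith [hτ.2]
      -- The decay factor increases towards the final time `t`, so it can be taken out of the
      -- integral, leaving the integral of `exp τ`, which is at most `exp t`.
      have h4 : (|τ| ^ (2 * J))⁻¹ ≤ (|t| ^ (2 * J))⁻¹ := by
        refine inv_anti₀ hta (Real.rpow_le_rpow (abs_nonneg t) ?_ (by linarith))
        rw [abs_of_neg hτ0, abs_of_neg ht0]; linarith [hτst.2]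
      calc Real.exp τ * ((16000 * (c * |τ|⁻¹) + l) * S.wordEnergy O L 1 τ +
            l⁻¹ * (B τ).toReal)
          ≤ Real.exp τ * ((16000 * (c * 1) + l) * (A * (|τ| ^ (2 * J))⁻¹) +
            l⁻¹ * (K * (|τ| ^ (2 * J))⁻¹)) := by
            have := S.wordEnergy_nonneg O L 1 τ
            gcongr
        _ = K' * (|τ| ^ (2 * J))⁻¹ * Real.exp τ := by rw [hK']; ring
        _ ≤ _ := by gcongr)
  rw [intervalIntegral.integral_const_mul, integral_exp] at key
  have h5 : Real.exp (-2) * Real.exp t * (1 / 2 * S.wordEnergy O L 1 t) ≤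
      Real.exp t * (2 * S.wordEnergy O L 1 s) + K' * (|t| ^ (2 * J))⁻¹ * Real.exp t := by
    refine key.trans (add_le_add (mul_le_mul_of_nonneg_right (Real.exp_le_exp.2 hst)
      (mul_nonneg zero_le_two (S.wordEnergy_nonneg _ _ _ _))) ?_)
    exact mul_le_mul_of_nonneg_left (by linarith [Real.exp_pos s]) (by positivity)
  have h6 : |t| ^ (2 * J) ≤ |s| ^ (2 * J) := by
    refine Real.rpow_le_rpow (abs_nonneg t) ?_ (by linarith)
    rw [abs_of_neg hs0, abs_of_neg ht0]; linarith
  have h7 : Real.exp (-2) * (1 / 2 * S.wordEnergy O L 1 t) ≤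
      2 * S.wordEnergy O L 1 s + K' * (|t| ^ (2 * J))⁻¹ := by
    refine le_of_mul_le_mul_left ?_ (Real.exp_pos t)
    linarith
  calc Real.exp (-2) / 2 * (|t| ^ (2 * J) * S.wordEnergy O L 1 t)
      = |t| ^ (2 * J) * (Real.exp (-2) * (1 / 2 * S.wordEnergy O L 1 t)) := by ring
    _ ≤ |t| ^ (2 * J) * (2 * S.wordEnergy O L 1 s + K' * (|t| ^ (2 * J))⁻¹) := by gcongr
    _ = 2 * (|t| ^ (2 * J) * S.wordEnergy O L 1 s) + K' := by field_simp
    _ ≤ _ := by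
        have := S.wordEnergy_nonneg O L 1 s
        gcongr

end

/-! ### The closing argument -/

/-- The choice of `l` and the bound on `k` make `N (16000 k + l) ≤ c / 2`, so half of the left-hand
side survives; the price is the factor `l⁻¹` on the forcing. -/
theorem absorb {c N l k A X Q : ℝ} (hc : 0 < c) (hN : 0 < N) (hl : l = c / (4 * N))
    (hk : 16000 * k ≤ l) (hA : 0 ≤ A) (h : c * A ≤ 2 * X + N * ((16000 * k + l) * A + l⁻¹ * Q)) :
    A ≤ 4 / c * X + 8 * N ^ 2 / c ^ 2 * Q := by
  have h1 : N * ((16000 * k + l) * A) ≤ c / 2 * A := by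
    calc _ ≤ N * ((l + l) * A) := by gcongr
      _ = c / 2 * A := by rw [hl]; field_simp; ring
  have h2 : N * (l⁻¹ * Q) = 4 * N ^ 2 / c * Q := by rw [hl]; field_simp
  have h3 : c / 2 * A ≤ 2 * X + 4 * N ^ 2 / c * Q := by rw [← h2]; linarith
  have h4 := mul_le_mul_of_nonneg_left h3 (by positivity : 0 ≤ 2 / c)
  calc A = 2 / c * (c / 2 * A) := by field_simp
    _ ≤ _ := h4
    _ = _ := by field_simp; ring

/-- Substitution down a triangular system: the successive constants are `3 G²`, `11 G⁴` and `29 G⁶`,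
and `3 + 11 + 29 = 43`. The variable `d` stands for the small multiple of the total that couples
back. -/
theorem hierarchy {G X x d A₀ A₁ A₂ : ℝ} (hG : 1 ≤ G) (hX : 0 ≤ X) (hx : 0 ≤ x) (hd : 0 ≤ d)
    (h0 : A₀ ≤ G * (X + 2 * G * (x + d)))
    (h1 : A₁ ≤ G * (X + (2 * G * A₀ + 4 * G * (x + d))))
    (h2 : A₂ ≤ G * (X + (2 * G * A₁ + 2 * G * d + 4 * G * (x + d)))) :
    A₀ + A₁ + A₂ ≤ 43 * G ^ 6 * (X + x + d) := by
  set y := X + x + d with hy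
  have hG0 : 0 ≤ G := by linarith
  have hy0 : 0 ≤ y := by positivity
  have b0 : A₀ ≤ 3 * G ^ 2 * y := by
    calc _ ≤ G * (G * y + 2 * G * y) := by
          refine h0.trans ?_
          gcongr
          · nlinarith
          · linarith
      _ = _ := by ring
  have b1 : A₁ ≤ 11 * G ^ 4 * y := by
    have e : G ^ 2 ≤ G ^ 4 := pow_le_pow_right₀ hG (by norm_num)
    have e1 : G ≤ G ^ 4 := le_self_pow₀ hG (by norm_num)
    calc _ ≤ G * (y + (2 * G * (3 * G ^ 2 * y) + 4 * G * y)) := by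
          refine h1.trans ?_
          gcongr <;> linarith
      _ = G * y + 6 * G ^ 4 * y + 4 * G ^ 2 * y := by ring
      _ ≤ G ^ 4 * y + 6 * G ^ 4 * y + 4 * G ^ 4 * y := by gcongr
      _ = _ := by ring
  have b2 : A₂ ≤ 29 * G ^ 6 * y := by
    have e : G ^ 2 ≤ G ^ 6 := pow_le_pow_right₀ hG (by norm_num)
    have e1 : G ≤ G ^ 6 := le_self_pow₀ hG (by norm_num)
    calc _ ≤ G * (y + (2 * G * (11 * G ^ 4 * y) + 2 * G * y + 4 * G * y)) := by
          refine h2.trans ?_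
          gcongr <;> linarith
      _ = G * y + 22 * G ^ 6 * y + 6 * G ^ 2 * y := by ring
      _ ≤ G ^ 6 * y + 22 * G ^ 6 * y + 6 * G ^ 6 * y := by gcongr
      _ = _ := by ring
  have e : G ^ 2 * y ≤ G ^ 6 * y :=
    mul_le_mul_of_nonneg_right (pow_le_pow_right₀ hG (by norm_num)) hy0
  have e1 : G ^ 4 * y ≤ G ^ 6 * y :=
    mul_le_mul_of_nonneg_right (pow_le_pow_right₀ hG (by norm_num)) hy0
  linarith

/-- The system of inequalities for the suprema of the weighted energies of the three blocks. -/
structure ClosingSystem (N Rc F J₀ h₁ h₂ h₃ l X c₁ c₂ ε A₀ A₁ A₂ : ℝ) : Prop where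
  zero : Real.exp (-2) / 2 * A₀ ≤ 2 * X + N * (((16000 * c₂ + l) * A₀ +
    l⁻¹ * (Rc * (c₁ ^ 2 + 2 * c₂ ^ 2 * (A₀ + A₁ + A₂)))) / J₀)
  one : Real.exp (-2) / 2 * A₁ ≤ 2 * X + N * ((16000 * c₂ + l) * A₁ +
    l⁻¹ * (2 * (h₁ ^ 2 * A₀ + Rc * (c₁ ^ 2 + 2 * c₂ ^ 2 * (A₀ + A₁ + A₂)))))
  two : Real.exp (-2) / 2 * A₂ ≤ 2 * X + N * (((16000 * c₂ + l) * A₂ +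
    l⁻¹ * (2 * (2 * (F * h₂ ^ 2 * A₁ + F * h₃ ^ 2 * ε ^ 2 * A₂) +
      Rc * (c₁ ^ 2 + 2 * c₂ ^ 2 * (A₀ + A₁ + A₂))))) / J₀)

/-- First the self-interaction of each block is absorbed by the choice of `l`, then the triangular
hierarchy is solved. What feeds back has the coefficient `c₂ ^ 2` or `ε ^ 2`, and is absorbed in the
total for small `c₃`. -/
theorem exists_closing_constants {N Rc F J₀ : ℝ} (h₁ h₂ h₃ : ℝ) (hN : 0 < N) (hRc : 0 ≤ Rc)
    (hF : 0 ≤ F) : ∃ c₃ ∈ Ioo (0 : ℝ) 1, ∃ l > 0, ∃ C > 0,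
      ∀ X c₁ c₂ ε A₀ A₁ A₂ : ℝ, 0 ≤ X → 0 ≤ c₂ → c₂ ≤ c₃ → 0 ≤ ε → ε ≤ c₃ → 0 ≤ A₀ → 0 ≤ A₁ →
        0 ≤ A₂ → ClosingSystem N Rc F J₀ h₁ h₂ h₃ l X c₁ c₂ ε A₀ A₁ A₂ →
          A₀ + A₁ + A₂ ≤ C * (X + c₁ ^ 2) := by
  obtain ⟨c, hcdef⟩ : ∃ c, c = Real.exp (-2) / 2 := ⟨_, rfl⟩
  have hc : 0 < c := by rw [hcdef]; positivity
  -- One number that covers both the blocks with the factor `1 / J₀` and the transport block without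
  -- it.
  obtain ⟨N', hN'def⟩ : ∃ N', N' = N * max J₀⁻¹ 1 := ⟨_, rfl⟩
  have hN' : 0 < N' := hN'def ▸ mul_pos hN (lt_max_of_lt_right one_pos)
  obtain ⟨l, hl⟩ : ∃ l, l = c / (4 * N') := ⟨_, rfl⟩
  have hl0 : 0 < l := by rw [hl]; positivity
  obtain ⟨G, hG⟩ : ∃ G, G = 1 + (4 / c + 8 * N' ^ 2 / c ^ 2 + Rc + h₁ ^ 2 + 2 * F * h₂ ^ 2 +
    2 * F * h₃ ^ 2) := ⟨_, rfl⟩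
  have g1 : 0 ≤ 4 / c := by positivity
  have g2 : 0 ≤ 8 * N' ^ 2 / c ^ 2 := by positivity
  have g3 : 0 ≤ h₁ ^ 2 := sq_nonneg _
  have g4 : 0 ≤ 2 * F * h₂ ^ 2 := by positivity
  have g5 : 0 ≤ 2 * F * h₃ ^ 2 := by positivity
  have hG1 : 1 ≤ G := by linarith
  have hG0 : 0 < G := by linarith
  have hG6 : 1 ≤ G ^ 6 := one_le_pow₀ hG1
  -- The first entry makes the feedback `43 G⁶ c₃² A` at most `A / 2`; the second gives `16000 c₂ ≤
  -- l`, as `absorb` requires.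
  obtain ⟨c₃, hc₃⟩ : ∃ c₃, c₃ = min (1 / (86 * G ^ 6)) (l / 16000) := ⟨_, rfl⟩
  have hc₃0 : 0 < c₃ := hc₃ ▸ lt_min (by positivity) (by positivity)
  have hc₃1 : c₃ * (86 * G ^ 6) ≤ 1 := by
    rw [← le_div_iff₀ (by positivity), hc₃]; exact min_le_left _ _
  have hc₃2 : c₃ < 1 := by
    refine (hc₃ ▸ min_le_left _ _ : c₃ ≤ 1 / (86 * G ^ 6)).trans_lt ?_
    rw [div_lt_one (by positivity)]; linarith
  have hc₃3 : 16000 * c₃ ≤ l := by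
    have := min_le_right (1 / (86 * G ^ 6)) (l / 16000)
    rw [← hc₃] at this; linarith
  refine ⟨c₃, ⟨hc₃0, hc₃2⟩, l, hl0, 86 * G ^ 6, by positivity, ?_⟩
  intro X c₁ c₂ ε A₀ A₁ A₂ hX hc₂ hc₂3 hε hε3 hA₀ hA₁ hA₂ hsys
  have hk : 16000 * c₂ ≤ l := by linarith
  obtain ⟨z0, z1, z2⟩ := hsys
  obtain ⟨A, hA⟩ : ∃ A, A = A₀ + A₁ + A₂ := ⟨_, rfl⟩
  rw [← hcdef, ← hA] at z0 z1 z2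
  have hA0 : 0 ≤ A := by rw [hA]; positivity
  have hsq : c₂ ^ 2 ≤ c₃ ^ 2 := by gcongr
  have hsq' : ε ^ 2 ≤ c₃ ^ 2 := by gcongr
  obtain ⟨d, hd⟩ : ∃ d, d = c₃ ^ 2 * A := ⟨_, rfl⟩
  have hd0 : 0 ≤ d := by rw [hd]; positivity
  have hscale : ∀ Z, 0 ≤ Z → N * (Z / J₀) ≤ N' * Z := fun Z hZ => by
    calc N * (Z / J₀) = N * J₀⁻¹ * Z := by ring
      _ ≤ _ := by rw [hN'def]; gcongr; exact le_max_left _ _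
  have hscale' : ∀ Z, 0 ≤ Z → N * Z ≤ N' * Z := fun Z hZ => by
    rw [hN'def]
    exact mul_le_mul_of_nonneg_right (le_mul_of_one_le_right hN.le (le_max_right _ _)) hZ
  have hcomb : ∀ Q A', 0 ≤ Q → A' ≤ 4 / c * X + 8 * N' ^ 2 / c ^ 2 * Q → A' ≤ G * (X + Q) :=
    fun Q A' hQ h => by
      have e1 : 4 / c * X ≤ G * X := mul_le_mul_of_nonneg_right (by linarith) hX
      have e2 : 8 * N' ^ 2 / c ^ 2 * Q ≤ G * Q := mul_le_mul_of_nonneg_right (by linarith) hQ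
      linarith
  obtain ⟨Q₀, hQ₀⟩ : ∃ Q, Q = Rc * (c₁ ^ 2 + 2 * c₂ ^ 2 * A) := ⟨_, rfl⟩
  have hQ₀0 : 0 ≤ Q₀ := by rw [hQ₀]; positivity
  have hQ₀le : Q₀ ≤ 2 * G * (c₁ ^ 2 + d) := by
    have e1 : c₂ ^ 2 * A ≤ d := hd ▸ mul_le_mul_of_nonneg_right hsq hA0
    have e3 : c₁ ^ 2 + 2 * c₂ ^ 2 * A ≤ 2 * (c₁ ^ 2 + d) := by linarith [sq_nonneg c₁, mul_assoc 2 (c₂ ^ 2) A]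
    calc Q₀ ≤ G * (2 * (c₁ ^ 2 + d)) := hQ₀ ▸
          mul_le_mul (by linarith) e3 (by positivity) hG0.le
      _ = _ := by ring
  obtain ⟨Q₁, hQ₁⟩ : ∃ Q, Q = 2 * (h₁ ^ 2 * A₀ + Q₀) := ⟨_, rfl⟩
  have hQ₁0 : 0 ≤ Q₁ := by rw [hQ₁]; positivity
  have hQ₁le : Q₁ ≤ 2 * G * A₀ + 4 * G * (c₁ ^ 2 + d) := by
    have e1 : h₁ ^ 2 * A₀ ≤ G * A₀ := mul_le_mul_of_nonneg_right (by linarith) hA₀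
    linarith
  obtain ⟨Q₂, hQ₂⟩ : ∃ Q, Q = 2 * (2 * (F * h₂ ^ 2 * A₁ + F * h₃ ^ 2 * ε ^ 2 * A₂) + Q₀) := ⟨_, rfl⟩
  have hQ₂0 : 0 ≤ Q₂ := by rw [hQ₂]; positivity
  have hQ₂le : Q₂ ≤ 2 * G * A₁ + 2 * G * d + 4 * G * (c₁ ^ 2 + d) := by
    have e1 : 2 * F * h₂ ^ 2 * A₁ ≤ G * A₁ := mul_le_mul_of_nonneg_right (by linarith) hA₁
    have e2 : ε ^ 2 * A₂ ≤ d := hd ▸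
      mul_le_mul hsq' (by linarith) hA₂ (sq_nonneg _)
    have e3 : 2 * F * h₃ ^ 2 * (ε ^ 2 * A₂) ≤ G * d :=
      mul_le_mul (by linarith) e2 (by positivity) hG0.le
    linarith
  rw [← hQ₀] at z0 z1 z2
  rw [← hQ₁] at z1
  rw [← hQ₂] at z2
  have b0 : A₀ ≤ G * (X + 2 * G * (c₁ ^ 2 + d)) := by
    refine (hcomb Q₀ A₀ hQ₀0 (absorb hc hN' hl hk hA₀ (z0.trans
      (add_le_add le_rfl (hscale _ (by positivity)))))).trans ?_
    gcongr
  have b1 : A₁ ≤ G * (X + (2 * G * A₀ + 4 * G * (c₁ ^ 2 + d))) := by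
    refine (hcomb Q₁ A₁ hQ₁0 (absorb hc hN' hl hk hA₁ (z1.trans
      (add_le_add le_rfl (hscale' _ (by positivity)))))).trans ?_
    gcongr
  have b2 : A₂ ≤ G * (X + (2 * G * A₁ + 2 * G * d + 4 * G * (c₁ ^ 2 + d))) := by
    refine (hcomb Q₂ A₂ hQ₂0 (absorb hc hN' hl hk hA₂ (z2.trans
      (add_le_add le_rfl (hscale _ (by positivity)))))).trans ?_
    gcongr
  have hfin := hierarchy hG1 hX (sq_nonneg c₁) hd0 b0 b1 b2
  have hsmall : 43 * G ^ 6 * d ≤ 1 / 2 * A := by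
    have e1 : c₃ ^ 2 ≤ c₃ := by rw [sq]; exact mul_le_of_le_one_left hc₃0.le hc₃2.le
    calc 43 * G ^ 6 * d ≤ 43 * G ^ 6 * (c₃ * A) := by rw [hd]; gcongr
      _ = 1 / 2 * (c₃ * (86 * G ^ 6)) * A := by ring
      _ ≤ 1 / 2 * 1 * A := by gcongr
      _ = _ := by ring
  rw [← hA] at hfin
  linarith

/-! ### From the decay hypotheses to the closing system -/

section

variable {P : Fin 3 → ℕ} {t₀ t₁ b : ℝ} {O : ℝ → Set Space} {φ : Spacetime → ℝ}
  {Y : Fin 4 → Spacetime → ℝ} {S : SystemData P} {R : ℕ}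

theorem SystemData.IsAdmissible.block_le (hS : S.IsAdmissible R t₀ t₁ O)
    (D : SliceDomain t₀ t₁ b O φ Y) (m : Fin 3) {c p K : ℝ}
    (h : ∀ α ∈ multiIndices R, ∀ s t, t₀ < s → s ≤ t → t < t₁ →
      c * (|t| ^ p * S.wordEnergy O (word α) m t) ≤
        2 * (|s| ^ p * S.wordEnergy O (word α) m s) + K) {t : ℝ} (ht : t ∈ Ioo t₀ t₁) :
    c * (|t| ^ p * S.blockEnergy R O m t) ≤
      2 * (|t₀| ^ p * (S.fieldEnergy R t₀ t₁ O t₀).toReal) + (multiIndices R).card * K := by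
  refine hS.le_of_forall_early D ht m fun s hs => ?_
  have := Finset.sum_le_sum fun α hα => h α hα s t hs.1 hs.2 ht.2
  simpa only [SystemData.blockEnergy, Finset.sum_add_distrib, ← Finset.mul_sum, Finset.sum_const, nsmul_eq_mul] using this

/-- The weighted energies are bounded a priori, because energies are bounded by compact support and
`|τ| ≤ |t₀|`; absorption is therefore legitimate. The last clause turns inequalities at all times
into inequalities for the supremum. -/
theorem SystemData.IsAdmissible.exists_sup (hS : S.IsAdmissible R t₀ t₁ O)
    (D : SliceDomain t₀ t₁ b O φ Y) {p : ℝ} (hp : 0 ≤ p) (m : Fin 3) :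
    ∃ A : ℝ, 0 ≤ A ∧ (∀ τ ∈ Ioo t₀ t₁, |τ| ^ p * S.blockEnergy R O m τ ≤ A) ∧
      ∀ c X : ℝ, 0 < c → (∀ τ ∈ Ioo t₀ t₁, c * (|τ| ^ p * S.blockEnergy R O m τ) ≤ X) →
        c * A ≤ X := by
  obtain ⟨C, hC⟩ := hS.exists_blockEnergy_le D
  set s := (fun τ => |τ| ^ p * S.blockEnergy R O m τ) '' Ioo t₀ t₁ with hs
  have hne : s.Nonempty := (nonempty_Ioo.2 D.lt).image _
  have hnn : ∀ y ∈ s, 0 ≤ y := by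
    rintro _ ⟨τ, _, rfl⟩
    exact mul_nonneg (by positivity) (S.blockEnergy_nonneg _ _ _ _)
  have hbdd : BddAbove s := by
    refine ⟨|t₀| ^ p * C, ?_⟩
    rintro _ ⟨τ, hτ, rfl⟩
    have h1 : |τ| ≤ |t₀| := by
      have := D.le_neg_one; have := D.lt
      rw [abs_of_neg (by linarith [hτ.2]), abs_of_neg (by linarith)]; linarith [hτ.1]
    exact mul_le_mul (Real.rpow_le_rpow (abs_nonneg _) h1 hp) (hC m τ hτ)
      (S.blockEnergy_nonneg _ _ _ _) (by positivity)
  refine ⟨sSup s, Real.sSup_nonneg hnn, fun τ hτ => le_csSup hbdd ⟨τ, hτ, rfl⟩,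
    fun c X hc h => ?_⟩
  rw [← le_div_iff₀' hc]
  refine csSup_le hne ?_
  rintro _ ⟨τ, hτ, rfl⟩
  rw [le_div_iff₀' hc]
  exact h τ hτ

theorem le_ofReal_of_mul_le {a d : ℝ} (ha : 0 < a) {e : ℝ≥0∞}
    (h : ENNReal.ofReal a * e ≤ ENNReal.ofReal d) : e ≤ ENNReal.ofReal (d * a⁻¹) := by
  rw [← div_eq_mul_inv, ENNReal.ofReal_div_of_pos ha, ENNReal.le_div_iff_mul_le
    (Or.inl (by simpa using ha)) (Or.inl ENNReal.ofReal_ne_top), mul_comm]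
  exact h

theorem mul_le_ofReal {X Z : ℝ≥0∞} {x z : ℝ} (hx : 0 ≤ x) (hX : X ≤ ENNReal.ofReal x)
    (hZ : Z ≤ ENNReal.ofReal z) : X * Z ≤ ENNReal.ofReal (x * z) := by
  rw [ENNReal.ofReal_mul hx]; exact mul_le_mul' hX hZ

theorem add_le_ofReal {X Z : ℝ≥0∞} {x z : ℝ} (hx : 0 ≤ x) (hz : 0 ≤ z) (hX : X ≤ ENNReal.ofReal x)
    (hZ : Z ≤ ENNReal.ofReal z) : X + Z ≤ ENNReal.ofReal (x + z) := by
  rw [ENNReal.ofReal_add hx hz]; exact add_le_add hX hZ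

theorem SystemData.coeffSmall_of_decay {c : ℝ} (ht₁ : t₁ ≤ -1)
    (h : (4 ≤ R ∧ S.CoeffEnergyDecay R t₀ t₁ O c) ∨ S.CoeffSupDecay R t₀ t₁ O c) {τ : ℝ}
    (hτ : τ ∈ Ioo t₀ t₁) : S.CoeffSmall R t₀ t₁ O 0 τ (c * |τ|⁻¹) (c * |τ|⁻¹) ∧
      S.CoeffSmall R t₀ t₁ O 1 τ (c * |τ|⁻¹) c ∧
      S.CoeffSmall R t₀ t₁ O 2 τ (c * |τ|⁻¹) (c * |τ|⁻¹) := by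
  have hT : 0 < |τ| := abs_pos.2 (by linarith [hτ.2] : τ < 0).ne
  rcases h with ⟨h4, h⟩ | h
  · obtain ⟨hM, hH⟩ := h τ hτ
    have e : c ^ 2 * (|τ| ^ 2)⁻¹ = (c * |τ|⁻¹) ^ 2 := by rw [mul_pow, inv_pow]
    have hT2 : 0 < |τ| ^ 2 := by positivity
    have hM' : ∀ μ, CoeffBound (region (Ioo t₀ t₁) O) (O τ) R (max 1 R) (S.δM μ) τ (c * |τ|⁻¹) :=
      fun μ => Or.inl ⟨h4, by rw [← e]; exact le_ofReal_of_mul_le hT2 (hM μ)⟩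
    exact ⟨⟨hM', fun n => Or.inl ⟨h4, by rw [← e]; exact le_ofReal_of_mul_le hT2 (hH n).1⟩⟩,
      ⟨hM', fun n => Or.inl ⟨h4, (hH n).2.1⟩⟩,
      ⟨hM', fun n => Or.inl ⟨h4, by rw [← e]; exact le_ofReal_of_mul_le hT2 (hH n).2.2⟩⟩⟩
  · obtain ⟨hM, hH⟩ := h τ hτ
    have hM' : ∀ μ, CoeffBound (region (Ioo t₀ t₁) O) (O τ) R (max 1 R) (S.δM μ) τ (c * |τ|⁻¹) :=
      fun μ => Or.inr (le_ofReal_of_mul_le hT (hM μ))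
    exact ⟨⟨hM', fun n => Or.inr (le_ofReal_of_mul_le hT (hH n).1)⟩,
      ⟨hM', fun n => Or.inr (hH n).2.1⟩,
      ⟨hM', fun n => Or.inr (le_ofReal_of_mul_le hT (hH n).2.2)⟩⟩

/-- The suprema bound every energy in the forcing terms by `A m |τ|^(-2J)`. With the source decay,
the squared forcing then has exactly the decay expected by `word_decay` for the outer blocks and by
`word_transport` for the middle one. -/
theorem SystemData.IsAdmissible.closingSystem (hS : S.IsAdmissible R t₀ t₁ O)
    (D : SliceDomain t₀ t₁ b O φ Y) (hlat : S.LateralSign t₀ t₁ b O φ) {J₀ J c₁ c₂ l : ℝ}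
    (hJ₀ : 0 < J₀) (hJ : J₀ ≤ J) (hl : 0 < l) (hsrc : S.SourceDecay R t₀ t₁ O J c₁)
    (hc₂ : 0 < c₂)
    (hcoeff : (4 ≤ R ∧ S.CoeffEnergyDecay R t₀ t₁ O c₂) ∨ S.CoeffSupDecay R t₀ t₁ O c₂) :
    ∃ A : Fin 3 → ℝ, (∀ m, 0 ≤ A m) ∧
      (∀ m, ∀ τ ∈ Ioo t₀ t₁, |τ| ^ (2 * J) * S.blockEnergy R O m τ ≤ A m) ∧
      ClosingSystem (multiIndices R).card (remainderConst R) (4 ^ 2 ^ R * (R.factorial : ℝ) ^ 2) J₀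
        (matNorm S.H₁) (matNorm S.H₂) (matNorm S.H₃) l
        (|t₀| ^ (2 * J) * (S.fieldEnergy R t₀ t₁ O t₀).toReal) c₁ c₂ |t₁|⁻¹ (A 0) (A 1) (A 2) := by
  choose A hA0 hA hsup using fun m => hS.exists_sup D (p := 2 * J) (by linarith) m
  refine ⟨A, hA0, hA, ?_⟩
  have hneg : ∀ τ, τ < t₁ → τ < 0 := fun τ h => by have := D.le_neg_one; linarith
  have hRc : 0 ≤ remainderConst R := by rw [remainderConst]; positivity
  have hAs : 0 ≤ A 0 + A 1 + A 2 := add_nonneg (add_nonneg (hA0 0) (hA0 1)) (hA0 2)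
  have hblock : ∀ m, ∀ τ ∈ Ioo t₀ t₁, S.blockEnergy R O m τ ≤ A m * (|τ| ^ (2 * J))⁻¹ :=
    fun m τ hτ => by
      rw [← div_eq_mul_inv, le_div_iff₀ (Real.rpow_pos_of_pos (abs_pos.2 (hneg τ hτ.2).ne) _),
        mul_comm]
      exact hA m τ hτ
  have hword : ∀ m, ∀ α ∈ multiIndices R, ∀ τ ∈ Ioo t₀ t₁,
      |τ| ^ (2 * J) * S.wordEnergy O (word α) m τ ≤ A m := fun m α hα τ hτ =>
    (mul_le_mul_of_nonneg_left (S.wordEnergy_le_blockEnergy O hα m τ) (by positivity)).trans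
      (hA m τ hτ)
  have hE : ∀ m, ∀ τ ∈ Ioo t₀ t₁, energy (region (Ioo t₀ t₁) O) (O τ) R (vecBlock m S.Θ) τ ≤
      ENNReal.ofReal (A m * (|τ| ^ (2 * J))⁻¹) := fun m τ hτ => by
    rw [hS.energy_vecBlock_eq D m hτ]
    exact ENNReal.ofReal_le_ofReal (hblock m τ hτ)
  have hEt : ∀ τ ∈ Ioo t₀ t₁, energy (region (Ioo t₀ t₁) O) (O τ) R S.Θ τ ≤
      ENNReal.ofReal ((A 0 + A 1 + A 2) * (|τ| ^ (2 * J))⁻¹) := fun τ hτ => by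
    refine (hS.fieldEnergy_eq D hτ).trans_le (ENNReal.ofReal_le_ofReal ?_)
    rw [Fin.sum_univ_three]
    linarith [hblock 0 τ hτ, hblock 1 τ hτ, hblock 2 τ hτ]
  have hsrc' : ∀ τ ∈ Ioo t₀ t₁,
      energy (region (Ioo t₀ t₁) O) (O τ) R (vecBlock 0 S.Src) τ ≤
        ENNReal.ofReal (c₁ ^ 2 * ((|τ| ^ (2 * J))⁻¹ * |τ|⁻¹ ^ 2)) ∧
      energy (region (Ioo t₀ t₁) O) (O τ) R (vecBlock 1 S.Src) τ ≤
        ENNReal.ofReal (c₁ ^ 2 * (|τ| ^ (2 * J))⁻¹) ∧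
      energy (region (Ioo t₀ t₁) O) (O τ) R (vecBlock 2 S.Src) τ ≤
        ENNReal.ofReal (c₁ ^ 2 * ((|τ| ^ (2 * J))⁻¹ * |τ|⁻¹ ^ 2)) := fun τ hτ => by
    have hT : 0 < |τ| := abs_pos.2 (hneg τ hτ.2).ne
    obtain ⟨h0, h1, h2⟩ := hsrc τ hτ
    have e : (|τ| ^ (2 * J))⁻¹ * |τ|⁻¹ ^ 2 = (|τ| ^ (2 * J + 2))⁻¹ := by
      rw [Real.rpow_add hT, mul_inv, Real.rpow_two, inv_pow]
    rw [e]
    exact ⟨le_ofReal_of_mul_le (Real.rpow_pos_of_pos hT _) h0,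
      le_ofReal_of_mul_le (Real.rpow_pos_of_pos hT _) h1,
      le_ofReal_of_mul_le (Real.rpow_pos_of_pos hT _) h2⟩
  have hsmall := fun τ (hτ : τ ∈ Ioo t₀ t₁) =>
    SystemData.coeffSmall_of_decay D.le_neg_one hcoeff hτ
  have hcM : ∀ τ, 0 ≤ c₂ * |τ|⁻¹ := fun τ => by positivity
  have hexp : 0 < Real.exp (-2) / 2 := by positivity
  have hone : ∀ τ ∈ Ioo t₀ t₁, |τ|⁻¹ ≤ |t₁|⁻¹ ∧ |τ|⁻¹ ≤ 1 := fun τ hτ => by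
    have := D.le_neg_one
    have h1 : |t₁| ≤ |τ| := by
      rw [abs_of_neg (hneg τ hτ.2), abs_of_neg (by linarith)]; linarith [hτ.2]
    have h2 : 1 ≤ |t₁| := by rw [abs_of_neg (by linarith)]; linarith
    exact ⟨inv_anti₀ (by linarith) h1, inv_le_one_of_one_le₀ (h2.trans h1)⟩
  refine ⟨hsup 0 _ _ hexp fun τ hτ => ?_, hsup 1 _ _ hexp fun τ hτ => ?_,
    hsup 2 _ _ hexp fun τ hτ => ?_⟩
  · refine hS.block_le D 0 (fun α hα s t hs hst ht => ?_) hτ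
    refine hS.word_decay D hlat (length_word_le hα) 0 hJ₀ hJ hc₂.le hl (by positivity)
      (fun τ hτ => (hsmall τ hτ).1.1)
      (hS.forced_zero D (length_word_le hα) hcM hcM fun τ hτ => (hsmall τ hτ).1)
      (fun τ hτ => ?_) (hword 0 α hα) hs hst ht
    refine (mul_le_ofReal hRc le_rfl (add_le_ofReal (by positivity) (by positivity)
      (hsrc' τ hτ).1 (mul_le_ofReal (by positivity) le_rfl (hEt τ hτ)))).trans
      (ENNReal.ofReal_le_ofReal (le_of_eq ?_))
    ring
  · refine hS.block_le D 1 (fun α hα s t hs hst ht => ?_) hτ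
    refine hS.word_transport D hlat (length_word_le hα) (by linarith) hc₂.le hl ?_
      (fun τ hτ => (hsmall τ hτ).2.1.1)
      (hS.forced_one D (length_word_le hα) hcM (fun _ => hc₂.le) fun τ hτ => (hsmall τ hτ).2.1)
      (fun τ hτ => ?_) (hword 1 α hα) hs hst ht
    · have := hA0 0
      positivity
    have h0 := hA0 0
    refine (mul_le_ofReal zero_le_two (by simp) (add_le_ofReal (by positivity) (by positivity)
      (mul_le_ofReal (by positivity) le_rfl (hE 0 τ hτ)) (mul_le_ofReal hRc le_rfl
        (add_le_ofReal (by positivity) (by positivity) (hsrc' τ hτ).2.1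
          (mul_le_ofReal (by positivity) le_rfl (hEt τ hτ)))))).trans
      (ENNReal.ofReal_le_ofReal ?_)
    -- In the middle row `H - H_∞` is small without decay; the better decay of `M - M_∞` is not
    -- needed here.
    have h2 : (c₂ * |τ|⁻¹) ^ 2 + c₂ ^ 2 ≤ 2 * c₂ ^ 2 := by
      have : (c₂ * |τ|⁻¹) ^ 2 ≤ c₂ ^ 2 := by
        gcongr
        exact mul_le_of_le_one_right hc₂.le (hone τ hτ).2
      linarith
    calc _ ≤ 2 * (1 ^ 2 * matNorm S.H₁ ^ 2 * (A 0 * (|τ| ^ (2 * J))⁻¹) + remainderConst R *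
          (c₁ ^ 2 * (|τ| ^ (2 * J))⁻¹ + 2 * c₂ ^ 2 *
            ((A 0 + A 1 + A 2) * (|τ| ^ (2 * J))⁻¹))) := by gcongr
      _ = _ := by ring
  · have h1 := hA0 1
    have h2 := hA0 2
    refine hS.block_le D 2 (fun α hα s t hs hst ht => ?_) hτ
    refine hS.word_decay D hlat (length_word_le hα) 2 hJ₀ hJ hc₂.le hl (by positivity)
      (fun τ hτ => (hsmall τ hτ).2.2.1)
      (hS.forced_two D (length_word_le hα) hcM hcM fun τ hτ => (hsmall τ hτ).2.2)
      (fun τ hτ => ?_) (hword 2 α hα) hs hst ht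
    have e4 : (4 ^ 2 ^ R : ℝ≥0∞) ≤ ENNReal.ofReal (4 ^ 2 ^ R) := by
      rw [ENNReal.ofReal_pow (by norm_num)]; simp
    refine (mul_le_ofReal zero_le_two (by simp) (add_le_ofReal (by positivity) (by positivity)
      (mul_le_ofReal zero_le_two (by simp) (add_le_ofReal (by positivity) (by positivity)
        (mul_le_ofReal (by positivity) e4 (mul_le_ofReal (by positivity) le_rfl (hE 1 τ hτ)))
        (mul_le_ofReal (by positivity) e4 (mul_le_ofReal (by positivity) le_rfl (hE 2 τ hτ)))))
      (mul_le_ofReal hRc le_rfl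
        (add_le_ofReal (by positivity) (by positivity) (hsrc' τ hτ).2.2
          (mul_le_ofReal (by positivity) le_rfl (hEt τ hτ)))))).trans
      (ENNReal.ofReal_le_ofReal ?_)
    have h3 := (hone τ hτ).1
    calc _ = 2 * (2 * (4 ^ 2 ^ R * (R.factorial : ℝ) ^ 2 * matNorm S.H₂ ^ 2 * A 1 +
          4 ^ 2 ^ R * (R.factorial : ℝ) ^ 2 * matNorm S.H₃ ^ 2 * |τ|⁻¹ ^ 2 * A 2) +
          remainderConst R * (c₁ ^ 2 + 2 * c₂ ^ 2 * (A 0 + A 1 + A 2))) *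
            ((|τ| ^ (2 * J))⁻¹ * |τ|⁻¹ ^ 2) := by ring
      _ ≤ _ := by gcongr

/-- The energy estimate on a general family of domains. -/
theorem exists_energy_estimate (R : ℕ) {J₀ : ℝ} (hJ₀ : 0 < J₀) (h₁ h₂ h₃ : ℝ) :
    ∃ c₃ ∈ Ioo (0 : ℝ) 1, ∃ c₄ > (0 : ℝ), ∀ (P : Fin 3 → ℕ) (S : SystemData P)
      (t₀ t₁ b J c₁ c₂ : ℝ) (O : ℝ → Set Space) (φ : Spacetime → ℝ) (Y : Fin 4 → Spacetime → ℝ),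
      SliceDomain t₀ t₁ b O φ Y → S.LateralSign t₀ t₁ b O φ → S.IsAdmissible R t₀ t₁ O →
      matNorm S.H₁ = h₁ → matNorm S.H₂ = h₂ → matNorm S.H₃ = h₃ → J₀ ≤ J → 0 ≤ c₁ →
      S.SourceDecay R t₀ t₁ O J c₁ → 0 < c₂ →
      ((4 ≤ R ∧ S.CoeffEnergyDecay R t₀ t₁ O c₂) ∨ S.CoeffSupDecay R t₀ t₁ O c₂) →
      c₂ ≤ c₃ → |t₁|⁻¹ ≤ c₃ →
      S.fieldEnergy R t₀ t₁ O t₀ < ∞ ∧ ∀ τ ∈ Ioo t₀ t₁, S.fieldEnergy R t₀ t₁ O τ < ∞ ∧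
        √(S.fieldEnergy R t₀ t₁ O τ).toReal ≤
          c₄ * ((|t₀| ^ J * √(S.fieldEnergy R t₀ t₁ O t₀).toReal + c₁) / |τ| ^ J) := by
  have hN : (0 : ℝ) < (multiIndices R).card := by
    have : (0 : Fin 4 → ℕ) ∈ multiIndices R := by simp [multiIndices]
    exact_mod_cast Finset.card_pos.2 ⟨_, this⟩
  obtain ⟨c₃, hc₃, l, hl, C, hC, hclose⟩ := exists_closing_constants (J₀ := J₀) h₁ h₂ h₃ hN
    (Rc := remainderConst R) (by rw [remainderConst]; positivity)
    (F := 4 ^ 2 ^ R * (R.factorial : ℝ) ^ 2) (by positivity)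
  refine ⟨c₃, hc₃, √C, Real.sqrt_pos.2 hC, ?_⟩
  rintro P S t₀ t₁ b J c₁ c₂ O φ Y D hlat hS rfl rfl rfl hJ hc₁ hsrc hc₂ hcoeff hc₂3 ht₁3
  obtain ⟨A, hA0, hA, hsys⟩ := hS.closingSystem D hlat hJ₀ hJ hl hsrc hc₂ hcoeff
  set E₀ := (S.fieldEnergy R t₀ t₁ O t₀).toReal with hE₀
  have hE₀0 : 0 ≤ E₀ := ENNReal.toReal_nonneg
  have hle := hclose _ c₁ c₂ |t₁|⁻¹ (A 0) (A 1) (A 2) (by positivity) hc₂.le hc₂3 (by positivity)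
    ht₁3 (hA0 0) (hA0 1) (hA0 2) hsys
  refine ⟨hS.fieldEnergy_initial_lt_top D, fun τ hτ => ⟨?_, ?_⟩⟩
  · rw [hS.fieldEnergy_eq D hτ]; exact ENNReal.ofReal_lt_top
  have hτ0 : τ < 0 := by have := D.le_neg_one; linarith [hτ.2]
  have hT : 0 < |τ| ^ J := Real.rpow_pos_of_pos (abs_pos.2 hτ0.ne) _
  have hsq : ∀ x : ℝ, |x| ^ (2 * J) = (|x| ^ J) ^ 2 := fun x => by
    rw [mul_comm, Real.rpow_mul (abs_nonneg x), Real.rpow_two]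
  rw [hS.fieldEnergy_eq D hτ, ENNReal.toReal_ofReal
    (Finset.sum_nonneg fun _ _ => S.blockEnergy_nonneg _ _ _ _), ← mul_div_assoc, le_div_iff₀ hT]
  refine (pow_le_pow_iff_left₀ (by positivity) (by positivity) two_ne_zero).1 ?_
  have hsum : |τ| ^ (2 * J) * ∑ m, S.blockEnergy R O m τ ≤ A 0 + A 1 + A 2 := by
    rw [Fin.sum_univ_three]
    linarith [hA 0 τ hτ, hA 1 τ hτ, hA 2 τ hτ]
  rw [hsq] at hsum hle
  have hnn : 0 ≤ ∑ m, S.blockEnergy R O m τ :=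
    Finset.sum_nonneg fun _ _ => S.blockEnergy_nonneg _ _ _ _
  calc (√(∑ m, S.blockEnergy R O m τ) * |τ| ^ J) ^ 2
      = (|τ| ^ J) ^ 2 * ∑ m, S.blockEnergy R O m τ := by rw [mul_pow, Real.sq_sqrt hnn, mul_comm]
    _ ≤ C * ((|t₀| ^ J) ^ 2 * E₀ + c₁ ^ 2) := hsum.trans hle
    -- A sum of squares is at most the square of the sum of nonnegative numbers; taking roots gives
    -- the constant `√C`.
    _ ≤ C * (|t₀| ^ J * √E₀ + c₁) ^ 2 := by
        gcongr
        have h1 : 0 ≤ |t₀| ^ J * √E₀ * c₁ := by positivity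
        have h2 : (|t₀| ^ J * √E₀) ^ 2 = (|t₀| ^ J) ^ 2 * E₀ := by
          rw [mul_pow, Real.sq_sqrt hE₀0]
        linarith [add_sq (|t₀| ^ J * √E₀) c₁]
    _ = _ := by rw [mul_pow, Real.sq_sqrt hC.le]

end

/-! ### Slabs -/

theorem volume_box (l u : Space) : volume (univ.pi fun i => Ioo (l i) (u i)) =
    ENNReal.ofReal (u 0 - l 0) * ENNReal.ofReal (u 1 - l 1) * ENNReal.ofReal (u 2 - l 2) := by
  rw [Real.volume_pi_Ioo, Fin.prod_univ_three]

theorem measurableSet_box (l u : Space) : MeasurableSet (univ.pi fun i => Ioo (l i) (u i)) :=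
  MeasurableSet.univ_pi fun _ => measurableSet_Ioo

theorem mem_box {l u x : Space} : (x ∈ univ.pi fun i => Ioo (l i) (u i)) ↔
    x 0 ∈ Ioo (l 0) (u 0) ∧ x 1 ∈ Ioo (l 1) (u 1) ∧ x 2 ∈ Ioo (l 2) (u 2) := by
  simp only [mem_univ_pi, Fin.forall_fin_succ, Fin.succ_zero_eq_one, Fin.succ_one_eq_two,
    IsEmpty.forall_iff, and_true]

theorem norm_space_le {x : Space} {r : ℝ} (hr : 0 ≤ r) :
    ‖x‖ ≤ r ↔ |x 0| ≤ r ∧ |x 1| ≤ r ∧ |x 2| ≤ r := by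
  rw [pi_norm_le_iff_of_nonneg hr]
  simp only [Fin.forall_fin_succ, Fin.succ_zero_eq_one, Fin.succ_one_eq_two,
    IsEmpty.forall_iff, and_true, Real.norm_eq_abs]

/-- A slab has no lateral boundary, so the constant `1` is a defining function and no outward field
is needed. The box near a point is a unit square times `(0, b)`. -/
theorem sliceDomain_slab {t₀ t₁ b : ℝ} (h : t₀ < t₁) (ht₁ : t₁ ≤ -1) (hb : b ∈ Icc (1 : ℝ) 2) :
    SliceDomain t₀ t₁ b (fun _ => slab b) (fun _ => 1) fun _ _ => 0 where
  lt := h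
  le_neg_one := ht₁
  b_le := hb.2
  mem_iff t _ x := by simp [slab]
  smooth := contDiffOn_const
  anti _ _ _ _ := subset_rfl
  convex _ _ := (convex_Ioo 0 b).is_linear_preimage (IsLinearMap.mk (fun _ _ => rfl) fun _ _ => rfl)
  exists_box t _ x hx := by
    refine ⟨univ.pi fun i => Ioo ((![x 0, x 1, 0] : Space) i) ((![x 0 + 1, x 1 + 1, b] : Space) i),
      fun y hy => (mem_box.1 hy).2.2, measurableSet_box _ _, ?_, fun y hy => ?_⟩
    · rw [volume_box]
      simp only [Matrix.cons_val_zero, Matrix.cons_val_one, Matrix.cons_val, add_sub_cancel_left,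
        ENNReal.ofReal_one, one_mul, sub_zero]
      exact ENNReal.ofReal_le_ofReal (by linarith [hb.1])
    · obtain ⟨h0, h1, h2⟩ := mem_box.1 hy
      simp only [Matrix.cons_val_zero, Matrix.cons_val_one, Matrix.cons_val, mem_Ioo] at h0 h1 h2
      have hx2 : x 2 ∈ Ioo 0 b := hx
      have hb2 := hb.2
      rw [norm_space_le (by norm_num)]
      simp only [Pi.sub_apply, abs_le]
      exact ⟨⟨by linarith, by linarith⟩, ⟨by linarith, by linarith⟩,
        ⟨by linarith [hx2.2], by linarith [hx2.1]⟩⟩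
  Y_smooth _ := contDiff_const
  Y_zero _ := rfl
  Y_three _ := rfl
  Y_low _ _ _ := rfl
  Y_support := ⟨0, fun _ _ _ _ => rfl⟩
  Y_flux _ _ := by simp
  Y_flux_lt _ _ _ _ h := absurd h one_ne_zero

/-! ### Disk bundles -/

/-- The radius without absolute values, as a function of the time and the last coordinate. -/
def smoothRadius (b t y : ℝ) : ℝ := 1 / 4 + 500 / 9 * ((b + 1 / 1000 - y) * (1 / 500 - (y - t)⁻¹))

section

variable {b t y : ℝ}

theorem inv_sub_mem (ht : t < -1000) (hy : 0 < y) : (y - t)⁻¹ ∈ Ioo (0 : ℝ) (1 / 1000) := by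
  refine ⟨inv_pos.2 (by linarith), ?_⟩
  rw [one_div]
  exact inv_strictAnti₀ (by norm_num) (by linarith)

theorem radius_eq (ht : t < -1000) (hy : y ∈ Ioo 0 b) : radius b t y = smoothRadius b t y := by
  have h1 := inv_sub_mem ht hy.1
  have h2 : y + |t| = y - t := by rw [abs_of_neg (by linarith)]; ring
  rw [radius, smoothRadius, dd, h2, abs_of_pos (by linarith [hy.2]), one_div (y - t),
    abs_of_pos (by linarith [h1.2])]
  ring

theorem smoothRadius_mem (hb : b ≤ 2) (ht : t < -1000) (hy : y ∈ Ioo 0 b) :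
    smoothRadius b t y ∈ Ioo (1 / 4 : ℝ) 1 := by
  have h1 := inv_sub_mem ht hy.1
  have h2 : 0 < b + 1 / 1000 - y := by linarith [hy.2]
  have h3 : 0 < 1 / 500 - (y - t)⁻¹ := by linarith [h1.2]
  have h4 : (b + 1 / 1000 - y) * (1 / 500 - (y - t)⁻¹) ≤ 3 * (1 / 500) :=
    mul_le_mul (by linarith [hy.1]) (by linarith [h1.1]) h3.le (by norm_num)
  have h5 := mul_pos h2 h3
  rw [smoothRadius]
  exact ⟨by linarith, by linarith⟩

theorem smoothRadius_anti {s : ℝ} (hst : s ≤ t) (ht : t < -1000) (hy : y ∈ Ioo 0 b) :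
    smoothRadius b t y ≤ smoothRadius b s y := by
  have h1 : (y - s)⁻¹ ≤ (y - t)⁻¹ := inv_anti₀ (by linarith [hy.1]) (by linarith)
  have h2 : 0 ≤ b + 1 / 1000 - y := by linarith [hy.2]
  rw [smoothRadius, smoothRadius]
  gcongr

theorem inv_convex_le {a c z w : ℝ} (ha : 0 ≤ a) (hc : 0 ≤ c) (hac : a + c = 1) (hz : 0 < z)
    (hw : 0 < w) : (a * z + c * w)⁻¹ ≤ a * z⁻¹ + c * w⁻¹ := by
  have h0 : 0 < a * z + c * w := by
    rcases ha.eq_or_lt with rfl | h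
    · have : c = 1 := by linarith
      simp [this, hw]
    · positivity
  rw [inv_le_iff_one_le_mul₀ h0]
  have h1 : (a * z⁻¹ + c * w⁻¹) * (a * z + c * w) =
      (a + c) ^ 2 + a * c * (z - w) ^ 2 * (z⁻¹ * w⁻¹) := by field_simp; ring
  rw [h1, hac]
  have : 0 ≤ a * c * (z - w) ^ 2 * (z⁻¹ * w⁻¹) := by positivity
  linarith

/-- Up to an affine function of `y` the radius is a negative multiple of the convex function `1 / (y
- t)`. Concavity of the radius is what makes the slices convex. -/
theorem smoothRadius_concave (ht : t < -1000) {y' a c : ℝ} (hy : y ∈ Ioo 0 b) (hy' : y' ∈ Ioo 0 b)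
    (ha : 0 ≤ a) (hc : 0 ≤ c) (hac : a + c = 1) :
    a * smoothRadius b t y + c * smoothRadius b t y' ≤ smoothRadius b t (a * y + c * y') := by
  -- With `β = b + 1/1000`, this is `(β - y) / (y - t) = (β - t) / (y - t) - 1`.
  have hform : ∀ y, 0 < y → smoothRadius b t y =
      1 / 4 + 500 / 9 * ((b + 1 / 1000 - y) * (1 / 500) + 1 - (b + 1 / 1000 - t) * (y - t)⁻¹) :=
    fun y hy => by
      have : y - t ≠ 0 := by linarith
      rw [smoothRadius]; field_simp; ring
  have hpos : 0 < a * y + c * y' := by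
    rcases ha.eq_or_lt with rfl | h
    · have : c = 1 := by linarith
      simpa [this] using hy'.1
    · have := hy.1; have := hy'.1; positivity
  rw [hform _ hy.1, hform _ hy'.1, hform _ hpos]
  have h1 := inv_convex_le ha hc hac (z := y - t) (w := y' - t) (by linarith [hy.1])
    (by linarith [hy'.1])
  have h2 : a * (y - t) + c * (y' - t) = a * y + c * y' - t := by linear_combination -t * hac
  rw [h2] at h1
  have h3 := mul_le_mul_of_nonneg_left h1 (by linarith [hy.1, hy.2] : 0 ≤ b + 1 / 1000 - t)
  have h4 : a = 1 - c := by linarith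
  subst h4
  linarith

/-- A defining function of the disk bundle. -/
def diskFun (ξ₀ : EuclideanSpace ℝ (Fin 2)) (b : ℝ) (q : Spacetime) : ℝ :=
  smoothRadius b (q 0) (q 3) ^ 2 - ((q 1 - ξ₀ 0) ^ 2 + (q 2 - ξ₀ 1) ^ 2)

variable {ξ₀ : EuclideanSpace ℝ (Fin 2)}

theorem norm_disk_sq (ξ₀ : EuclideanSpace ℝ (Fin 2)) (x y : ℝ) :
    ‖(!₂[x, y] : EuclideanSpace ℝ (Fin 2)) - ξ₀‖ ^ 2 = (x - ξ₀ 0) ^ 2 + (y - ξ₀ 1) ^ 2 := by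
  rw [EuclideanSpace.norm_sq_eq, Fin.sum_univ_two]
  simp

theorem mem_diskBundle_iff (ht : t < -1000) (x : Space) :
    x ∈ diskBundle ξ₀ b t ↔ x 2 ∈ Ioo 0 b ∧
      ‖(!₂[x 0, x 1] : EuclideanSpace ℝ (Fin 2)) - ξ₀‖ < smoothRadius b t (x 2) := by
  rw [diskBundle, mem_ofPred_eq, Metric.mem_ball, dist_eq_norm]
  exact and_congr_right fun h => by rw [radius_eq ht h]

theorem mem_diskBundle_iff_diskFun (hb : b ≤ 2) (ht : t < -1000) (x : Space) :
    x ∈ diskBundle ξ₀ b t ↔ x 2 ∈ Ioo 0 b ∧ 0 < diskFun ξ₀ b (pt t x) := by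
  rw [mem_diskBundle_iff ht]
  refine and_congr_right fun h => ?_
  have h1 := (smoothRadius_mem hb ht h).1
  rw [← sq_lt_sq₀ (norm_nonneg _) (by linarith), norm_disk_sq, ← sub_pos]
  rfl

theorem hasFDerivAt_diskFun {q : Spacetime} (hq : q 0 < 0 ∧ 0 < q 3) :
    HasFDerivAt (diskFun ξ₀ b) ((2 * smoothRadius b (q 0) (q 3)) • ((500 / 9 : ℝ) •
      ((b + 1 / 1000 - q 3) • (((q 3 - q 0) ^ 2)⁻¹ • (ContinuousLinearMap.proj (R := ℝ)
        (φ := fun _ : Fin 4 => ℝ) 3 - ContinuousLinearMap.proj 0)) -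
          (1 / 500 - (q 3 - q 0)⁻¹) • ContinuousLinearMap.proj 3)) -
      ((2 * (q 1 - ξ₀ 0)) • ContinuousLinearMap.proj 1 +
        (2 * (q 2 - ξ₀ 1)) • ContinuousLinearMap.proj 2)) q := by
  have hp : ∀ i, HasFDerivAt (fun q : Spacetime => q i)
      (ContinuousLinearMap.proj (R := ℝ) (φ := fun _ : Fin 4 => ℝ) i) q := fun i =>
    hasFDerivAt_apply i q
  have hz : q 3 - q 0 ≠ 0 := by linarith [hq.1, hq.2]
  have hinv : HasFDerivAt (fun q : Spacetime => (q 3 - q 0)⁻¹) _ q :=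
    (hasDerivAt_inv hz).comp_hasFDerivAt q ((hp 3).sub (hp 0))
  have hr : HasFDerivAt (fun q : Spacetime => smoothRadius b (q 0) (q 3)) _ q :=
    ((((hp 3).const_sub (b + 1 / 1000)).mul (hinv.const_sub (1 / 500))).const_mul
      (500 / 9)).const_add (1 / 4)
  have h := (hr.pow 2).sub ((((hp 1).sub_const (ξ₀ 0)).pow 2).add
    (((hp 2).sub_const (ξ₀ 1)).pow 2))
  refine h.congr_fderiv ?_
  ext v
  simp
  ring

theorem pd_diskFun {q : Spacetime} (hq : q 0 < 0 ∧ 0 < q 3) :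
    pd 0 (diskFun ξ₀ b) q = -2 * smoothRadius b (q 0) (q 3) *
      (500 / 9 * ((b + 1 / 1000 - q 3) * ((q 3 - q 0) ^ 2)⁻¹)) ∧
    pd 1 (diskFun ξ₀ b) q = -2 * (q 1 - ξ₀ 0) ∧ pd 2 (diskFun ξ₀ b) q = -2 * (q 2 - ξ₀ 1) ∧
    pd 3 (diskFun ξ₀ b) q = -2 * smoothRadius b (q 0) (q 3) *
      (500 / 9 * (1 / 500 - (q 3 - q 0)⁻¹) -
        500 / 9 * ((b + 1 / 1000 - q 3) * ((q 3 - q 0) ^ 2)⁻¹)) := by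
  simp only [pd, (hasFDerivAt_diskFun hq).fderiv]
  refine ⟨?_, ?_, ?_, ?_⟩
  all_goals simp
  all_goals ring

theorem contDiffOn_diskFun : ContDiffOn ℝ 1 (diskFun ξ₀ b) {q | q 0 < 0 ∧ 0 < q 3} := by
  have hp : ∀ i, ContDiffOn ℝ 1 (fun q : Spacetime => q i) {q | q 0 < 0 ∧ 0 < q 3} := fun i =>
    (contDiff_apply ℝ ℝ i).contDiffOn
  have hinv : ContDiffOn ℝ 1 (fun q : Spacetime => (q 3 - q 0)⁻¹) {q | q 0 < 0 ∧ 0 < q 3} :=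
    ((hp 3).sub (hp 0)).inv fun q hq => by
      have h1 : q 0 < 0 := hq.1
      have h2 : 0 < q 3 := hq.2
      linarith
  have hr : ContDiffOn ℝ 1 (fun q : Spacetime => smoothRadius b (q 0) (q 3))
      {q | q 0 < 0 ∧ 0 < q 3} :=
    contDiffOn_const.add (contDiffOn_const.mul
      ((contDiffOn_const.sub (hp 3)).mul (contDiffOn_const.sub hinv)))
  exact (hr.pow 2).sub ((((hp 1).sub contDiffOn_const).pow 2).add
    (((hp 2).sub contDiffOn_const).pow 2))

/-- The radial field, cut off at small values of the last coordinate. -/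
def diskField (ξ₀ : EuclideanSpace ℝ (Fin 2)) (μ : Fin 4) (q : Spacetime) : ℝ :=
  Real.smoothTransition (4 * q 3 - 1) * ![0, q 1 - ξ₀ 0, q 2 - ξ₀ 1, 0] μ

theorem diskFun_flux {q : Spacetime} (hq : q 0 < 0 ∧ 0 < q 3) :
    ∑ μ, pd μ (diskFun ξ₀ b) q * diskField ξ₀ μ q =
      -2 * Real.smoothTransition (4 * q 3 - 1) * ((q 1 - ξ₀ 0) ^ 2 + (q 2 - ξ₀ 1) ^ 2) := by
  obtain ⟨-, h1, h2, -⟩ := pd_diskFun (ξ₀ := ξ₀) (b := b) hq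
  rw [Fin.sum_univ_four, h1, h2]
  simp [diskField]
  ring

theorem abs_sub_le_of_mem_diskBundle (hb : b ≤ 2) (ht : t < -1000) {x : Space}
    (hx : x ∈ diskBundle ξ₀ b t) : |x 0 - ξ₀ 0| ≤ 1 ∧ |x 1 - ξ₀ 1| ≤ 1 ∧ |x 2| ≤ 2 := by
  obtain ⟨h2, h⟩ := (mem_diskBundle_iff ht x).1 hx
  have h1 := (smoothRadius_mem hb ht h2).2
  have h3 : ‖(!₂[x 0, x 1] : EuclideanSpace ℝ (Fin 2)) - ξ₀‖ ^ 2 ≤ 1 :=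
    pow_le_one₀ (norm_nonneg _) (by linarith)
  rw [norm_disk_sq] at h3
  refine ⟨?_, ?_, abs_le.2 ⟨by linarith [h2.1], by linarith [h2.2]⟩⟩
  · rw [← sq_le_one_iff_abs_le_one]; linarith [sq_nonneg (x 1 - ξ₀ 1)]
  · rw [← sq_le_one_iff_abs_le_one]; linarith [sq_nonneg (x 0 - ξ₀ 0)]

theorem convex_diskBundle (ht : t < -1000) : Convex ℝ (diskBundle ξ₀ b t) := by
  intro x hx y hy a c ha hc hac
  rw [mem_diskBundle_iff ht] at hx hy ⊢
  refine ⟨(convex_Ioo 0 b) hx.1 hy.1 ha hc hac, ?_⟩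
  have e : (!₂[(a • x + c • y) 0, (a • x + c • y) 1] : EuclideanSpace ℝ (Fin 2)) - ξ₀ =
      a • (!₂[x 0, x 1] - ξ₀) + c • (!₂[y 0, y 1] - ξ₀) := by
    ext i
    fin_cases i <;> simp <;> linear_combination ξ₀ _ * hac
  rw [e]
  refine lt_of_lt_of_le ?_ (smoothRadius_concave ht hx.1 hy.1 ha hc hac)
  refine (norm_add_le _ _).trans_lt ?_
  rw [norm_smul, norm_smul, Real.norm_of_nonneg ha, Real.norm_of_nonneg hc]
  rcases ha.eq_or_lt with rfl | h
  · have : c = 1 := by linarith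
    simpa [this] using hy.2
  · exact add_lt_add_of_lt_of_le (mul_lt_mul_of_pos_left hx.2 h)
      (mul_le_mul_of_nonneg_left hy.2.le hc)

/-- The radius lies in `(1/4, 1)`, decreases in time and is concave in `ū`. The lower bound gives a
fixed box around the axis inside every slice, the upper bound keeps it close to every point, and the
radial field points strictly outward where the radius is positive. -/
theorem sliceDomain_diskBundle {t₀ t₁ : ℝ} (h : t₀ < t₁) (ht₁ : t₁ < -1000)
    (hb : b ∈ Icc (1 : ℝ) 2) :
    SliceDomain t₀ t₁ b (diskBundle ξ₀ b) (diskFun ξ₀ b) (diskField ξ₀) where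
  lt := h
  le_neg_one := by linarith
  b_le := hb.2
  mem_iff t ht x := mem_diskBundle_iff_diskFun hb.2 (by linarith) x
  smooth := contDiffOn_diskFun
  anti s t hst ht x hx := by
    rw [mem_diskBundle_iff (by linarith)] at hx ⊢
    exact ⟨hx.1, hx.2.trans_le (smoothRadius_anti hst (by linarith) hx.1)⟩
  convex t ht := convex_diskBundle (by linarith)
  exists_box t ht x hx := by
    refine ⟨univ.pi fun i => Ioo ((![ξ₀ 0 - 1 / 8, ξ₀ 1 - 1 / 8, 0] : Space) i)
      ((![ξ₀ 0 + 1 / 8, ξ₀ 1 + 1 / 8, b] : Space) i), fun y hy => ?_, measurableSet_box _ _, ?_,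
      fun y hy => ?_⟩
    · obtain ⟨h0, h1, h2⟩ := mem_box.1 hy
      simp only [Matrix.cons_val_zero, Matrix.cons_val_one, Matrix.cons_val] at h0 h1 h2
      rw [mem_diskBundle_iff (by linarith)]
      refine ⟨h2, ?_⟩
      have h3 := (smoothRadius_mem hb.2 (by linarith : t < -1000) h2).1
      refine lt_of_pow_lt_pow_left₀ 2 (by linarith) ?_
      rw [norm_disk_sq]
      -- A square of half-side `1/8` fits in the disk of radius `1/4`, as `2 / 64 < 1 / 16`; the box
      -- has volume `b / 16 ≥ 1 / 64`.
      have h4 : (y 0 - ξ₀ 0) ^ 2 ≤ (1 / 8) ^ 2 := sq_le_sq' (by linarith [h0.1]) (by linarith [h0.2])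
      have h5 : (y 1 - ξ₀ 1) ^ 2 ≤ (1 / 8) ^ 2 := sq_le_sq' (by linarith [h1.1]) (by linarith [h1.2])
      have h6 : (1 / 4 : ℝ) ^ 2 < smoothRadius b t (y 2) ^ 2 := by gcongr
      linarith
    · rw [volume_box]
      simp only [Matrix.cons_val_zero, Matrix.cons_val_one, Matrix.cons_val]
      rw [← ENNReal.ofReal_mul (by linarith), ← ENNReal.ofReal_mul (by ring_nf; norm_num)]
      refine ENNReal.ofReal_le_ofReal ?_
      have := hb.1
      ring_nf
      linarith
    · obtain ⟨h0, h1, h2⟩ := mem_box.1 hy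
      simp only [Matrix.cons_val_zero, Matrix.cons_val_one, Matrix.cons_val, mem_Ioo] at h0 h1 h2
      obtain ⟨a0, a1, -⟩ := abs_sub_le_of_mem_diskBundle hb.2 (by linarith) hx
      have hx2 := hx.1
      have hb2 := hb.2
      rw [abs_le] at a0 a1
      rw [norm_space_le (by norm_num)]
      simp only [Pi.sub_apply, abs_le]
      exact ⟨⟨by linarith, by linarith⟩, ⟨by linarith, by linarith⟩,
        ⟨by linarith [hx2.2], by linarith [hx2.1]⟩⟩
  Y_smooth μ := by
    refine (Real.smoothTransition.contDiff.comp ((contDiff_const.mul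
      (contDiff_apply ℝ ℝ (3 : Fin 4))).sub contDiff_const)).mul ?_
    fin_cases μ
    · exact contDiff_const
    · exact (contDiff_apply ℝ ℝ (1 : Fin 4)).sub contDiff_const
    · exact (contDiff_apply ℝ ℝ (2 : Fin 4)).sub contDiff_const
    · exact contDiff_const
  Y_zero q := by simp [diskField]
  Y_three q := by simp [diskField]
  Y_low q hq μ := by
    rw [diskField, Real.smoothTransition.zero_of_nonpos (by linarith), zero_mul]
  Y_support := by
    refine ⟨|ξ₀ 0| + |ξ₀ 1| + 3, fun q hq h => absurd h (not_le.2 ?_)⟩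
    obtain ⟨a0, a1, a2⟩ := abs_sub_le_of_mem_diskBundle hb.2 (lt_trans hq.1.2 ht₁) hq.2
    have b0 : |sp q 0| ≤ |ξ₀ 0| + 1 := by
      have := abs_add_le (sp q 0 - ξ₀ 0) (ξ₀ 0)
      rw [sub_add_cancel] at this
      exact this.trans (by rw [add_comm]; exact add_le_add le_rfl a0)
    have b1 : |sp q 1| ≤ |ξ₀ 1| + 1 := by
      have := abs_add_le (sp q 1 - ξ₀ 1) (ξ₀ 1)
      rw [sub_add_cancel] at this
      exact this.trans (by rw [add_comm]; exact add_le_add le_rfl a1)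
    have c0 := abs_nonneg (ξ₀ 0)
    have c1 := abs_nonneg (ξ₀ 1)
    have : ‖sp q‖ ≤ |ξ₀ 0| + |ξ₀ 1| + 2 := by
      rw [norm_space_le (by positivity)]
      exact ⟨by linarith, by linarith, le_trans a2 (by linarith)⟩
    linarith
  Y_flux q hq := by
    have hq0 : q 0 < 0 := by linarith [hq.1.2]
    rw [diskFun_flux ⟨hq0, hq.2.1.1⟩]
    have := Real.smoothTransition.nonneg (4 * q 3 - 1)
    have : 0 ≤ Real.smoothTransition (4 * q 3 - 1) * ((q 1 - ξ₀ 0) ^ 2 + (q 2 - ξ₀ 1) ^ 2) := by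
      positivity
    linarith
  Y_flux_lt q h0 h3 hb3 hφ := by
    have hq0 : q 0 < 0 := by linarith [h0.2]
    rw [diskFun_flux ⟨hq0, by linarith⟩, Real.smoothTransition.one_of_one_le (by linarith)]
    have h1 := (smoothRadius_mem hb.2 (by linarith [h0.2] : q 0 < -1000)
      (⟨by linarith, hb3⟩ : q 3 ∈ Ioo 0 b)).1
    have h2 : 0 < smoothRadius b (q 0) (q 3) ^ 2 := by
      have : 0 < smoothRadius b (q 0) (q 3) := by linarith
      positivity
    rw [diskFun] at hφ
    linarith

end

/-! ### The lateral sign condition and the conormal -/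

variable {P : Fin 3 → ℕ} {S : SystemData P}

theorem lateralSign_slab (S : SystemData P) (t₀ t₁ b : ℝ) :
    S.LateralSign t₀ t₁ b (fun _ => slab b) fun _ => 1 := fun _ _ _ _ h => absurd h one_ne_zero

/-- Where the defining function vanishes, `|ξ - ξ₀|` equals the radius `r`, and `d(r² - |ξ - ξ₀|²) =
-2r (d|ξ - ξ₀| - dr)`; the bracket is `θ`. Thus `θ_μ M^μ ≥ 0` says that the flux of the energy
current against the differential of the defining function is nonpositive. -/
theorem conormal_eq {ξ₀ : EuclideanSpace ℝ (Fin 2)} {b : ℝ} (hb : b ≤ 2) {q : Spacetime}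
    (h0 : q 0 < -1000) (h3 : q 3 ∈ Ioo 0 b) (hφ : diskFun ξ₀ b q = 0) (μ : Fin 4) :
    pd μ (diskFun ξ₀ b) q = -2 * smoothRadius b (q 0) (q 3) * conormal ξ₀ b q μ := by
  have h1 := smoothRadius_mem hb h0 h3
  have h2 := inv_sub_mem h0 h3.1
  have hz : 0 < q 3 - q 0 := by linarith [h3.1]
  have hu : |q 0 - q 3| = q 3 - q 0 := by rw [abs_of_neg (by linarith)]; ring
  have hn : ‖(!₂[q 1, q 2] : EuclideanSpace ℝ (Fin 2)) - ξ₀‖ = smoothRadius b (q 0) (q 3) := by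
    refine (sq_eq_sq₀ (norm_nonneg _) (by linarith [h1.1])).1 ?_
    rw [norm_disk_sq]
    rw [diskFun] at hφ
    linarith
  have hr : smoothRadius b (q 0) (q 3) ≠ 0 := by linarith [h1.1]
  have hθ : |1 / (q 3 - q 0) - 2 * dd| = 1 / 500 - (q 3 - q 0)⁻¹ := by
    rw [one_div, dd, abs_of_neg (by linarith [h2.2])]; ring
  have hθ' : |b + dd - q 3| = b + 1 / 1000 - q 3 := by
    rw [dd, abs_of_pos (by linarith [h3.2])]
  obtain ⟨e0, e1, e2, e3⟩ := pd_diskFun (ξ₀ := ξ₀) (b := b) ⟨by linarith, h3.1⟩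
  have hk : 1 / (18 * dd) = 500 / 9 := by rw [dd]; norm_num
  simp only [conormal, hn, hu, hθ, hθ', hk]
  fin_cases μ
  · simp only [Fin.zero_eta, e0, Matrix.cons_val_zero]
    ring
  · refine e1.trans ?_
    change _ = -2 * smoothRadius b (q 0) (q 3) * ((q 1 - ξ₀ 0) / smoothRadius b (q 0) (q 3))
    field_simp
  · refine e2.trans ?_
    change _ = -2 * smoothRadius b (q 0) (q 3) * ((q 2 - ξ₀ 1) / smoothRadius b (q 0) (q 3))
    field_simp
  · simp only [Fin.reduceFinMk, e3, Matrix.cons_val]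
    ring

theorem lateralSign_diskBundle {t₀ t₁ b : ℝ} {ξ₀ : EuclideanSpace ℝ (Fin 2)} (h : t₀ < t₁)
    (ht₁ : t₁ < -1000) (hb : b ∈ Icc (1 : ℝ) 2) (hlat : S.LateralBoundaryNonTimelike t₀ t₁ ξ₀ b) :
    S.LateralSign t₀ t₁ b (diskBundle ξ₀ b) (diskFun ξ₀ b) := by
  intro q hq h0 h3 hφ v
  have D := sliceDomain_diskBundle (ξ₀ := ξ₀) h ht₁ hb
  have hq0 : q 0 < -1000 := by linarith [h0.2]
  -- A point of the closure where the defining function is zero is not in the open region, so it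
  -- lies on its frontier and the boundary hypothesis applies.
  have hf : q ∈ frontier (region (Ioo t₀ t₁) (diskBundle ξ₀ b)) := by
    rw [D.isOpen_region.frontier_eq]
    refine ⟨hq, fun hU => ?_⟩
    have := (D.mem_region_iff.1 hU).2.2
    linarith
  have hQ := hlat q hf h0 h3 v
  rw [Matrix.zero_mulVec, dotProduct_zero, Matrix.sum_mulVec, dotProduct_sum] at hQ
  simp only [Matrix.smul_mulVec, dotProduct_smul, smul_eq_mul] at hQ
  simp only [conormal_eq hb.2 hq0 h3 hφ, mul_assoc (-2 * smoothRadius b (q 0) (q 3)),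
    ← Finset.mul_sum]
  have h1 := (smoothRadius_mem hb.2 hq0 h3).1
  exact mul_nonpos_of_nonpos_of_nonneg (by linarith) hQ

end EnergyEstimate

end

theorem mainTheorem9 :
    -- the energy estimate on `(t₀, t₁) × ℝ² × (0, b)`
    (∀ (R : ℕ) (J₀ : ℝ), 0 < J₀ → ∀ h₁ h₂ h₃ : ℝ,
      ∃ c₃ ∈ Ioo (0 : ℝ) 1, ∃ c₄ > (0 : ℝ),
        ∀ (P : Fin 3 → ℕ), ∑ m, P m ≤ 10 ^ 9 → ∀ (S : SystemData P) (t₀ t₁ b J c₁ c₂ : ℝ),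
          t₀ < t₁ → t₁ ≤ -1 → b ∈ Icc (1 : ℝ) 2 →
          S.IsAdmissible R t₀ t₁ (fun _ => slab b) →
          matNorm S.H₁ = h₁ → matNorm S.H₂ = h₂ → matNorm S.H₃ = h₃ →
          J₀ ≤ J → 0 ≤ c₁ → S.SourceDecay R t₀ t₁ (fun _ => slab b) J c₁ →
          0 < c₂ →
          ((4 ≤ R ∧ S.CoeffEnergyDecay R t₀ t₁ (fun _ => slab b) c₂) ∨
            S.CoeffSupDecay R t₀ t₁ (fun _ => slab b) c₂) →
          c₂ ≤ c₃ → |t₁|⁻¹ ≤ c₃ →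
          S.fieldEnergy R t₀ t₁ (fun _ => slab b) t₀ < ∞ ∧
          ∀ τ ∈ Ioo t₀ t₁,
            S.fieldEnergy R t₀ t₁ (fun _ => slab b) τ < ∞ ∧
            √(S.fieldEnergy R t₀ t₁ (fun _ => slab b) τ).toReal ≤
              c₄ * ((|t₀| ^ J * √(S.fieldEnergy R t₀ t₁ (fun _ => slab b) t₀).toReal + c₁)
                / |τ| ^ J)) ∧
    -- the refined energy estimate on the disk bundles
    (∀ (R : ℕ) (J₀ : ℝ), 0 < J₀ → ∀ h₁ h₂ h₃ : ℝ,
      ∃ c₃ ∈ Ioo (0 : ℝ) 1, ∃ c₄ > (0 : ℝ),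
        ∀ (P : Fin 3 → ℕ), ∑ m, P m ≤ 10 ^ 9 → ∀ (S : SystemData P) (t₀ t₁ b J c₁ c₂ : ℝ)
          (ξ₀ : EuclideanSpace ℝ (Fin 2)),
          t₀ < t₁ → t₁ < -dd⁻¹ → b ∈ Icc (1 : ℝ) 2 →
          S.IsAdmissible R t₀ t₁ (diskBundle ξ₀ b) →
          matNorm S.H₁ = h₁ → matNorm S.H₂ = h₂ → matNorm S.H₃ = h₃ →
          J₀ ≤ J → 0 ≤ c₁ → S.SourceDecay R t₀ t₁ (diskBundle ξ₀ b) J c₁ →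
          0 < c₂ →
          ((4 ≤ R ∧ S.CoeffEnergyDecay R t₀ t₁ (diskBundle ξ₀ b) c₂) ∨
            S.CoeffSupDecay R t₀ t₁ (diskBundle ξ₀ b) c₂) →
          S.LateralBoundaryNonTimelike t₀ t₁ ξ₀ b →
          c₂ ≤ c₃ → |t₁|⁻¹ ≤ c₃ →
          S.fieldEnergy R t₀ t₁ (diskBundle ξ₀ b) t₀ < ∞ ∧
          ∀ τ ∈ Ioo t₀ t₁,
            S.fieldEnergy R t₀ t₁ (diskBundle ξ₀ b) τ < ∞ ∧
            √(S.fieldEnergy R t₀ t₁ (diskBundle ξ₀ b) τ).toReal ≤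
              c₄ * ((|t₀| ^ J * √(S.fieldEnergy R t₀ t₁ (diskBundle ξ₀ b) t₀).toReal + c₁)
                / |τ| ^ J)) := by
  refine ⟨fun R J₀ hJ₀ h₁ h₂ h₃ => ?_, fun R J₀ hJ₀ h₁ h₂ h₃ => ?_⟩
  · obtain ⟨c₃, hc₃, c₄, hc₄, h⟩ := exists_energy_estimate R hJ₀ h₁ h₂ h₃
    refine ⟨c₃, hc₃, c₄, hc₄, ?_⟩
    intro P _ S t₀ t₁ b J c₁ c₂ ht ht₁ hb hS e₁ e₂ e₃ hJ hc₁ hsrc hc₂ hcoeff hc ht₁'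
    exact h P S t₀ t₁ b J c₁ c₂ _ _ _ (sliceDomain_slab ht ht₁ hb) (lateralSign_slab S t₀ t₁ b) hS
      e₁ e₂ e₃ hJ hc₁ hsrc hc₂ hcoeff hc ht₁'
  · obtain ⟨c₃, hc₃, c₄, hc₄, h⟩ := exists_energy_estimate R hJ₀ h₁ h₂ h₃
    refine ⟨c₃, hc₃, c₄, hc₄, ?_⟩
    intro P _ S t₀ t₁ b J c₁ c₂ ξ₀ ht ht₁ hb hS e₁ e₂ e₃ hJ hc₁ hsrc hc₂ hcoeff hlat hc ht₁'
    have ht₁'' : t₁ < -1000 := by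
      have : -dd⁻¹ = -1000 := by norm_num [dd]
      rwa [this] at ht₁
    exact h P S t₀ t₁ b J c₁ c₂ _ _ _ (sliceDomain_diskBundle ht ht₁'' hb)
      (lateralSign_diskBundle ht ht₁'' hb hlat) hS e₁ e₂ e₃ hJ hc₁ hsrc hc₂ hcoeff hc ht₁'
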